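/- Let $q\in(0,1)$ and let $\zeta_-<0<\zeta_+$ be real numbers. Put $(z;q)_\infty=\prod_{i\ge 0}(1-zq^i)$, $(z_1,\dots,z_m;q)_\infty=\prod_j (z_j;q)_\infty$, $\theta_q(z)=(z,q/z;q)_\infty$ and $\theta_q(z_1,\dots,z_m)=\prod_j\theta_q(z_j)$, and let $$\mathfrak L=\zeta_-q^{\mathbb Z}\sqcup\zeta_+q^{\mathbb Z}\subset\mathbb R .$$ Let $(\gamma,\delta)\in\mathbb C^2$ be an admissible pair, that is, either $\delta=\overline\gamma\in\mathbb C\setminus\mathbb R$, or $\gamma,\delta$ are real and both lie in $(\zeta_-^{-1}q^{m},\zeta_-^{-1}q^{m+1})$ for some $m\in\mathbb Z$, or both lie in $(\zeta_+^{-1}q^{n+1},\zeta_+^{-1}q^{n})$ for some $n\in\mathbb Z$. If $\gamma\ne\delta$, let $$C=\frac{\theta_q(\gamma\zeta_-,\gamma\zeta_+,\delta\zeta_-,\delta\zeta_+)}{\zeta_+\,\theta_q(\zeta_- /\zeta_+,\ \gamma\delta\zeta_-\zeta_+)}\cdot\frac{\delta-\gamma}{\gamma\delta\,(\delta/\gamma,\gamma/\delta,q,q;q)_\infty},$$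 $$P(x)=\sqrt{|x|}\,\frac{\theta_q(x\delta)}{\sqrt{\theta_q(x\gamma,x\delta)}},\qquad Q(x)=\sqrt{|x|}\,\frac{\theta_q(x\gamma)}{\sqrt{\theta_q(x\gamma,x\delta)}},$$ for real $x$ near $\mathfrak L$ (with principal square roots; there $\theta_q(x\gamma,x\delta)>0$), and for $x,y\in\mathfrak L$ $$K^{\gamma,\delta}(x,y)=C\,\frac{P(x)Q(y)-Q(x)P(y)}{x-y}\quad(x\ne y),\qquad K^{\gamma,\delta}(x,x)=C\,\bigl(P'(x)Q(x)-Q'(x)P(x)\bigr).$$ If $\gamma=\delta$, let $K^{\gamma,\gamma}$ be the limit of this kernel as $\delta\to\gamma$, namely $$K^{\gamma,\gamma}(x,y)=\frac{\theta_q(\gamma\zeta_-,\gamma\zeta_+)^2}{\zeta_+\,(q;q)_\infty^4\,\theta_q(\zeta_- /\zeta_+,\ \gamma^2\zeta_-\zeta_+)}\cdot\frac{\sqrt{|xy|}}{x-y}\left(y\frac{\theta_q'(y\gamma)}{\theta_q(y\gamma)}-x\frac{\theta_q'(x\gamma)}{\theta_q(x\gamma)}\right)\qquad(x\ne y),$$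 with the value at $x=y$ given by L'Hôpital's rule. Then $$(Kf)(x)=\sum_{y\in\mathfrak L}K^{\gamma,\delta}(x,y)f(y),\qquad f\in\ell^2(\mathfrak L),\ x\in\mathfrak L,$$ converges and defines a bounded operator $K$ on the complex Hilbert space $\ell^2(\mathfrak L)$, and $K$ is an orthogonal projection: $K=K^*=K^2$. -/

import Mathlib

open scoped lp ENNReal

noncomputable section

namespace EllipticTail

/-- The `q`-Pochhammer symbol `(z; q)_∞ = ∏_{i ≥ 0} (1 - z q^i)`. -/
def qPoch (q : ℝ) (z : ℂ) : ℂ := ∏' i : ℕ, (1 - z * (q : ℂ) ^ i)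

/-- The theta function `θ_q(z) = (z; q)_∞ (q/z; q)_∞`. -/
def theta (q : ℝ) (z : ℂ) : ℂ := qPoch q z * qPoch q ((q : ℂ) / z)

/-- The two-sided `q`-lattice `ζ₋ q^ℤ ⊔ ζ₊ q^ℤ`, as a set of real numbers. -/
def lattice (q ζm ζp : ℝ) : Set ℝ :=
  {x : ℝ | ∃ n : ℤ, x = ζm * q ^ n ∨ x = ζp * q ^ n}

/-- Admissible pairs: the principal series (non-real complex conjugates) and the complementary
series (two reals in one and the same of the open intervals cut out on the real line minus the
origin by the points of `ζ₋⁻¹ q^ℤ` on the negative side and of `ζ₊⁻¹ q^ℤ` on the positive side). -/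
def Admissible (q ζm ζp : ℝ) (γ δ : ℂ) : Prop :=
  (γ.im ≠ 0 ∧ δ = (starRingEnd ℂ) γ) ∨
  ∃ a b : ℝ, γ = (a : ℂ) ∧ δ = (b : ℂ) ∧
    ((∃ m : ℤ, (ζm⁻¹ * q ^ m < a ∧ a < ζm⁻¹ * q ^ (m + 1)) ∧
        (ζm⁻¹ * q ^ m < b ∧ b < ζm⁻¹ * q ^ (m + 1))) ∨
      (∃ n : ℤ, (ζp⁻¹ * q ^ (n + 1) < a ∧ a < ζp⁻¹ * q ^ n) ∧
        (ζp⁻¹ * q ^ (n + 1) < b ∧ b < ζp⁻¹ * q ^ n)))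

/-- The constant `C(γ, δ)` in front of the kernel; meant for `γ ≠ δ`. -/
def constC (q ζm ζp : ℝ) (γ δ : ℂ) : ℂ :=
  theta q (γ * ζm) * theta q (γ * ζp) * theta q (δ * ζm) * theta q (δ * ζp) /
      (ζp * (theta q (ζm / ζp) * theta q (γ * δ * ζm * ζp))) *
    ((δ - γ) / (γ * δ * (qPoch q (δ / γ) * qPoch q (γ / δ) * qPoch q q * qPoch q q)))

/-- `P(x) = √|x| θ_q(xδ) / √(θ_q(xγ) θ_q(xδ))`, as a function of a real variable. At the points of
the lattice the radicand of the second root is a positive real number, so that the principal square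
root is smooth in a neighbourhood of each of them. -/
def P (q : ℝ) (γ δ : ℂ) (x : ℝ) : ℂ :=
  (Real.sqrt |x| : ℂ) * (theta q (x * δ) / Complex.sqrt (theta q (x * γ) * theta q (x * δ)))

/-- `Q(x) = √|x| θ_q(xγ) / √(θ_q(xγ) θ_q(xδ))`. -/
def Q (q : ℝ) (γ δ : ℂ) (x : ℝ) : ℂ :=
  (Real.sqrt |x| : ℂ) * (theta q (x * γ) / Complex.sqrt (theta q (x * γ) * theta q (x * δ)))

/-- The elliptic tail kernel for `γ ≠ δ`; on the diagonal it is given by L'Hôpital's rule. -/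
def kernelNe (q ζm ζp : ℝ) (γ δ : ℂ) (x y : ℝ) : ℂ :=
  if x = y then
    constC q ζm ζp γ δ *
      (deriv (P q γ δ) x * Q q γ δ x - deriv (Q q γ δ) x * P q γ δ x)
  else
    constC q ζm ζp γ δ *
      ((P q γ δ x * Q q γ δ y - Q q γ δ x * P q γ δ y) / ((x : ℂ) - (y : ℂ)))

/-- The function `x ↦ x θ_q'(xγ) / θ_q(xγ)`, where `θ_q'` is the complex derivative. -/
def thetaLog (q : ℝ) (γ : ℂ) (x : ℝ) : ℂ :=
  x * (deriv (theta q) (x * γ) / theta q (x * γ))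

/-- The constant in front of the kernel for `δ = γ`. -/
def constEq (q ζm ζp : ℝ) (γ : ℂ) : ℂ :=
  (theta q (γ * ζm) * theta q (γ * ζp)) ^ 2 /
    (ζp * qPoch q q ^ 4 * (theta q (ζm / ζp) * theta q (γ ^ 2 * ζm * ζp)))

/-- The elliptic tail kernel for `δ = γ`, which is the limit of the kernel as `δ → γ`. On the
diagonal it is given by L'Hôpital's rule: the derivative of the numerator in the first variable
(that of the denominator `x - y` being `1`). -/
def kernelEq (q ζm ζp : ℝ) (γ : ℂ) (x y : ℝ) : ℂ :=
  if x = y then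
    constEq q ζm ζp γ *
      deriv (fun t : ℝ => (Real.sqrt |t * y| : ℂ) * (thetaLog q γ y - thetaLog q γ t)) y
  else
    constEq q ζm ζp γ *
      ((Real.sqrt |x * y| : ℂ) / ((x : ℂ) - (y : ℂ)) * (thetaLog q γ y - thetaLog q γ x))

open Classical in
/-- The elliptic tail kernel `K^{γ,δ}(x, y)`. -/
def kernel (q ζm ζp : ℝ) (γ δ : ℂ) (x y : ℝ) : ℂ :=
  if γ = δ then kernelEq q ζm ζp γ x y else kernelNe q ζm ζp γ δ x y

end EllipticTail

end

noncomputable section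

namespace EllipticTail

open Filter Topology ComplexConjugate

section

variable {q : ℝ}

/-! ### The `q`-Pochhammer symbol -/

/-! The kernel is diagonally conjugate to a block Toeplitz matrix with 2×2 blocks, and the symbol of
that matrix has rank one and trace one.

Write the lattice points as `ζ_a q^n`, where `a` is the branch with sign `s_a`, and put `y =
δ/√(γδ)`, so that `y² = δ/γ`. The functional equation `θ(qz) = -z⁻¹ θ(z)` makes `P` and `Q`
geometric along each branch, with ratios `-s_a √q / y` and `-s_a √q y` (`Good.P_Q_zpow`). The Cauchy
factor `1/(ζ_a q^n - ζ_b q^m)` is `-1/(ζ_b q^m)` times `(1 - (ζ_a/ζ_b) q^(n-m))⁻¹`. After a diagonal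
conjugation whose entries have modulus depending only on the branch, the kernel therefore depends on
`a`, `b` and `n - m` alone (`Good.kernelNe_eq`).

The symbol is summed in closed form. Off the diagonal of the block this is Kronecker's formula `∑
t^n/(1 - c q^n) = (q;q)² θ(ct)/(θ(c)θ(t))` on `q < |t| < 1` (`hasSum_kronecker`). On the diagonal,
where `c = 1`, it is the Lambert type series of `zθ'(z)/θ(z)` (`exists_hasSum_thetaL`). The
arguments are `t = √q u y^{±1}` with `|u| = 1`; they lie in the annulus because admissibility gives
`√q < |y| < 1/√q`. Each entry is a difference of two such terms. The Weierstrass addition formula,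
or its derivative on the diagonal, merges them into one product of a factor in `a` and a factor in
`b`, which is rank one. In the logarithmic derivative form the part of a diagonal entry depending on
`u` carries only the sign `s_a`, so it cancels in the trace; what remains is made equal to one by
the constant `C` (`Param.constC_mul`). A matrix of rank one and trace one is idempotent.

The coefficients are absolutely summable, so comparing Fourier coefficients turns idempotency of the
symbol into `K² = K` entrywise (`IdemSymbol.convolution`), and Schur's test gives boundedness.
Self-adjointness is a direct computation: either all the data are real, or conjugation exchanges `γ`
and `δ`, hence `P` and `Q`, while `C` changes sign.

Equal parameters are reached by letting `τ ↓ 1` in the pair `(g/τ, gτ)`. The Toeplitz coefficients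
converge under a summable bound, and idempotency of the symbol survives such limits
(`IdemSymbol.of_tendsto`). -/

theorem norm_ofReal_of_pos (hq0 : 0 < q) : ‖(q : ℂ)‖ = q := by
  rw [Complex.norm_real, Real.norm_of_nonneg hq0.le]

theorem ofReal_ne_zero_of_pos (hq0 : 0 < q) : (q : ℂ) ≠ 0 := by exact_mod_cast hq0.ne'

theorem summable_norm_mul_pow (hq0 : 0 < q) (hq1 : q < 1) (z : ℂ) :
    Summable fun i : ℕ => ‖-(z * (q : ℂ) ^ i)‖ := by
  simp only [norm_neg, norm_mul, norm_pow, norm_ofReal_of_pos hq0]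
  exact (summable_geometric_of_lt_one hq0.le hq1).mul_left _

theorem multipliable_qPoch (hq0 : 0 < q) (hq1 : q < 1) (z : ℂ) :
    Multipliable fun i : ℕ => (1 - z * (q : ℂ) ^ i) := by
  simpa only [sub_eq_add_neg] using
    multipliable_one_add_of_summable (summable_norm_mul_pow hq0 hq1 z)

theorem qPoch_eq_mul (hq0 : 0 < q) (hq1 : q < 1) (z : ℂ) :
    qPoch q z = (1 - z) * qPoch q (q * z) := by
  have h2 : (fun i : ℕ => (1 - q * z * (q : ℂ) ^ i)) = fun i : ℕ => (1 - z * (q : ℂ) ^ (i + 1)) := by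
    ext i; ring
  have h := multipliable_qPoch hq0 hq1 (q * z)
  rw [h2] at h
  have h3 := tprod_eq_zero_mul' (f := fun i : ℕ => (1 - z * (q : ℂ) ^ i)) h
  rw [pow_zero, mul_one] at h3
  rw [qPoch, h3, qPoch, h2]

theorem qPoch_ne_zero (hq0 : 0 < q) (hq1 : q < 1) {z : ℂ} (h : ∀ i : ℕ, z * (q : ℂ) ^ i ≠ 1) :
    qPoch q z ≠ 0 := by
  have := tprod_one_add_ne_zero_of_summable (f := fun i : ℕ => -(z * (q : ℂ) ^ i)) ?_
    (summable_norm_mul_pow hq0 hq1 z)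
  · simpa only [qPoch, sub_eq_add_neg] using this
  · intro i hi
    exact h i (by linear_combination -hi)

theorem qPoch_conj (q : ℝ) (z : ℂ) :
    qPoch q (conj z) = conj (qPoch q z) := by
  unfold qPoch
  rw [Function.LeftInverse.map_tprod (g := starRingEnd ℂ) (g' := starRingEnd ℂ) _
    Complex.continuous_conj Complex.continuous_conj (fun x => Complex.conj_conj x)]
  simp

theorem differentiable_qPoch (hq0 : 0 < q) (hq1 : q < 1) : Differentiable ℂ (qPoch q) := by
  have key : ∀ R : ℝ, DifferentiableOn ℂ (qPoch q) (Metric.ball 0 R) := by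
    intro R
    have hs : Summable fun i : ℕ => R * q ^ i :=
      (summable_geometric_of_lt_one hq0.le hq1).mul_left _
    have h := Summable.hasProdLocallyUniformlyOn_one_add (K := Metric.ball (0 : ℂ) R)
      (f := fun (i : ℕ) (z : ℂ) => -(z * (q : ℂ) ^ i)) Metric.isOpen_ball hs
      (Eventually.of_forall fun i z hz => by
        simp only [norm_neg, norm_mul, norm_pow, norm_ofReal_of_pos hq0]
        gcongr
        simpa using (mem_ball_zero_iff.1 hz).le)
      (fun i => by fun_prop)
    have h2 := h.differentiableOn (Eventually.of_forall fun s => by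
      simpa [Finset.prod_fn] using
        DifferentiableOn.finsetProd (fun _ _ ↦ by fun_prop)) Metric.isOpen_ball
    exact h2.congr fun z _ => by simp only [qPoch, sub_eq_add_neg]
  intro z
  exact (key (‖z‖ + 1)).differentiableAt
    (Metric.isOpen_ball.mem_nhds (by simp))

/-! ### The theta function -/

/-- Shifting by `q` removes the factor `1 - z` from one product and adds `1 - z⁻¹` to the other;
their ratio is `-z⁻¹`. -/
theorem theta_q_mul (hq0 : 0 < q) (hq1 : q < 1) {z : ℂ} (hz : z ≠ 0) :
    theta q (q * z) = -z⁻¹ * theta q z := by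
  have hq := ofReal_ne_zero_of_pos hq0
  unfold theta
  rw [qPoch_eq_mul hq0 hq1 z, qPoch_eq_mul hq0 hq1 (q / (q * z))]
  have h1 : (q : ℂ) / (q * z) = z⁻¹ := by field_simp
  rw [h1, ← div_eq_mul_inv]
  field_simp
  ring

theorem theta_inv (hq0 : 0 < q) (hq1 : q < 1) {z : ℂ} (hz : z ≠ 0) :
    theta q z⁻¹ = -z⁻¹ * theta q z := by
  rw [← theta_q_mul hq0 hq1 hz]
  have hq := ofReal_ne_zero_of_pos hq0
  unfold theta
  rw [div_inv_eq_mul, mul_comm (qPoch q z⁻¹)]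
  congr 2
  field_simp

theorem theta_one (hq0 : 0 < q) (hq1 : q < 1) : theta q 1 = 0 := by
  unfold theta
  rw [qPoch_eq_mul hq0 hq1]
  simp

theorem theta_conj (q : ℝ) (z : ℂ) :
    theta q (conj z) = conj (theta q z) := by
  unfold theta
  rw [map_mul, ← qPoch_conj, ← qPoch_conj, map_div₀, Complex.conj_ofReal]

theorem theta_ne_zero (hq0 : 0 < q) (hq1 : q < 1) {z : ℂ} (hz : z ≠ 0)
    (h : ∀ n : ℤ, z ≠ (q : ℂ) ^ n) : theta q z ≠ 0 := by
  have hq := ofReal_ne_zero_of_pos hq0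
  refine mul_ne_zero (qPoch_ne_zero hq0 hq1 fun i hi => ?_) (qPoch_ne_zero hq0 hq1 fun i hi => ?_)
  · refine h (-i) ?_
    rw [zpow_neg, zpow_natCast]
    exact eq_inv_of_mul_eq_one_left hi
  · refine h (i + 1) ?_
    rw [zpow_add₀ hq, zpow_natCast, zpow_one]
    field_simp at hi
    linear_combination -hi

theorem differentiableAt_theta (hq0 : 0 < q) (hq1 : q < 1) {z : ℂ} (hz : z ≠ 0) :
    DifferentiableAt ℂ (theta q) z := by
  unfold theta
  have h := differentiable_qPoch hq0 hq1
  exact (h z).mul ((h _).comp z ((differentiableAt_const _).div differentiableAt_id hz))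

theorem continuousAt_theta (hq0 : 0 < q) (hq1 : q < 1) {z : ℂ} (hz : z ≠ 0) :
    ContinuousAt (theta q) z := (differentiableAt_theta hq0 hq1 hz).continuousAt

theorem qPoch_self_ne_zero (hq0 : 0 < q) (hq1 : q < 1) : qPoch q q ≠ 0 := by
  refine qPoch_ne_zero hq0 hq1 fun i hi => ?_
  have : q * q ^ i = 1 := by exact_mod_cast hi
  have h2 : q * q ^ i < 1 := by
    rw [← pow_succ']
    exact pow_lt_one₀ hq0.le hq1 (by omega)
  linarith

/-- After splitting off the simple zero `1 - z`, only its derivative survives at `1`. This is the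
source of every `(q;q)²` below. -/
theorem hasDerivAt_theta_one (hq0 : 0 < q) (hq1 : q < 1) :
    HasDerivAt (theta q) (-(qPoch q q) ^ 2) 1 := by
  have h := differentiable_qPoch hq0 hq1
  have h1 : theta q = fun z => (1 - z) * (qPoch q (q * z) * qPoch q (q / z)) := by
    ext z
    unfold theta
    rw [qPoch_eq_mul hq0 hq1 z]; ring
  have h2 : DifferentiableAt ℂ (fun z : ℂ => qPoch q (q * z) * qPoch q (q / z)) 1 := by
    refine DifferentiableAt.mul ((h _).comp _ (by fun_prop)) ((h _).comp _ ?_)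
    exact (differentiableAt_const _).div differentiableAt_id one_ne_zero
  have h3 := ((hasDerivAt_id (1 : ℂ)).const_sub 1).mul h2.hasDerivAt
  rw [h1]
  convert! h3 using 1
  simp
  ring

theorem theta_of_neg_ne_zero (hq0 : 0 < q) (hq1 : q < 1) {x : ℝ} (hx : x < 0) :
    theta q x ≠ 0 := by
  refine theta_ne_zero hq0 hq1 (by exact_mod_cast hx.ne) fun n hn => ?_
  have : x = q ^ n := by exact_mod_cast hn
  have := zpow_pos hq0 n
  linarith

theorem norm_zpow_eq (hq0 : 0 < q) (n : ℤ) : ‖(q : ℂ) ^ n‖ = q ^ n := by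
  rw [norm_zpow, norm_ofReal_of_pos hq0]

theorem theta_ne_zero_of_norm (hq0 : 0 < q) (hq1 : q < 1) {z : ℂ} (hz : q < ‖z‖) (hz1 : ‖z‖ < 1) :
    theta q z ≠ 0 := by
  refine theta_ne_zero hq0 hq1 (norm_pos_iff.1 (hq0.trans hz)) fun n hn => ?_
  rw [hn, norm_zpow_eq hq0] at hz hz1
  have h1 : n < 1 := by
    by_contra! h
    have := zpow_le_zpow_right_of_le_one₀ hq0 hq1.le h
    simp at this; linarith
  have h2 : 0 < n := by
    by_contra! h
    have := one_le_zpow_of_nonpos₀ hq0 hq1.le h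
    linarith
  omega

/-! ### The logarithmic derivative -/

/-- The logarithmic derivative `z θ_q'(z) / θ_q(z)`. -/
def thetaL (q : ℝ) (z : ℂ) : ℂ := z * (deriv (theta q) z / theta q z)

/-- Logarithmic differentiation of `θ(qz) = -z⁻¹ θ(z)`: the factor `z⁻¹` contributes the `-1`. -/
theorem thetaL_q_mul (hq0 : 0 < q) (hq1 : q < 1) {z : ℂ} (hz : z ≠ 0) (h : theta q z ≠ 0) :
    thetaL q (q * z) = thetaL q z - 1 := by
  have hq := ofReal_ne_zero_of_pos hq0
  have h1 : HasDerivAt (fun z => theta q (q * z)) (deriv (theta q) (q * z) * q) z := by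
    have := (differentiableAt_theta hq0 hq1 (mul_ne_zero hq hz)).hasDerivAt
    have h3 : HasDerivAt (fun z : ℂ => (q : ℂ) * z) q z := by
      simpa using (hasDerivAt_id z).const_mul (q : ℂ)
    exact this.comp z h3
  have h2 : HasDerivAt (fun z => -z⁻¹ * theta q z)
      (-(-(z ^ 2)⁻¹) * theta q z + -z⁻¹ * deriv (theta q) z) z :=
    ((hasDerivAt_inv hz).neg).mul (differentiableAt_theta hq0 hq1 hz).hasDerivAt
  have h4 : (fun z => theta q (q * z)) =ᶠ[𝓝 z] (fun z => -z⁻¹ * theta q z) := by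
    filter_upwards [isOpen_ne.mem_nhds hz] with w hw using theta_q_mul hq0 hq1 hw
  have h5 := h1.unique (h2.congr_of_eventuallyEq h4)
  unfold thetaL
  rw [theta_q_mul hq0 hq1 hz]
  field_simp
  field_simp at h5
  linear_combination -h5

theorem thetaL_zpow_mul (hq0 : 0 < q) (hq1 : q < 1) {z : ℂ} (hz : z ≠ 0) 
    (h : ∀ n : ℤ, theta q (q ^ n * z) ≠ 0) (n : ℤ) :
    thetaL q (q ^ n * z) = thetaL q z - n := by
  have hq := ofReal_ne_zero_of_pos hq0
  have step : ∀ n : ℤ, thetaL q (q ^ (n + 1) * z) = thetaL q (q ^ n * z) - 1 := fun n => by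
    rw [← thetaL_q_mul hq0 hq1 (mul_ne_zero (zpow_ne_zero n hq) hz) (h n), zpow_add_one₀ hq]
    congr 1; ring
  induction n with
  | zero => simp
  | succ n ih => rw [step, ih]; push_cast; ring
  | pred n ih =>
    have := step (-n - 1)
    rw [sub_add_cancel, ih] at this
    push_cast at this ⊢
    linear_combination -this

end

section

variable {q : ℝ}

/-! ### Two-sided power series -/

/-- Summability in `ℂ` is absolute, so the product family on `ℤ × ℤ` may be summed along the lines
of constant index sum. -/
theorem hasSum_convolution {a b : ℤ → ℂ} {A B : ℂ} (ha : HasSum a A) (hb : HasSum b B) :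
    (∀ N, Summable fun m => a m * b (N - m)) ∧
      HasSum (fun N => ∑' m, a m * b (N - m)) (A * B) := by
  let e : ℤ × ℤ ≃ ℤ × ℤ :=
    { toFun := fun p => (p.2, p.1 - p.2)
      invFun := fun p => (p.1 + p.2, p.1)
      left_inv := fun p => by simp
      right_inv := fun p => by simp }
  have hs : Summable fun p : ℤ × ℤ => a p.1 * b p.2 :=
    summable_mul_of_summable_norm ha.summable.norm hb.summable.norm
  have h : HasSum (fun p : ℤ × ℤ => a p.1 * b p.2) (A * B) := ha.mul hb hs
  have h2 : HasSum (fun p : ℤ × ℤ => a p.2 * b (p.1 - p.2)) (A * B) :=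
    (Equiv.hasSum_iff e).2 h
  have h3 : ∀ N, Summable fun m => a m * b (N - m) := fun N => h2.summable.prod_factor N
  exact ⟨h3, h2.prod_fiberwise fun N => (h3 N).hasSum⟩

theorem hasSum_laurent_mul {a b : ℤ → ℂ} {A B z : ℂ} (hz : z ≠ 0)
    (ha : HasSum (fun n => a n * z ^ n) A) (hb : HasSum (fun n => b n * z ^ n) B) :
    (∀ N, Summable fun m => a m * b (N - m)) ∧
      HasSum (fun N => (∑' m, a m * b (N - m)) * z ^ N) (A * B) := by
  obtain ⟨h1, h2⟩ := hasSum_convolution ha hb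
  have key : ∀ N m : ℤ, a m * z ^ m * (b (N - m) * z ^ (N - m)) = a m * b (N - m) * z ^ N := by
    intro N m
    have : z ^ N = z ^ m * z ^ (N - m) := by rw [← zpow_add₀ hz]; congr 1; ring
    rw [this]; ring
  simp only [key] at h1 h2
  refine ⟨fun N => ?_, ?_⟩
  · exact (summable_mul_right_iff (zpow_ne_zero N hz)).1 (h1 N)
  · simpa only [tsum_mul_right] using h2

theorem integral_circle_zpow (n : ℤ) :
    (∮ z in C(0, 1), z ^ n) = if n = -1 then 2 * Real.pi * Complex.I else 0 := by
  split_ifs with h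
  · subst h
    simpa using circleIntegral.integral_sub_center_inv (0 : ℂ) one_ne_zero
  · simpa using circleIntegral.integral_sub_zpow_of_ne h 0 0 1

/-- A summable two-sided power series that vanishes on the unit circle has zero coefficients. -/
theorem laurent_coeff_eq_zero {c : ℤ → ℂ} (h : ∀ u : ℂ, ‖u‖ = 1 → HasSum (fun n => c n * u ^ n) 0)
    (N : ℤ) : c N = 0 := by
  have hs : Summable fun n => ‖c n‖ := by
    simpa using (h 1 (by simp)).summable.norm
  -- Termwise integration of the series times `z^(-N-1)` over the unit circle isolates the
  -- coefficient of index `N`; `‖c n‖` dominates.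
  have h1 : HasSum (fun n : ℤ => ∫ θ in (0 : ℝ)..2 * Real.pi,
      deriv (circleMap 0 1) θ • (c n * circleMap 0 1 θ ^ (n - N - 1)))
      (∫ θ in (0 : ℝ)..2 * Real.pi, (0 : ℂ)) := by
    refine intervalIntegral.hasSum_integral_of_dominated_convergence (fun n _ => ‖c n‖) ?_ ?_ ?_ ?_ ?_
    · intro n
      refine Continuous.aestronglyMeasurable ?_
      simp only [deriv_circleMap]
      refine ((continuous_circleMap 0 1).mul continuous_const).smul (continuous_const.mul ?_)
      exact (continuous_circleMap 0 1).zpow₀ _ fun θ => Or.inl (by simp [circleMap])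
    · intro n
      refine Eventually.of_forall fun θ _ => ?_
      simp [circleMap]
    · exact Eventually.of_forall fun θ _ => hs
    · simp
    · refine Eventually.of_forall fun θ _ => ?_
      have hu : ‖circleMap 0 1 θ‖ = 1 := by simp [circleMap]
      have hu0 : circleMap 0 1 θ ≠ 0 := norm_pos_iff.1 (by rw [hu]; norm_num)
      have := ((h _ hu).mul_left (deriv (circleMap 0 1) θ * circleMap 0 1 θ ^ (-N - 1)))
      rw [mul_zero] at this
      convert! this using 2 with n
      rw [smul_eq_mul, show n - N - 1 = n + (-N - 1) by ring, zpow_add₀ hu0]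
      ring
  have h2 : (fun n : ℤ => ∫ θ in (0 : ℝ)..2 * Real.pi,
      deriv (circleMap 0 1) θ • (c n * circleMap 0 1 θ ^ (n - N - 1))) =
      fun n : ℤ => if n = N then c N * (2 * Real.pi * Complex.I) else 0 := by
    ext n
    change (∮ z in C(0, 1), c n * z ^ (n - N - 1)) = _
    rw [circleIntegral.integral_const_mul, integral_circle_zpow]
    by_cases hn : n = N
    · subst hn; simp
    · rw [if_neg (by omega), if_neg hn, mul_zero]
  rw [h2] at h1
  have h3 := h1.unique (hasSum_ite_eq N _)
  simpa [Real.pi_ne_zero] using h3.symm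

theorem laurent_coeff_eq_zero_of_ne_zero {c : ℤ → ℂ}
    (h : ∀ z : ℂ, z ≠ 0 → HasSum (fun n => c n * z ^ n) 0) (N : ℤ) : c N = 0 :=
  laurent_coeff_eq_zero (fun u hu => h u (norm_pos_iff.1 (by rw [hu]; norm_num))) N

/-! ### The Laurent expansion of the theta function -/

theorem exists_hasSum_qPoch (hq0 : 0 < q) (hq1 : q < 1) :
    ∃ a : ℕ → ℂ, ∀ z : ℂ, HasSum (fun n => a n * z ^ n) (qPoch q z) := by
  refine ⟨fun n => (n.factorial : ℂ)⁻¹ * iteratedDeriv n (qPoch q) 0, fun z => ?_⟩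
  have := Complex.hasSum_taylorSeries_of_entire (differentiable_qPoch hq0 hq1) 0 z
  convert! this using 2 with n
  simp only [sub_zero, smul_eq_mul]; ring

/-- Only the recurrence of the coefficients is needed, not their explicit values. It is the
functional equation read off coefficientwise. It forces all coefficients to vanish if `t 0` does,
contradicting `θ(-1) ≠ 0`. -/
theorem exists_hasSum_theta (hq0 : 0 < q) (hq1 : q < 1) :
    ∃ t : ℤ → ℂ, (∀ z : ℂ, z ≠ 0 → HasSum (fun n => t n * z ^ n) (theta q z)) ∧
      (∀ n, t (n + 1) = -(q : ℂ) ^ n * t n) ∧ t 0 ≠ 0 := by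
  have hq := ofReal_ne_zero_of_pos hq0
  obtain ⟨a, ha⟩ := exists_hasSum_qPoch hq0 hq1
  let a₁ : ℤ → ℂ := fun n => if 0 ≤ n then a n.toNat else 0
  let a₂ : ℤ → ℂ := fun n => if n ≤ 0 then a (-n).toNat * (q : ℂ) ^ (-n) else 0
  have h₁ : ∀ z : ℂ, HasSum (fun n => a₁ n * z ^ n) (qPoch q z) := by
    intro z
    have := HasSum.of_nat_of_neg_add_one (f := fun n => a₁ n * z ^ n) (m := qPoch q z) (m' := 0)
      (by simpa [a₁] using ha z) (by
        convert! hasSum_zero using 2 with n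
        simp only [a₁]
        rw [if_neg (by omega), zero_mul])
    simpa using this
  have h₂ : ∀ z : ℂ, HasSum (fun n => a₂ n * z ^ n) (qPoch q (q / z)) := by
    intro z
    have h0 : HasSum (fun n : ℤ => a₁ n * (q / z) ^ n) (qPoch q (q / z)) := h₁ _
    rw [← (Equiv.neg ℤ).hasSum_iff] at h0
    convert! h0 using 2 with n
    simp only [a₁, a₂, Function.comp, Equiv.neg_apply, Left.nonneg_neg_iff]
    split_ifs with hn
    · rw [div_zpow, zpow_neg z]; simp [div_eq_mul_inv]; ring
    · simp
  let t : ℤ → ℂ := fun N => ∑' m, a₁ m * a₂ (N - m)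
  have ht : ∀ z : ℂ, z ≠ 0 → HasSum (fun n => t n * z ^ n) (theta q z) := fun z hz =>
    (hasSum_laurent_mul hz (h₁ z) (h₂ z)).2
  have hrec : ∀ n, t (n + 1) = -(q : ℂ) ^ n * t n := by
    intro n
    have := laurent_coeff_eq_zero_of_ne_zero (c := fun n => t (n + 1) + (q : ℂ) ^ n * t n) ?_ n
    · linear_combination this
    · intro z hz
      have e1 := ht (q * z) (mul_ne_zero hq hz)
      have e2 := (ht z hz).mul_left z⁻¹
      rw [← (Equiv.addRight (1 : ℤ)).hasSum_iff] at e2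
      have e3 := e2.add e1
      rw [theta_q_mul hq0 hq1 hz] at e3
      convert! e3 using 1
      · ext n
        simp only [Function.comp, Equiv.coe_addRight, zpow_add_one₀ hz, mul_zpow]
        field_simp
      · ring
  refine ⟨t, ht, hrec, fun h0 => ?_⟩
  have hall : ∀ n, t n = 0 := by
    intro n
    induction n with
    | zero => exact h0
    | succ n ih => rw [hrec, ih, mul_zero]
    | pred n ih =>
      have := hrec (-n - 1)
      rw [sub_add_cancel, ih] at this
      exact (mul_eq_zero.1 this.symm).resolve_left (neg_ne_zero.2 (zpow_ne_zero _ hq))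
  have h1 := ht (-1 : ℝ) (by norm_num)
  simp only [hall, zero_mul] at h1
  exact theta_of_neg_ne_zero hq0 hq1 (by norm_num) (h1.unique hasSum_zero)

/-- Solutions of a first order recurrence with nonzero multipliers form a line. Cross-multiplication
avoids dividing by `t 0`. -/
theorem recurrence_unique {c h t : ℤ → ℂ} (hc : ∀ n, c n ≠ 0) (hh : ∀ n, h (n + 1) = c n * h n)
    (ht : ∀ n, t (n + 1) = c n * t n) (n : ℤ) : h n * t 0 = h 0 * t n := by
  induction n with
  | zero => rfl
  | succ n ih => rw [hh, ht, mul_assoc, ih]; ring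
  | pred n ih =>
    have h1 := hh (-n - 1)
    have h2 := ht (-n - 1)
    rw [sub_add_cancel] at h1 h2
    rw [h1, h2] at ih
    exact mul_left_cancel₀ (hc (-n - 1)) (by linear_combination ih)

/-! ### The Weierstrass addition formula -/

/-- As a function of `x` the product satisfies `f(qx) = x⁻² f(x)`, so its Laurent coefficients obey
`h(n+2) = q^n h(n)`. They are determined by `h 0` and `h 1`, so `f` lies in a two-dimensional space
independent of `y`, spanned by an even and an odd series. -/
theorem exists_rank_two (hq0 : 0 < q) (hq1 : q < 1) :
    ∃ E O α β : ℂ → ℂ, ∀ x y : ℂ, x ≠ 0 → y ≠ 0 →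
      theta q (x * y) * theta q (x / y) = α y * E x + β y * O x := by
  have hq := ofReal_ne_zero_of_pos hq0
  obtain ⟨t, ht, -, -⟩ := exists_hasSum_theta hq0 hq1
  let h : ℂ → ℤ → ℂ := fun y N => ∑' m, t m * y ^ m * (t (N - m) * y⁻¹ ^ (N - m))
  have hsum : ∀ x y : ℂ, x ≠ 0 → y ≠ 0 →
      HasSum (fun N => h y N * x ^ N) (theta q (x * y) * theta q (x / y)) := by
    intro x y hx hy
    have e1 := ht (x * y) (mul_ne_zero hx hy)
    have e2 := ht (x / y) (div_ne_zero hx hy)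
    refine (hasSum_laurent_mul hx (a := fun m => t m * y ^ m) (b := fun m => t m * y⁻¹ ^ m)
      ?_ ?_).2
    · convert! e1 using 2 with n
      rw [mul_zpow]; ring
    · convert! e2 using 2 with n
      rw [div_eq_mul_inv, mul_zpow]; ring
  have hrec : ∀ y : ℂ, y ≠ 0 → ∀ n, h y (n + 2) = (q : ℂ) ^ n * h y n := by
    intro y hy n
    have := laurent_coeff_eq_zero_of_ne_zero (c := fun n => h y (n + 2) - (q : ℂ) ^ n * h y n) ?_ n
    · linear_combination this
    · intro x hx
      have e1 := hsum (q * x) y (mul_ne_zero hq hx) hy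
      have e2 := (hsum x y hx hy).mul_left (x ^ 2)⁻¹
      rw [← (Equiv.addRight (2 : ℤ)).hasSum_iff] at e2
      have e3 := e2.sub e1
      rw [mul_assoc (q : ℂ), mul_div_assoc (q : ℂ), theta_q_mul hq0 hq1 (mul_ne_zero hx hy),
        theta_q_mul hq0 hq1 (div_ne_zero hx hy)] at e3
      convert! e3 using 1
      · ext n
        simp only [Function.comp, Equiv.coe_addRight, zpow_add₀ hx, mul_zpow]
        field_simp
      · field_simp
        ring
  have hev : ∀ y : ℂ, y ≠ 0 → ∀ k : ℤ, h y (2 * k) = h y 0 * (q : ℂ) ^ (k * (k - 1)) := by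
    intro y hy k
    have := recurrence_unique (c := fun k => (q : ℂ) ^ (2 * k)) (h := fun k => h y (2 * k))
      (t := fun k => (q : ℂ) ^ (k * (k - 1))) (fun k => zpow_ne_zero _ hq)
      (fun k => by simp only [mul_add, mul_one]; exact hrec y hy _)
      (fun k => by rw [← zpow_add₀ hq]; congr 1; ring) k
    simpa using this
  have hod : ∀ y : ℂ, y ≠ 0 → ∀ k : ℤ, h y (2 * k + 1) = h y 1 * (q : ℂ) ^ (k * k) := by
    intro y hy k
    have := recurrence_unique (c := fun k => (q : ℂ) ^ (2 * k + 1)) (h := fun k => h y (2 * k + 1))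
      (t := fun k => (q : ℂ) ^ (k * k)) (fun k => zpow_ne_zero _ hq)
      (fun k => by
        rw [← hrec y hy]; congr 1; ring)
      (fun k => by rw [← zpow_add₀ hq]; congr 1; ring) k
    simpa using this
  refine ⟨fun x => ∑' k : ℤ, (q : ℂ) ^ (k * (k - 1)) * x ^ (2 * k),
    fun x => ∑' k : ℤ, (q : ℂ) ^ (k * k) * x ^ (2 * k + 1), fun y => h y 0, fun y => h y 1,
    fun x y hx hy => ?_⟩
  have hs := hsum x y hx hy
  have i1 : Function.Injective fun k : ℤ => 2 * k := fun a b hab => by simpa using hab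
  have i2 : Function.Injective fun k : ℤ => 2 * k + 1 := fun a b hab => by simpa using hab
  have hc : IsCompl (Set.range fun k : ℤ => 2 * k) (Set.range fun k : ℤ => 2 * k + 1) := by
    have e : (Set.range fun k : ℤ => 2 * k + 1) = (Set.range fun k : ℤ => 2 * k)ᶜ := by
      ext n
      simp only [Set.mem_range, Set.mem_compl_iff, not_exists]
      constructor
      · rintro ⟨k, rfl⟩ l hl; omega
      · intro hn
        exact ⟨n / 2, by have := hn (n / 2); omega⟩
    rw [e]; exact isCompl_compl
  have s1 := (hs.summable.comp_injective i1).hasSum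
  have s2 := (hs.summable.comp_injective i2).hasSum
  have s3 := HasSum.add_isCompl hc (i1.hasSum_range_iff.2 s1) (i2.hasSum_range_iff.2 s2)
  rw [hs.unique s3]
  simp only [Function.comp, hev y hy, hod y hy, mul_assoc, tsum_mul_left]

/-- The left side is, up to sign, the 3×3 minor with rows `a, b, c` and columns `a, b, d`, which
vanishes for a form of rank two. -/
theorem rank_two_minor {φ : ℂ → ℂ → ℂ} {E O α β : ℂ → ℂ}
    (hφ : ∀ x y, x ≠ 0 → y ≠ 0 → φ x y = α y * E x + β y * O x)
    (hanti : ∀ x y, x ≠ 0 → y ≠ 0 → φ y x = -φ x y) {a b c d : ℂ}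
    (ha : a ≠ 0) (hb : b ≠ 0) (hc : c ≠ 0) (hd : d ≠ 0) :
    φ a b * (φ a b * φ c d - φ a c * φ b d + φ a d * φ b c) = 0 := by
  have haa : φ a a = 0 := by linear_combination (1 / 2 : ℂ) * hanti a a ha ha
  have hbb : φ b b = 0 := by linear_combination (1 / 2 : ℂ) * hanti b b hb hb
  have hdet : φ a a * (φ b b * φ c d - φ b d * φ c b) - φ a b * (φ b a * φ c d - φ b d * φ c a) +
      φ a d * (φ b a * φ c b - φ b b * φ c a) = 0 := by
    simp only [hφ, ha, hb, hc, hd, ne_eq, not_false_eq_true]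
    ring
  rw [haa, hbb, hanti a b ha hb, hanti a c ha hc, hanti b c hb hc] at hdet
  linear_combination hdet

/-- An alternating form of rank two satisfies the Plücker relation. -/
theorem rank_two_pfaffian {φ : ℂ → ℂ → ℂ} {E O α β : ℂ → ℂ}
    (hφ : ∀ x y, x ≠ 0 → y ≠ 0 → φ x y = α y * E x + β y * O x)
    (hanti : ∀ x y, x ≠ 0 → y ≠ 0 → φ y x = -φ x y) {a b c d : ℂ}
    (ha : a ≠ 0) (hb : b ≠ 0) (hc : c ≠ 0) (hd : d ≠ 0) :
    φ a b * φ c d - φ a c * φ b d + φ a d * φ b c = 0 := by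
  have h1 := rank_two_minor hφ hanti ha hb hc hd
  have h2 := rank_two_minor hφ hanti ha hc hb hd
  have h3 := rank_two_minor hφ hanti ha hd hb hc
  rw [hanti b c hb hc] at h2
  rw [hanti b d hb hd, hanti c d hc hd] at h3
  -- Each of `h1`, `h2`, `h3` says that one entry times the Pfaffian is zero; the combination
  -- rebuilds the Pfaffian as second factor.
  have : (φ a b * φ c d - φ a c * φ b d + φ a d * φ b c) ^ 2 = 0 := by
    linear_combination φ c d * h1 + φ b d * h2 + φ b c * h3
  exact pow_eq_zero_iff two_ne_zero |>.1 this

/-- The form `x⁻¹ θ(xy) θ(x/y)` is alternating by the inversion formula for `θ` and has rank two, so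
this is its Plücker relation. -/
theorem theta_weierstrass (hq0 : 0 < q) (hq1 : q < 1) {x y u v : ℂ} (hx : x ≠ 0) (hy : y ≠ 0)
    (hu : u ≠ 0) (hv : v ≠ 0) :
    theta q (x * y) * theta q (x / y) * (theta q (u * v) * theta q (u / v)) -
      theta q (x * v) * theta q (x / v) * (theta q (u * y) * theta q (u / y)) =
    u / y * (theta q (y * v) * theta q (y / v) * (theta q (x * u) * theta q (x / u))) := by
  obtain ⟨E, O, α, β, h⟩ := exists_rank_two hq0 hq1
  let φ : ℂ → ℂ → ℂ := fun x y => x⁻¹ * (theta q (x * y) * theta q (x / y))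
  have hφ : ∀ x y, x ≠ 0 → y ≠ 0 → φ x y = α y * (x⁻¹ * E x) + β y * (x⁻¹ * O x) := by
    intro x y hx hy
    simp only [φ, h x y hx hy]; ring
  have hanti : ∀ x y, x ≠ 0 → y ≠ 0 → φ y x = -φ x y := by
    intro x y hx hy
    simp only [φ]
    rw [← inv_div x y, theta_inv hq0 hq1 (div_ne_zero hx hy), mul_comm y x]
    field_simp
  have key := rank_two_pfaffian hφ hanti hx hy hu hv
  have e : φ y u = -φ u y := hanti u y hu hy
  rw [e] at key
  simp only [φ] at key
  field_simp at key ⊢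
  linear_combination key

end

/-! ### Kronecker's formula -/

section

variable {q : ℝ}

/-- The coefficients `(1 - a q^n)⁻¹` of the Kronecker series, with the value `0` at a pole. -/
def kronCoeff (q : ℝ) (a : ℂ) (n : ℤ) : ℂ := (1 - a * (q : ℂ) ^ n)⁻¹

theorem tendsto_q_pow (hq0 : 0 < q) (hq1 : q < 1) :
    Tendsto (fun n : ℕ => (q : ℂ) ^ n) atTop (𝓝 0) :=
  tendsto_pow_atTop_nhds_zero_of_norm_lt_one (by rwa [norm_ofReal_of_pos hq0])

/-- Boundedness follows from convergence of the coefficients, suitably rescaled, at both ends. A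
pole merely contributes the value `0`, so `a` may be a power of `q`; the case `a = 1` is needed
later. -/
theorem kronCoeff_bound (hq0 : 0 < q) (hq1 : q < 1) {a : ℂ} (ha : a ≠ 0) :
    ∃ M : ℝ, (∀ n : ℕ, ‖kronCoeff q a n‖ ≤ M) ∧
      ∀ n : ℕ, ‖kronCoeff q a (-(n : ℤ))‖ ≤ M * q ^ n := by
  have hq := ofReal_ne_zero_of_pos hq0
  have h1 : Tendsto (fun n : ℕ => ‖kronCoeff q a n‖) atTop (𝓝 ‖(1 - a * 0 : ℂ)⁻¹‖) := by
    refine Tendsto.norm (Tendsto.inv₀ ?_ (by simp))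
    simpa using ((tendsto_q_pow hq0 hq1).const_mul a).const_sub 1
  have h2 : Tendsto (fun n : ℕ => ‖((q : ℂ) ^ n - a)⁻¹‖) atTop (𝓝 ‖(0 - a : ℂ)⁻¹‖) :=
    Tendsto.norm (Tendsto.inv₀ ((tendsto_q_pow hq0 hq1).sub_const a) (by simpa using ha))
  obtain ⟨M₁, hM₁⟩ := h1.bddAbove_range
  obtain ⟨M₂, hM₂⟩ := h2.bddAbove_range
  refine ⟨max M₁ M₂, fun n => (hM₁ ⟨n, rfl⟩).trans (le_max_left _ _), fun n => ?_⟩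
  have e : kronCoeff q a (-(n : ℤ)) = ((q : ℂ) ^ n - a)⁻¹ * (q : ℂ) ^ n := by
    have : (q : ℂ) ^ n ≠ 0 := pow_ne_zero _ hq
    have e2 : (1 - a * (q : ℂ) ^ (-(n : ℤ))) = ((q : ℂ) ^ n - a) / (q : ℂ) ^ n := by
      rw [zpow_neg, zpow_natCast]; field_simp
    rw [kronCoeff, e2, inv_div, div_eq_mul_inv, mul_comm]
  rw [e, norm_mul, norm_pow, norm_ofReal_of_pos hq0]
  gcongr
  exact (hM₂ ⟨n, rfl⟩).trans (le_max_right _ _)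

theorem summable_kronCoeff (hq0 : 0 < q) (hq1 : q < 1) {a t : ℂ} (ha : a ≠ 0)
    (ht : q < ‖t‖) (ht1 : ‖t‖ < 1) : Summable fun n : ℤ => kronCoeff q a n * t ^ n := by
  obtain ⟨M, h1, h2⟩ := kronCoeff_bound hq0 hq1 ha
  have ht0 : 0 < ‖t‖ := hq0.trans ht
  refine Summable.of_nat_of_neg ?_ ?_
  · refine Summable.of_norm_bounded (g := fun n : ℕ => M * ‖t‖ ^ n)
      ((summable_geometric_of_lt_one ht0.le ht1).mul_left _) fun n => ?_
    rw [norm_mul, zpow_natCast, norm_pow]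
    gcongr
    exact h1 n
  · refine Summable.of_norm_bounded (g := fun n : ℕ => M * (q / ‖t‖) ^ n)
      ((summable_geometric_of_lt_one (by positivity) ((div_lt_one ht0).2 ht)).mul_left _)
      fun n => ?_
    rw [norm_mul, norm_zpow, zpow_neg, zpow_natCast, div_pow, div_eq_mul_inv, ← mul_assoc]
    gcongr
    exact h2 n

theorem kronCoeff_mul {a : ℂ} {n : ℤ} (h : a * (q : ℂ) ^ n ≠ 1) :
    a * (q : ℂ) ^ n * kronCoeff q a n = kronCoeff q a n - 1 := by
  have : (1 - a * (q : ℂ) ^ n) ≠ 0 := sub_ne_zero.2 (Ne.symm h)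
  unfold kronCoeff
  field_simp
  ring

/-- The product of the Kronecker series and the theta function satisfies the functional equation
of a theta function. -/
theorem exists_kron_mul_theta (hq0 : 0 < q) (hq1 : q < 1) {a : ℂ} (ha : a ≠ 0)
    (hq : ∀ n : ℤ, a * (q : ℂ) ^ n ≠ 1) :
    ∃ κ : ℂ, ∀ t : ℂ, q < ‖t‖ → ‖t‖ < 1 →
      (∑' n : ℤ, kronCoeff q a n * t ^ n) * theta q t = κ * theta q (a * t) := by
  have hq' := ofReal_ne_zero_of_pos hq0
  obtain ⟨c, hc, hrec, hc0⟩ := exists_hasSum_theta hq0 hq1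
  let e : ℤ → ℂ := fun N => ∑' m, c m * kronCoeff q a (N - m)
  have hsum : ∀ t : ℂ, q < ‖t‖ → ‖t‖ < 1 → (∀ N, Summable fun m => c m * kronCoeff q a (N - m)) ∧
      HasSum (fun N => e N * t ^ N) (theta q t * ∑' n : ℤ, kronCoeff q a n * t ^ n) := by
    intro t ht ht1
    have ht0 : t ≠ 0 := norm_pos_iff.1 (hq0.trans ht)
    exact hasSum_laurent_mul ht0 (hc t ht0) (summable_kronCoeff hq0 hq1 ha ht ht1).hasSum
  obtain ⟨r, hr0, hr1⟩ := exists_between hq1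
  have hr : ‖(r : ℂ)‖ = r := norm_ofReal_of_pos (hq0.trans hr0)
  have hs := (hsum r (by rwa [hr]) (by rwa [hr])).1
  have herec : ∀ N, e (N + 1) = -(a * (q : ℂ) ^ N) * e N := by
    intro N
    -- Multiplying by `a q^N` shifts the convolution by one index and leaves the extra terms `c (m +
    -- 1)`, whose sum is `θ(1) = 0`. Hence the homogeneous recurrence, which is that of the
    -- coefficients of `θ(at)`.
    have h1 : ∀ m, a * (q : ℂ) ^ N * (c m * kronCoeff q a (N - m)) =
        -(c (m + 1) * kronCoeff q a (N + 1 - (m + 1))) + c (m + 1) := by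
      intro m
      have e1 : (q : ℂ) ^ N = (q : ℂ) ^ m * (q : ℂ) ^ (N - m) := by
        rw [← zpow_add₀ hq']; congr 1; ring
      have e2 := kronCoeff_mul (hq (N - m))
      rw [add_sub_add_right_eq_sub, hrec, e1]
      linear_combination c m * (q : ℂ) ^ m * e2
    have h2 := (hs N).hasSum.mul_left (a * (q : ℂ) ^ N)
    simp only [h1] at h2
    have h3 := (Equiv.addRight (1 : ℤ)).hasSum_iff.2 (hs (N + 1)).hasSum
    have h4 := (Equiv.addRight (1 : ℤ)).hasSum_iff.2 (hc 1 one_ne_zero)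
    simp only [Function.comp_def, Equiv.coe_addRight, one_zpow, mul_one, theta_one hq0 hq1] at h3 h4
    have h5 := h2.unique (h3.neg.add h4)
    simp only [e]
    linear_combination h5
  have heq : ∀ n, e n * c 0 = e 0 * (a ^ n * c n) := fun n => by
    have := recurrence_unique (c := fun N => -(a * (q : ℂ) ^ N)) (h := e)
      (t := fun n => a ^ n * c n)
      (fun n => neg_ne_zero.2 (mul_ne_zero ha (zpow_ne_zero _ hq'))) herec
      (fun n => by rw [hrec, zpow_add_one₀ ha]; ring) n
    simpa using this
  refine ⟨e 0 / c 0, fun t ht ht1 => ?_⟩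
  have ht0 : t ≠ 0 := norm_pos_iff.1 (hq0.trans ht)
  have h1 := (hsum t ht ht1).2
  have h2 := (hc (a * t) (mul_ne_zero ha ht0)).mul_left (e 0 / c 0)
  rw [mul_comm]
  refine h1.unique ?_
  convert! h2 using 2 with n
  rw [mul_zpow]
  field_simp
  linear_combination heq n

/-- Near `t = 1` the Kronecker series behaves like `(1 - t)⁻¹`. -/
theorem tendsto_one_sub_mul_kron (hq0 : 0 < q) (hq1 : q < 1) {a : ℂ} (ha : a ≠ 0)
    (hq : ∀ n : ℤ, a * (q : ℂ) ^ n ≠ 1) :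
    Tendsto (fun t : ℝ => (1 - (t : ℂ)) * ∑' n : ℤ, kronCoeff q a n * (t : ℂ) ^ n)
      (𝓝[<] 1) (𝓝 1) := by
  obtain ⟨M, h1, h2⟩ := kronCoeff_bound hq0 hq1 ha
  obtain ⟨r, hr0, hr1⟩ := exists_between hq1
  have hr : 0 < r := hq0.trans hr0
  -- Subtracting the geometric series `∑_{n ≥ 0} t^n = (1 - t)⁻¹` leaves coefficients of size
  -- `O(q^|n|)`. For `r ≤ t < 1` with `q < r` the remainder is dominated by a multiple of `∑
  -- (q/r)^|n|`, so multiplication by `1 - t` kills it in the limit.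
  let g : ℤ → ℂ := fun n => kronCoeff q a n - if 0 ≤ n then 1 else 0
  have hM : 0 ≤ M := (norm_nonneg _).trans (h1 0)
  have hbound : ∃ B : ℝ, ∀ t : ℝ, r ≤ t → t < 1 → Summable (fun n : ℤ => g n * (t : ℂ) ^ n) ∧
      ‖∑' n : ℤ, g n * (t : ℂ) ^ n‖ ≤ B := by
    let b : ℤ → ℝ := fun n => (‖a‖ * M + M) * (q / r) ^ n.natAbs
    have hqr : q / r < 1 := (div_lt_one hr).2 hr0
    have hb : Summable b := by
      have := (summable_geometric_of_lt_one (by positivity) hqr).mul_left (‖a‖ * M + M)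
      refine Summable.of_nat_of_neg ?_ ?_ <;> simpa [b] using this
    have hgb : ∀ t : ℝ, r ≤ t → t < 1 → ∀ n, ‖g n * (t : ℂ) ^ n‖ ≤ b n := by
      intro t ht ht1 n
      have ht0 : 0 < t := hr.trans_le ht
      rw [norm_mul, norm_zpow, norm_ofReal_of_pos ht0]
      rcases le_or_gt 0 n with hn | hn
      · obtain ⟨k, rfl⟩ := Int.eq_ofNat_of_zero_le hn
        have e1 : g k = a * (q : ℂ) ^ (k : ℤ) * kronCoeff q a k := by
          rw [kronCoeff_mul (hq k)]; simp [g]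
        rw [e1, norm_mul, norm_mul, norm_zpow, norm_ofReal_of_pos hq0, zpow_natCast, zpow_natCast]
        simp only [b, Int.natAbs_natCast]
        have e2 : q ^ k * t ^ k ≤ (q / r) ^ k := by
          rw [← mul_pow]
          refine pow_le_pow_left₀ (by positivity) ?_ k
          rw [le_div_iff₀ hr]
          nlinarith [mul_le_one₀ ht1.le hr.le hr1.le]
        calc ‖a‖ * q ^ k * ‖kronCoeff q a k‖ * t ^ k
            = ‖a‖ * ‖kronCoeff q a k‖ * (q ^ k * t ^ k) := by ring
          _ ≤ ‖a‖ * M * (q / r) ^ k := by gcongr; exact h1 k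
          _ ≤ (‖a‖ * M + M) * (q / r) ^ k := by gcongr; linarith
      · obtain ⟨k, hk⟩ := Int.eq_ofNat_of_zero_le (a := -n) (by omega)
        obtain rfl : n = -(k : ℤ) := by omega
        have e1 : g (-(k : ℤ)) = kronCoeff q a (-(k : ℤ)) := by
          simp only [g]; rw [if_neg (by omega), sub_zero]
        rw [e1, zpow_neg, zpow_natCast]
        simp only [b, Int.natAbs_neg, Int.natAbs_natCast]
        calc ‖kronCoeff q a (-(k : ℤ))‖ * (t ^ k)⁻¹ ≤ M * q ^ k * (r ^ k)⁻¹ := by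
              gcongr; exact h2 k
          _ = M * (q / r) ^ k := by rw [div_pow]; ring
          _ ≤ (‖a‖ * M + M) * (q / r) ^ k := by
            have : 0 ≤ ‖a‖ * M := by positivity
            gcongr; linarith
    refine ⟨∑' n, b n, fun t ht ht1 => ⟨Summable.of_norm_bounded hb (hgb t ht ht1), ?_⟩⟩
    exact tsum_of_norm_bounded hb.hasSum (hgb t ht ht1)
  obtain ⟨B, hB⟩ := hbound
  have hlim : Tendsto (fun t : ℝ => (1 - (t : ℂ)) * ∑' n : ℤ, g n * (t : ℂ) ^ n)
      (𝓝[<] 1) (𝓝 0) := by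
    refine squeeze_zero_norm' (a := fun t : ℝ => (1 - t) * B) ?_ ?_
    · filter_upwards [Ioo_mem_nhdsLT hr1] with t ht
      rw [norm_mul]
      have : ‖(1 - (t : ℂ))‖ = 1 - t := by
        rw [← Complex.ofReal_one, ← Complex.ofReal_sub, norm_ofReal_of_pos (by linarith [ht.2])]
      rw [this]
      exact mul_le_mul_of_nonneg_left (hB t ht.1.le ht.2).2 (by linarith [ht.2])
    · have : Tendsto (fun t : ℝ => (1 - t) * B) (𝓝 1) (𝓝 ((1 - 1) * B)) :=
        (Continuous.tendsto (by fun_prop) _)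
      simpa using this.mono_left nhdsWithin_le_nhds
  have h1' : Tendsto (fun t : ℝ => 1 + (1 - (t : ℂ)) * ∑' n : ℤ, g n * (t : ℂ) ^ n)
      (𝓝[<] 1) (𝓝 1) := by simpa using hlim.const_add 1
  refine h1'.congr' ?_
  filter_upwards [Ioo_mem_nhdsLT hr1] with t ht
  have ht0 : 0 < t := hr.trans ht.1
  have hnorm : ‖(t : ℂ)‖ < 1 := by rw [norm_ofReal_of_pos ht0]; exact ht.2
  have hgeo : HasSum (fun n : ℤ => (if 0 ≤ n then (1 : ℂ) else 0) * (t : ℂ) ^ n)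
      (1 - (t : ℂ))⁻¹ := by
    have := HasSum.of_nat_of_neg_add_one
      (f := fun n : ℤ => (if 0 ≤ n then (1 : ℂ) else 0) * (t : ℂ) ^ n)
      (m := (1 - (t : ℂ))⁻¹) (m' := 0) (by simpa using hasSum_geometric_of_norm_lt_one hnorm) (by
        convert! hasSum_zero using 2 with n
        rw [if_neg (by omega), zero_mul])
    simpa using this
  have hs := (hB t ht.1.le ht.2).1.hasSum.add hgeo
  have e : (fun n : ℤ => g n * (t : ℂ) ^ n + (if 0 ≤ n then (1 : ℂ) else 0) * (t : ℂ) ^ n) =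
      fun n : ℤ => kronCoeff q a n * (t : ℂ) ^ n := by
    ext n; simp only [g]; ring
  rw [e] at hs
  rw [hs.tsum_eq]
  have h1t : (1 - (t : ℂ)) ≠ 0 := by
    rw [← Complex.ofReal_one, ← Complex.ofReal_sub]
    exact ofReal_ne_zero_of_pos (by linarith [ht.2])
  field_simp
  ring

/-- Kronecker's formula. -/
theorem hasSum_kronecker (hq0 : 0 < q) (hq1 : q < 1) {a t : ℂ} (ha : a ≠ 0)
    (hq : ∀ n : ℤ, a * (q : ℂ) ^ n ≠ 1) (ht : q < ‖t‖) (ht1 : ‖t‖ < 1) :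
    HasSum (fun n : ℤ => kronCoeff q a n * t ^ n)
      (qPoch q q ^ 2 * theta q (a * t) / (theta q a * theta q t)) := by
  obtain ⟨κ, hκ⟩ := exists_kron_mul_theta hq0 hq1 ha hq
  have hθ : theta q a ≠ 0 := by
    refine theta_ne_zero hq0 hq1 ha fun n hn => hq (-n) ?_
    rw [hn, ← zpow_add₀ (ofReal_ne_zero_of_pos hq0)]; simp
  -- The constant is found by letting `t` increase to `1`: the series behaves like `(1 - t)⁻¹` and
  -- `θ(t)` like `(q;q)² (1 - t)`.
  have hκ2 : κ * theta q a = qPoch q q ^ 2 := by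
    have h1 := tendsto_one_sub_mul_kron hq0 hq1 ha hq
    have hslope := (hasDerivAt_iff_tendsto_slope.1 (hasDerivAt_theta_one hq0 hq1))
    have hof : Tendsto (fun t : ℝ => (t : ℂ)) (𝓝[<] 1) (𝓝[≠] 1) := by
      refine tendsto_nhdsWithin_iff.2 ⟨?_, ?_⟩
      · have : Tendsto (fun t : ℝ => (t : ℂ)) (𝓝 1) (𝓝 ((1 : ℝ) : ℂ)) :=
          Complex.continuous_ofReal.tendsto 1
        rw [Complex.ofReal_one] at this
        exact this.mono_left nhdsWithin_le_nhds
      · filter_upwards [self_mem_nhdsWithin] with t ht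
        have : t ≠ 1 := ne_of_lt ht
        simpa using this
    have h2 := h1.mul (hslope.comp hof).neg
    have h3 : Tendsto (fun t : ℝ => κ * theta q (a * t)) (𝓝[<] 1) (𝓝 (κ * theta q (a * 1))) := by
      refine Tendsto.const_mul κ ?_
      have hc : ContinuousAt (fun t : ℂ => theta q (a * t)) 1 :=
        ContinuousAt.comp (continuousAt_theta hq0 hq1 (by simpa using ha)) (by fun_prop)
      exact hc.tendsto.comp (hof.mono_right nhdsWithin_le_nhds)
    have h4 := tendsto_nhds_unique (h3.congr' ?_) h2
    · rw [mul_one] at h4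
      rw [h4]; ring
    · filter_upwards [Ioo_mem_nhdsLT hq1] with t ht
      have hn : ‖(t : ℂ)‖ = t := norm_ofReal_of_pos (hq0.trans ht.1)
      rw [← hκ t (by rw [hn]; exact ht.1) (by rw [hn]; exact ht.2)]
      simp only [Function.comp, slope_def_field, theta_one hq0 hq1]
      have h1t : (t : ℂ) - 1 ≠ 0 := by
        rw [← Complex.ofReal_one, ← Complex.ofReal_sub]
        exact_mod_cast (by linarith [ht.2] : t - 1 < 0).ne
      field_simp
      ring
  have hθt := theta_ne_zero_of_norm hq0 hq1 ht ht1
  have h := (summable_kronCoeff hq0 hq1 ha ht ht1).hasSum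
  convert! h using 1
  rw [div_eq_iff (mul_ne_zero hθ hθt)]
  have := hκ t ht ht1
  linear_combination -theta q a * this - theta q (a * t) * hκ2

end

/-! ### Lambert type expansion and addition formula of the logarithmic derivative -/

section

variable {q : ℝ}

theorem norm_intCast_le_two_zpow (n : ℤ) : ‖(n : ℂ)‖ ≤ 2 ^ n + (2 : ℝ)⁻¹ ^ n := by
  have h : ∀ k : ℕ, (k : ℝ) ≤ 2 ^ k := fun k => by exact_mod_cast (Nat.lt_two_pow_self (n := k)).le
  rw [Complex.norm_intCast]
  rcases le_total 0 n with hn | hn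
  · obtain ⟨k, rfl⟩ := Int.eq_ofNat_of_zero_le hn
    have := h k
    have p : (0 : ℝ) < (2 ^ k)⁻¹ := by positivity
    simp
    linarith
  · obtain ⟨k, hk⟩ := Int.eq_ofNat_of_zero_le (a := -n) (by omega)
    obtain rfl : n = -(k : ℤ) := by omega
    have := h k
    have p : (0 : ℝ) < (2 ^ k)⁻¹ := by positivity
    simp
    linarith

/-- Termwise differentiation of a two-sided power series. -/
theorem hasSum_laurent_deriv {c : ℤ → ℂ} {f : ℂ → ℂ}
    (h : ∀ z : ℂ, z ≠ 0 → HasSum (fun n => c n * z ^ n) (f z)) {z : ℂ} (hz : z ≠ 0) :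
    HasSum (fun n : ℤ => (n : ℂ) * c n * z ^ n) (z * deriv f z) := by
  have hr : 0 < ‖z‖ / 2 := by have := norm_pos_iff.2 hz; positivity
  have hs : ∀ R : ℝ, 0 < R → Summable fun n : ℤ => ‖c n‖ * R ^ n := by
    intro R hR
    have := (h R (by exact_mod_cast hR.ne')).summable.norm
    refine this.congr fun n => ?_
    rw [norm_mul, norm_zpow, Complex.norm_real, Real.norm_of_nonneg hR.le]
  let R₁ : ℝ := ‖z‖ / 2
  let R₂ : ℝ := 3 * ‖z‖ / 2
  have hR₁ : 0 < R₁ := hr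
  have hR₂ : 0 < R₂ := by simp only [R₂]; linarith
  -- On the ball the modulus stays between `R₁` and `R₂`, so `|w|^n ≤ R₁^n + R₂^n` for either sign
  -- of `n`. Bounding `|n|` by `2^n + 2^(-n)` reduces summability to the original series at the four
  -- radii `2R₁`, `R₁/2`, `2R₂`, `R₂/2`.
  let u : ℤ → ℝ := fun n => ‖c n‖ * ((2 ^ n + (2 : ℝ)⁻¹ ^ n) * (R₁ ^ n + R₂ ^ n)) / R₁
  have hu : Summable u := by
    have := ((((hs (2 * R₁) (by positivity)).add (hs (2⁻¹ * R₁) (by positivity))).add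
      (hs (2 * R₂) (by positivity))).add (hs (2⁻¹ * R₂) (by positivity))).div_const R₁
    refine this.congr fun n => ?_
    simp only [u, mul_zpow]
    ring
  have hball : ∀ w ∈ Metric.ball z R₁, R₁ ≤ ‖w‖ ∧ ‖w‖ ≤ R₂ := by
    intro w hw
    rw [mem_ball_iff_norm] at hw
    have h1 := norm_sub_norm_le z w
    have h2 := norm_sub_norm_le w z
    rw [norm_sub_rev] at h1
    simp only [R₁, R₂] at hw ⊢
    constructor <;> linarith
  have hzpow : ∀ w ∈ Metric.ball z R₁, ∀ n : ℤ, ‖w‖ ^ n ≤ R₁ ^ n + R₂ ^ n := by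
    intro w hw n
    obtain ⟨h1, h2⟩ := hball w hw
    have p1 : 0 < R₁ ^ n := by positivity
    have p2 : 0 < R₂ ^ n := by positivity
    rcases le_total 0 n with hn | hn
    · have := zpow_le_zpow_left₀ hn (norm_nonneg w) h2
      linarith
    · have : ‖w‖ ^ n ≤ R₁ ^ n := by
        obtain ⟨k, hk⟩ := Int.eq_ofNat_of_zero_le (a := -n) (by omega)
        obtain rfl : n = -(k : ℤ) := by omega
        rw [zpow_neg, zpow_neg, zpow_natCast, zpow_natCast]
        gcongr
      linarith
  have hne : ∀ w ∈ Metric.ball z R₁, w ≠ 0 := fun w hw =>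
    norm_pos_iff.1 (hR₁.trans_le (hball w hw).1)
  have hder : ∀ (n : ℤ) (w : ℂ), w ∈ Metric.ball z R₁ →
      HasDerivAt (fun w => c n * w ^ n) (c n * (n * w ^ (n - 1))) w := fun n w hw =>
    (hasDerivAt_zpow n w (Or.inl (hne w hw))).const_mul _
  have hbd : ∀ (n : ℤ) (w : ℂ), w ∈ Metric.ball z R₁ → ‖c n * (n * w ^ (n - 1))‖ ≤ u n := by
    intro n w hw
    have h1 := hzpow w hw n
    have h2 := hball w hw
    have hw0 : 0 < ‖w‖ := hR₁.trans_le h2.1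
    rw [norm_mul, norm_mul, norm_zpow, zpow_sub_one₀ hw0.ne']
    simp only [u]
    rw [mul_div_assoc, mul_div_assoc]
    gcongr
    · exact norm_intCast_le_two_zpow n
    · rw [← div_eq_mul_inv]
      gcongr
      exact h2.1
  have hmem : z ∈ Metric.ball z R₁ := Metric.mem_ball_self hR₁
  have hd := hasDerivAt_tsum_of_isPreconnected hu Metric.isOpen_ball
    (convex_ball z R₁).isPreconnected hder hbd hmem (h z hz).summable hmem
  have hd2 : HasDerivAt f (∑' n, c n * (n * z ^ (n - 1))) z := by
    refine hd.congr_of_eventuallyEq ?_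
    filter_upwards [Metric.isOpen_ball.mem_nhds hmem] with w hw
    exact (h w (hne w hw)).tsum_eq.symm
  have hsum := (Summable.of_norm_bounded hu fun n => hbd n z hmem).hasSum.mul_left z
  rw [hd2.deriv]
  convert! hsum using 2 with n
  rw [zpow_sub_one₀ hz]
  field_simp

/-- The Lambert type expansion of the logarithmic derivative of the theta function. -/
theorem exists_hasSum_thetaL (hq0 : 0 < q) (hq1 : q < 1) :
    ∃ κ : ℂ, ∀ t : ℂ, q < ‖t‖ → ‖t‖ < 1 →
      HasSum (fun n : ℤ => kronCoeff q 1 n * t ^ n) (κ - thetaL q t) := by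
  have hq' := ofReal_ne_zero_of_pos hq0
  have hpole : ∀ n : ℤ, n ≠ 0 → (1 : ℂ) * (q : ℂ) ^ n ≠ 1 := by
    intro n hn h
    rw [one_mul] at h
    have : q ^ n = 1 := by exact_mod_cast h
    rcases (zpow_eq_one_iff_right₀ hq0.le hq1.ne).1 this with h
    exact hn h
  have hk0 : kronCoeff q 1 0 = 0 := by simp [kronCoeff]
  obtain ⟨c, hc, hrec, hc0⟩ := exists_hasSum_theta hq0 hq1
  let e : ℤ → ℂ := fun N => ∑' m, c m * kronCoeff q 1 (N - m)
  have hsum : ∀ t : ℂ, q < ‖t‖ → ‖t‖ < 1 → (∀ N, Summable fun m => c m * kronCoeff q 1 (N - m)) ∧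
      HasSum (fun N => e N * t ^ N) (theta q t * ∑' n : ℤ, kronCoeff q 1 n * t ^ n) := by
    intro t ht ht1
    have ht0 : t ≠ 0 := norm_pos_iff.1 (hq0.trans ht)
    exact hasSum_laurent_mul ht0 (hc t ht0)
      (summable_kronCoeff hq0 hq1 one_ne_zero ht ht1).hasSum
  obtain ⟨r, hr0, hr1⟩ := exists_between hq1
  have hr : ‖(r : ℂ)‖ = r := norm_ofReal_of_pos (hq0.trans hr0)
  have hs := (hsum r (by rwa [hr]) (by rwa [hr])).1
  -- As in Kronecker's formula, except that the suppressed pole at `m = N` leaves an inhomogeneous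
  -- term.
  have herec : ∀ N, e (N + 1) = -(q : ℂ) ^ N * e N - c (N + 1) := by
    intro N
    have h1 : ∀ m, (q : ℂ) ^ N * (c m * kronCoeff q 1 (N - m)) =
        -(c (m + 1) * kronCoeff q 1 (N + 1 - (m + 1))) + c (m + 1) -
          if m = N then c (N + 1) else 0 := by
      intro m
      have e1 : (q : ℂ) ^ N = (q : ℂ) ^ m * (q : ℂ) ^ (N - m) := by
        rw [← zpow_add₀ hq']; congr 1; ring
      rw [add_sub_add_right_eq_sub]
      split_ifs with hm
      · subst hm; simp [hk0]
      · have e2 := kronCoeff_mul (hpole (N - m) (by omega))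
        rw [hrec, e1]
        linear_combination c m * (q : ℂ) ^ m * e2
    have h2 := (hs N).hasSum.mul_left ((q : ℂ) ^ N)
    simp only [h1] at h2
    have h3 := (Equiv.addRight (1 : ℤ)).hasSum_iff.2 (hs (N + 1)).hasSum
    have h4 := (Equiv.addRight (1 : ℤ)).hasSum_iff.2 (hc 1 one_ne_zero)
    simp only [Function.comp_def, Equiv.coe_addRight, one_zpow, mul_one, theta_one hq0 hq1] at h3 h4
    have h5 := h2.unique ((h3.neg.add h4).sub (hasSum_ite_eq N (c (N + 1))))
    simp only [e]
    linear_combination h5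
  -- Adding `n c_n` absorbs the inhomogeneity and restores the recurrence of `θ`; the corresponding
  -- series `∑ n c_n t^n` is `tθ'(t)`.
  have heq : ∀ n : ℤ, (e n + n * c n) * c 0 = e 0 * c n := fun n => by
    have := recurrence_unique (c := fun N => -(q : ℂ) ^ N) (h := fun n => e n + n * c n)
      (t := c) (fun n => neg_ne_zero.2 (zpow_ne_zero _ hq'))
      (fun n => by simp only [herec, hrec]; push_cast; ring) hrec n
    simpa using this
  refine ⟨e 0 / c 0, fun t ht ht1 => ?_⟩
  have ht0 : t ≠ 0 := norm_pos_iff.1 (hq0.trans ht)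
  have hθ := theta_ne_zero_of_norm hq0 hq1 ht ht1
  have h1 := (hsum t ht ht1).2
  have h2 := hasSum_laurent_deriv hc ht0
  have h3 := (hc t ht0).mul_left (e 0 / c 0)
  have h4 : HasSum (fun n => e 0 / c 0 * (c n * t ^ n))
      (theta q t * (∑' n : ℤ, kronCoeff q 1 n * t ^ n) + t * deriv (theta q) t) := by
    convert! h1.add h2 using 2 with n
    field_simp
    linear_combination -heq n
  have h5 := h3.unique h4
  convert! (summable_kronCoeff hq0 hq1 one_ne_zero ht ht1).hasSum using 1
  unfold thetaL
  field_simp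
  field_simp at h5
  linear_combination h5

/-- The addition formula for the logarithmic derivative of the theta function. -/
theorem thetaL_addition (hq0 : 0 < q) (hq1 : q < 1) {x y u : ℂ} (hx : x ≠ 0) (hy : y ≠ 0)
    (hu : u ≠ 0) (h1 : theta q (x * y) ≠ 0) (h2 : theta q (x / y) ≠ 0)
    (h3 : theta q (u * y) ≠ 0) (h4 : theta q (u / y) ≠ 0) :
    thetaL q (u * y) - thetaL q (u / y) - thetaL q (x * y) + thetaL q (x / y) =
      u / y * qPoch q q ^ 2 * theta q (y ^ 2) * (theta q (x * u) * theta q (x / u)) /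
        (theta q (x * y) * theta q (x / y) * (theta q (u * y) * theta q (u / y))) := by
  have hmul : ∀ c : ℂ, c ≠ 0 → HasDerivAt (fun v => theta q (c * v))
      (deriv (theta q) (c * y) * c) y := fun c hc => by
    have e : HasDerivAt (fun v : ℂ => c * v) c y := by simpa using (hasDerivAt_id y).const_mul c
    exact (differentiableAt_theta hq0 hq1 (mul_ne_zero hc hy)).hasDerivAt.comp y e
  have hdiv : ∀ (c d : ℂ), c ≠ 0 → HasDerivAt (theta q) d (c / y) →
      HasDerivAt (fun v => theta q (c / v)) (d * (-c / y ^ 2)) y := fun c d hc hd => by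
    have e : HasDerivAt (fun v : ℂ => c / v) (-c / y ^ 2) y := by
      have := (hasDerivAt_inv hy).const_mul c
      convert! this using 1
      field_simp
    exact hd.comp y e
  have dd : ∀ c : ℂ, c ≠ 0 → HasDerivAt (theta q) (deriv (theta q) (c / y)) (c / y) :=
    fun c hc => (differentiableAt_theta hq0 hq1 (div_ne_zero hc hy)).hasDerivAt
  have d1 := (hmul u hu).mul (hdiv u _ hu (dd u hu))
  have d2 := (hmul x hx).mul (hdiv x _ hx (dd x hx))
  have d3 := (hmul y hy).mul (hdiv y (-(qPoch q q) ^ 2) hy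
    (by rw [div_self hy]; exact hasDerivAt_theta_one hq0 hq1))
  -- The Weierstrass formula is differentiated in `v` at `v = y`. On its right side `θ(y/v)`
  -- vanishes there, so only `θ'(1) = -(q;q)²` enters.
  have D := ((d1.const_mul (theta q (x * y) * theta q (x / y))).sub
    (d2.mul_const (theta q (u * y) * theta q (u / y)))).sub
    (d3.const_mul (u / y * (theta q (x * u) * theta q (x / u))))
  have hzero : HasDerivAt (fun _ : ℂ => (0 : ℂ)) 0 y := hasDerivAt_const _ _
  have heq := D.unique (hzero.congr_of_eventuallyEq (by
    filter_upwards [isOpen_ne.mem_nhds hy] with v hv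
    have := theta_weierstrass hq0 hq1 hx hy hu hv
    simp only [Pi.mul_apply, Pi.sub_apply]
    linear_combination this))
  simp only [div_self hy, theta_one hq0 hq1, ← sq y] at heq
  unfold thetaL
  generalize theta q (u * y) = a₁, theta q (u / y) = a₂, theta q (x * y) = a₃,
    theta q (x / y) = a₄, theta q (x * u) = a₅, theta q (x / u) = a₆, theta q (y ^ 2) = a₇,
    deriv (theta q) (u * y) = b₁, deriv (theta q) (u / y) = b₂, deriv (theta q) (x * y) = b₃,
    deriv (theta q) (x / y) = b₄ at *
  field_simp
  field_simp at heq
  linear_combination heq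

end

/-! ### The symbol of the block Toeplitz matrix -/

section

variable {q : ℝ}

theorem theta_ne_zero_of_norm_of_ne_one (hq0 : 0 < q) (hq1 : q < 1) {z : ℂ} (hz : q < ‖z‖)
    (hz1 : q * ‖z‖ < 1) (h1 : z ≠ 1) : theta q z ≠ 0 := by
  refine theta_ne_zero hq0 hq1 (norm_pos_iff.1 (hq0.trans hz)) fun n hn => ?_
  have hn0 : n ≠ 0 := by rintro rfl; simp at hn; exact h1 hn
  rw [hn, norm_zpow_eq hq0] at hz hz1
  rcases lt_or_gt_of_ne hn0 with h | h
  · have := zpow_le_zpow_right_of_le_one₀ hq0 hq1.le (show n ≤ -1 by omega)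
    rw [zpow_neg_one] at this
    have h2 : q * q⁻¹ ≤ q * q ^ n := by gcongr
    rw [mul_inv_cancel₀ hq0.ne'] at h2
    linarith
  · have := zpow_le_zpow_right_of_le_one₀ hq0 hq1.le (show 1 ≤ n by omega)
    rw [zpow_one] at this
    linarith

/-- The base points `ζ₋`, `ζ₊` of the two branches of the lattice. -/
def base (ζm ζp : ℝ) (a : Bool) : ℝ := cond a ζp ζm

/-- The signs of the base points. -/
def branchSign (a : Bool) : ℂ := cond a 1 (-1)

/-- The coefficients of the kernel, written as a block Toeplitz matrix after conjugation by a
diagonal matrix. -/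
def toep (q ζm ζp : ℝ) (γ δ y C : ℂ) (a b : Bool) (k : ℤ) : ℂ :=
  (if a = b ∧ k = 0 then
    C * branchSign a * (thetaL q (base ζm ζp a * δ) - thetaL q (base ζm ζp a * γ)) else 0) +
  -C * branchSign b / (theta q (base ζm ζp b * γ) * theta q (base ζm ζp b * δ)) *
    (kronCoeff q (base ζm ζp a / base ζm ζp b) k *
      (theta q (base ζm ζp a * δ) * theta q (base ζm ζp b * γ) * ((√q : ℝ) / y) ^ k -
        theta q (base ζm ζp a * γ) * theta q (base ζm ζp b * δ) * ((√q : ℝ) * y) ^ k))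

/-- The closed form of the symbol of the block Toeplitz matrix `toep`, as a function of
`w = √q u` with `u` on the unit circle. -/
def symb (q ζm ζp : ℝ) (γ δ r y C w : ℂ) (a b : Bool) : ℂ :=
  -C * branchSign b * w * qPoch q q ^ 2 * theta q (y ^ 2) * theta q (base ζm ζp b * r / w) *
    theta q (base ζm ζp a * r * w) /
    (y * (theta q (base ζm ζp b * γ) * theta q (base ζm ζp b * δ)) *
      (theta q (w * y) * theta q (w / y)))

/-- The standing assumptions on the parameters. -/
structure Param (q ζm ζp : ℝ) (γ δ r y : ℂ) : Prop where
  hq0 : 0 < q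
  hq1 : q < 1
  hζm : ζm < 0
  hζp : 0 < ζp
  hr : r ≠ 0
  hγ : γ = r / y
  hδ : δ = r * y
  hy : √q < ‖y‖
  hy' : √q * ‖y‖ < 1
  hθγ : ∀ a, theta q (base ζm ζp a * γ) ≠ 0
  hθδ : ∀ a, theta q (base ζm ζp a * δ) ≠ 0

theorem base_ne_zero {ζm ζp : ℝ} (hm : ζm < 0) (hp : 0 < ζp) (a : Bool) :
    (base ζm ζp a : ℂ) ≠ 0 := by
  cases a
  · exact_mod_cast hm.ne
  · exact_mod_cast hp.ne'

theorem base_div_neg {ζm ζp : ℝ} (hm : ζm < 0) (hp : 0 < ζp) {a b : Bool} (hab : a ≠ b) :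
    base ζm ζp a / base ζm ζp b < 0 := by
  cases a <;> cases b <;> simp [base] at hab ⊢
  · exact div_neg_of_neg_of_pos hm hp
  · exact div_neg_of_pos_of_neg hp hm

namespace Param

variable {ζm ζp : ℝ} {γ δ r y : ℂ}

theorem y_ne_zero (h : Param q ζm ζp γ δ r y) : y ≠ 0 :=
  norm_pos_iff.1 ((Real.sqrt_nonneg q).trans_lt h.hy)

theorem sqrt_pos (h : Param q ζm ζp γ δ r y) : 0 < √q := Real.sqrt_pos.2 h.hq0

theorem norm_mul_y (h : Param q ζm ζp γ δ r y) {w : ℂ} (hw : ‖w‖ = √q) :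
    q < ‖w * y‖ ∧ ‖w * y‖ < 1 := by
  rw [norm_mul, hw]
  refine ⟨?_, h.hy'⟩
  calc q = √q * √q := (Real.mul_self_sqrt h.hq0.le).symm
    _ < _ := by have := h.sqrt_pos; gcongr; exact h.hy

theorem norm_div_y (h : Param q ζm ζp γ δ r y) {w : ℂ} (hw : ‖w‖ = √q) :
    q < ‖w / y‖ ∧ ‖w / y‖ < 1 := by
  have hy0 := norm_pos_iff.2 h.y_ne_zero
  rw [norm_div, hw]
  refine ⟨?_, (div_lt_one hy0).2 h.hy⟩
  rw [lt_div_iff₀ hy0]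
  have := h.sqrt_pos
  nlinarith [Real.mul_self_sqrt h.hq0.le, h.hy']

/-- This merges the two Kronecker sums of an off-diagonal entry into one product in which, apart
from the factor `θ(ζ_a/ζ_b)` that cancels, `a` and `b` are separated. -/
theorem three_term (h : Param q ζm ζp γ δ r y) {w : ℂ} (hw : w ≠ 0) (a b : Bool) :
    theta q (base ζm ζp a * δ) * theta q (base ζm ζp a / base ζm ζp b * (w / y)) *
        (theta q (w * y) * theta q (base ζm ζp b * γ)) -
      theta q (base ζm ζp a / base ζm ζp b * (w * y)) * theta q (base ζm ζp a * γ) *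
        (theta q (base ζm ζp b * δ) * theta q (w / y)) =
    w / y * (theta q (y ^ 2) * theta q (base ζm ζp b * r / w) *
      (theta q (base ζm ζp a * r * w) * theta q (base ζm ζp a / base ζm ζp b))) := by
  have hy := h.y_ne_zero
  have hr := h.hr
  have ha := base_ne_zero h.hζm h.hζp a
  have hb := base_ne_zero h.hζm h.hζp b
  -- The Weierstrass variables must solve quadratic equations in the given data; a square root of
  -- `ζ_b r / w` makes all the arguments match.
  obtain ⟨β, hβ⟩ := IsAlgClosed.exists_pow_nat_eq (base ζm ζp b * r / w) two_pos
  have hβ0 : β ≠ 0 := by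
    rintro rfl
    rw [zero_pow two_ne_zero] at hβ
    exact div_ne_zero (mul_ne_zero hb hr) hw hβ.symm
  have hw' : w = base ζm ζp b * r / β ^ 2 := by
    rw [hβ]; field_simp
  have W := theta_weierstrass h.hq0 h.hq1 (x := base ζm ζp a * r / β) (y := y * β) (u := w * β)
    (v := y / β) (div_ne_zero (mul_ne_zero ha hr) hβ0) (mul_ne_zero hy hβ0) (mul_ne_zero hw hβ0)
    (div_ne_zero hy hβ0)
  have hγ := h.hγ
  have hδ := h.hδ
  clear hβ
  generalize (base ζm ζp a : ℂ) = A at *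
  generalize (base ζm ζp b : ℂ) = B at *
  subst hw' hγ hδ
  have e1 : A * r / β * (y * β) = A * (r * y) := by field_simp
  have e2 : A * r / β / (y * β) = A / B * (B * r / β ^ 2 / y) := by field_simp
  have e3 : B * r / β ^ 2 * β * (y / β) = B * r / β ^ 2 * y := by field_simp
  have e4 : B * r / β ^ 2 * β / (y / β) = B * (r / y) := by field_simp
  have e5 : A * r / β * (y / β) = A / B * (B * r / β ^ 2 * y) := by field_simp
  have e6 : A * r / β / (y / β) = A * (r / y) := by field_simp
  have e7 : B * r / β ^ 2 * β * (y * β) = B * (r * y) := by field_simp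
  have e8 : B * r / β ^ 2 * β / (y * β) = B * r / β ^ 2 / y := by field_simp
  have e9 : y * β * (y / β) = y ^ 2 := by field_simp
  have e10 : y * β / (y / β) = B * r / (B * r / β ^ 2) := by field_simp
  have e11 : A * r / β * (B * r / β ^ 2 * β) = A * r * (B * r / β ^ 2) := by field_simp
  have e12 : A * r / β / (B * r / β ^ 2 * β) = A / B := by field_simp
  rw [e1, e2, e3, e4, e5, e6, e7, e8, e9, e10, e11, e12] at W
  exact W

/-- For `a = b` the Kronecker coefficients have `c = 1`, and the unknown constant of the Lambert
type expansion drops out of the difference. This form, unlike `symb`, makes the trace visible. -/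
theorem hasSum_toep_diag (h : Param q ζm ζp γ δ r y) {u : ℂ} (hu : ‖u‖ = 1) (C : ℂ) (a : Bool) :
    HasSum (fun k => toep q ζm ζp γ δ y C a a k * u ^ k)
      (C * branchSign a * (thetaL q (base ζm ζp a * δ) - thetaL q (base ζm ζp a * γ) -
        thetaL q ((√q : ℝ) * u * y) + thetaL q ((√q : ℝ) * u / y))) := by
  have hw : ‖((√q : ℝ) : ℂ) * u‖ = √q := by rw [norm_mul, hu, mul_one, norm_ofReal_of_pos h.sqrt_pos]
  obtain ⟨κ, hκ⟩ := exists_hasSum_thetaL h.hq0 h.hq1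
  have s1 := hκ _ (h.norm_mul_y hw).1 (h.norm_mul_y hw).2
  have s2 := hκ _ (h.norm_div_y hw).1 (h.norm_div_y hw).2
  have ha := base_ne_zero h.hζm h.hζp a
  have hγ := h.hθγ a
  have hδ := h.hθδ a
  have s3 := ((s2.sub s1).mul_left (-C * branchSign a)).add
    (hasSum_ite_eq (0 : ℤ) (C * branchSign a * (thetaL q (base ζm ζp a * δ) -
      thetaL q (base ζm ζp a * γ))))
  convert! s3 using 1
  · ext k
    have e1 : ((√q : ℝ) * u * y : ℂ) ^ k = ((√q : ℝ) * y : ℂ) ^ k * u ^ k := by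
      rw [← mul_zpow]; congr 1; ring
    have e2 : ((√q : ℝ) * u / y : ℂ) ^ k = ((√q : ℝ) / y : ℂ) ^ k * u ^ k := by
      rw [← mul_zpow]; congr 1; ring
    rw [toep, e1, e2, div_self ha, add_mul, add_comm]
    congr 1
    · field_simp
    · by_cases hk : k = 0
      · subst hk; simp
      · simp [hk]
  · ring

/-- The diagonal entries come from the addition formula for `thetaL`, the off-diagonal ones from
Kronecker's formula and `three_term`; both give the same closed product. -/
theorem hasSum_toep (h : Param q ζm ζp γ δ r y) {u : ℂ} (hu : ‖u‖ = 1) (C : ℂ) (a b : Bool) :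
    HasSum (fun k => toep q ζm ζp γ δ y C a b k * u ^ k)
      (symb q ζm ζp γ δ r y C ((√q : ℝ) * u) a b) := by
  have hw : ‖((√q : ℝ) : ℂ) * u‖ = √q := by rw [norm_mul, hu, mul_one, norm_ofReal_of_pos h.sqrt_pos]
  have hw0 : ((√q : ℝ) : ℂ) * u ≠ 0 := norm_pos_iff.1 (by rw [hw]; exact h.sqrt_pos)
  have ha := base_ne_zero h.hζm h.hζp a
  have hb := base_ne_zero h.hζm h.hζp b
  have hy := h.y_ne_zero
  have n1 := theta_ne_zero_of_norm h.hq0 h.hq1 (h.norm_mul_y hw).1 (h.norm_mul_y hw).2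
  have n2 := theta_ne_zero_of_norm h.hq0 h.hq1 (h.norm_div_y hw).1 (h.norm_div_y hw).2
  by_cases hab : a = b
  · subst hab
    convert! h.hasSum_toep_diag hu C a using 1
    have hγ := h.hθγ a
    have hδ := h.hθδ a
    have eδ : (base ζm ζp a : ℂ) * δ = base ζm ζp a * r * y := by rw [h.hδ]; ring
    have eγ : (base ζm ζp a : ℂ) * γ = base ζm ζp a * r / y := by rw [h.hγ]; ring
    rw [symb, eδ, eγ, thetaL_addition h.hq0 h.hq1 hw0 hy (mul_ne_zero ha h.hr) n1 n2
      (eδ ▸ hδ) (eγ ▸ hγ), ← inv_div (base ζm ζp a * r : ℂ),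
      theta_inv h.hq0 h.hq1 (div_ne_zero (mul_ne_zero ha h.hr) hw0),
      mul_comm (base ζm ζp a * r : ℂ) ((√q : ℝ) * u)]
    rw [eδ] at hδ
    rw [eγ] at hγ
    have hr := h.hr
    generalize ((√q : ℝ) : ℂ) * u = w at *
    generalize (base ζm ζp a : ℂ) = A at *
    generalize theta q (w * y) = a₁, theta q (w / y) = a₂, theta q (A * r * y) = a₃,
      theta q (A * r / y) = a₄, theta q (w * (A * r)) = a₅, theta q (A * r / w) = a₆ at *
    field_simp
  · have hneg := base_div_neg h.hζm h.hζp hab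
    have hα0 : (base ζm ζp a / base ζm ζp b : ℂ) ≠ 0 := div_ne_zero ha hb
    have hpole : ∀ n : ℤ, (base ζm ζp a / base ζm ζp b : ℂ) * (q : ℂ) ^ n ≠ 1 := by
      intro n hn
      have e : base ζm ζp a / base ζm ζp b * q ^ n = 1 := by exact_mod_cast hn
      have := zpow_pos h.hq0 n
      nlinarith
    have hα : theta q (base ζm ζp a / base ζm ζp b : ℂ) ≠ 0 := by
      have := theta_of_neg_ne_zero h.hq0 h.hq1 hneg
      rwa [Complex.ofReal_div] at this
    have s1 := hasSum_kronecker h.hq0 h.hq1 hα0 hpole (h.norm_mul_y hw).1 (h.norm_mul_y hw).2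
    have s2 := hasSum_kronecker h.hq0 h.hq1 hα0 hpole (h.norm_div_y hw).1 (h.norm_div_y hw).2
    have s3 := (((s2.mul_left (theta q (base ζm ζp a * δ) * theta q (base ζm ζp b * γ))).sub
      (s1.mul_left (theta q (base ζm ζp a * γ) * theta q (base ζm ζp b * δ)))).mul_left
      (-C * branchSign b / (theta q (base ζm ζp b * γ) * theta q (base ζm ζp b * δ))))
    convert! s3 using 1
    · ext k
      have e1 : ((√q : ℝ) * u * y : ℂ) ^ k = ((√q : ℝ) * y : ℂ) ^ k * u ^ k := by
        rw [← mul_zpow]; congr 1; ring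
      have e2 : ((√q : ℝ) * u / y : ℂ) ^ k = ((√q : ℝ) / y : ℂ) ^ k * u ^ k := by
        rw [← mul_zpow]; congr 1; ring
      rw [toep, e1, e2, if_neg (by tauto)]
      ring
    · have hγ := h.hθγ b
      have hδ := h.hθδ b
      have T := h.three_term hw0 a b
      unfold symb
      generalize ((√q : ℝ) : ℂ) * u = w at *
      generalize (base ζm ζp a / base ζm ζp b : ℂ) = α at *
      generalize (base ζm ζp a : ℂ) = A at *
      generalize (base ζm ζp b : ℂ) = B at *
      generalize theta q (w * y) = a₁, theta q (w / y) = a₂, theta q (B * γ) = a₃,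
        theta q (B * δ) = a₄, theta q (A * γ) = a₅, theta q (A * δ) = a₆, 
        theta q (α * (w / y)) = a₇, theta q (α * (w * y)) = a₈, theta q (y ^ 2) = a₉,
        theta q (B * r / w) = b₁, theta q (A * r * w) = b₂, theta q α = b₃ at *
      field_simp
      field_simp at T
      linear_combination C * branchSign b * qPoch q q ^ 2 * T

theorem gamma_ne_zero (h : Param q ζm ζp γ δ r y) : γ ≠ 0 := by
  rw [h.hγ]; exact div_ne_zero h.hr h.y_ne_zero

theorem delta_ne_zero (h : Param q ζm ζp γ δ r y) : δ ≠ 0 := by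
  rw [h.hδ]; exact mul_ne_zero h.hr h.y_ne_zero

theorem sq_y (h : Param q ζm ζp γ δ r y) : y ^ 2 = δ / γ := by
  have := h.hr
  have := h.y_ne_zero
  rw [h.hγ, h.hδ]; field_simp

theorem theta_sq_ne_zero (h : Param q ζm ζp γ δ r y) (hne : γ ≠ δ) : theta q (y ^ 2) ≠ 0 := by
  have h0 : 0 < ‖y‖ := norm_pos_iff.2 h.y_ne_zero
  have hs := h.sqrt_pos
  have hq := Real.mul_self_sqrt h.hq0.le
  refine theta_ne_zero_of_norm_of_ne_one h.hq0 h.hq1 ?_ ?_ ?_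
  · rw [norm_pow]; nlinarith [h.hy]
  · rw [norm_pow]
    calc q * ‖y‖ ^ 2 = (√q * ‖y‖) ^ 2 := by rw [mul_pow, Real.sq_sqrt h.hq0.le]
      _ < 1 := pow_lt_one₀ (by positivity) h.hy' two_ne_zero
  · rw [h.sq_y]
    intro e
    exact hne ((div_eq_one_iff_eq h.gamma_ne_zero).1 e).symm

/-- The normalization of the constant in front of the kernel. -/
theorem constC_mul (h : Param q ζm ζp γ δ r y) (hne : γ ≠ δ)
    (hprod : theta q (γ * δ * ζm * ζp) ≠ 0) :
    constC q ζm ζp γ δ * ((thetaL q (ζp * δ) - thetaL q (ζp * γ)) -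
      (thetaL q (ζm * δ) - thetaL q (ζm * γ))) = 1 := by
  have hm := base_ne_zero h.hζm h.hζp false
  have hp := base_ne_zero h.hζm h.hζp true
  have t1 := h.hθγ false
  have t2 := h.hθγ true
  have t3 := h.hθδ false
  have t4 := h.hθδ true
  simp only [base, cond_true, cond_false] at hm hp t1 t2 t3 t4
  have hy := h.y_ne_zero
  have hr := h.hr
  have eδ : ∀ z : ℂ, z * δ = z * r * y := fun z => by rw [h.hδ]; ring
  have eγ : ∀ z : ℂ, z * γ = z * r / y := fun z => by rw [h.hγ]; ring
  -- With these variables the product and the quotient of the outer ones are `γδζ₋ζ₊` and `ζ₋/ζ₊`,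
  -- the arguments of the theta functions in the denominator of `C`.
  have T := thetaL_addition h.hq0 h.hq1 (x := ζm * r) (y := y) (u := ζp * r)
    (mul_ne_zero hm hr) hy (mul_ne_zero hp hr) (eδ _ ▸ t3) (eγ _ ▸ t1) (eδ _ ▸ t4) (eγ _ ▸ t2)
  rw [← eδ, ← eγ, ← eδ, ← eγ] at T
  have T' : (thetaL q (ζp * δ) - thetaL q (ζp * γ)) - (thetaL q (ζm * δ) - thetaL q (ζm * γ)) =
      ζp * γ * qPoch q q ^ 2 * theta q (δ / γ) *
        (theta q (γ * δ * ζm * ζp) * theta q (ζm / ζp)) /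
        (theta q (γ * ζm) * theta q (γ * ζp) * theta q (δ * ζm) * theta q (δ * ζp)) := by
    have e1 : (ζm * r * (ζp * r) : ℂ) = γ * δ * ζm * ζp := by rw [h.hγ, h.hδ]; field_simp
    have e2 : (ζm * r / (ζp * r) : ℂ) = ζm / ζp := by field_simp
    rw [← h.sq_y, mul_comm γ (ζm : ℂ), mul_comm γ (ζp : ℂ), mul_comm δ (ζm : ℂ),
      mul_comm δ (ζp : ℂ)]
    rw [e1, e2] at T
    calc _ = _ := by ring
      _ = _ := T
      _ = _ := by ring_nf
  have hθ := h.theta_sq_ne_zero hne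
  rw [h.sq_y] at hθ
  have hγ0 := h.gamma_ne_zero
  have hδ0 := h.delta_ne_zero
  -- This accounts for `δ - γ` in `C`: the Pochhammer pair at `δ/γ`, `γ/δ` is `θ(δ/γ)` times `(δ -
  -- γ)/δ`.
  have e4 : theta q (δ / γ) * (1 - γ / δ) = qPoch q (δ / γ) * qPoch q (γ / δ) := by
    rw [theta, qPoch_eq_mul h.hq0 h.hq1 (γ / δ), div_div_eq_mul_div, ← mul_div_assoc]
    ring
  have hsub : δ - γ ≠ 0 := sub_ne_zero.2 (Ne.symm hne)
  have e5 : (1 - γ / δ) ≠ 0 := by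
    rw [one_sub_div hδ0]; exact div_ne_zero hsub hδ0
  have hmp : theta q (ζm / ζp) ≠ 0 := by
    have := theta_of_neg_ne_zero h.hq0 h.hq1 (div_neg_of_neg_of_pos h.hζm h.hζp)
    rwa [Complex.ofReal_div] at this
  have hqq := qPoch_self_ne_zero h.hq0 h.hq1
  rw [T', constC, ← e4]
  rw [mul_comm _ γ] at t1 t2
  rw [mul_comm _ δ] at t3 t4
  generalize theta q (δ / γ) = a₁, theta q (ζm / ζp) = a₂, theta q (γ * δ * ζm * ζp) = a₃,
    theta q (γ * ζm) = a₄, theta q (γ * ζp) = a₅, theta q (δ * ζm) = a₆, theta q (δ * ζp) = a₇,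
    qPoch q q = b at *
  have e6 : (1 - γ / δ) = (δ - γ) / δ := one_sub_div hδ0
  rw [e6]
  field_simp

/-- The terms depending on `u` have coefficient `branchSign a` and cancel between the two branches;
the rest is the normalization `constC_mul`. -/
theorem symb_trace (h : Param q ζm ζp γ δ r y) (hne : γ ≠ δ)
    (hprod : theta q (γ * δ * ζm * ζp) ≠ 0) {u : ℂ} (hu : ‖u‖ = 1) :
    ∑ a, symb q ζm ζp γ δ r y (constC q ζm ζp γ δ) ((√q : ℝ) * u) a a = 1 := by
  have e := fun a => (h.hasSum_toep hu (constC q ζm ζp γ δ) a a).unique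
    (h.hasSum_toep_diag hu (constC q ζm ζp γ δ) a)
  simp only [e, Fintype.sum_bool, branchSign, base, cond_true, cond_false]
  linear_combination h.constC_mul hne hprod

/-- The symbol is a matrix of rank one and trace one, hence idempotent. -/
theorem symb_mul (h : Param q ζm ζp γ δ r y) (hne : γ ≠ δ)
    (hprod : theta q (γ * δ * ζm * ζp) ≠ 0) {u : ℂ} (hu : ‖u‖ = 1) (a c : Bool) :
    ∑ b, symb q ζm ζp γ δ r y (constC q ζm ζp γ δ) ((√q : ℝ) * u) a b *
      symb q ζm ζp γ δ r y (constC q ζm ζp γ δ) ((√q : ℝ) * u) b c =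
    symb q ζm ζp γ δ r y (constC q ζm ζp γ δ) ((√q : ℝ) * u) a c := by
  have T := h.symb_trace hne hprod hu
  have R : ∀ b, symb q ζm ζp γ δ r y (constC q ζm ζp γ δ) ((√q : ℝ) * u) a b *
      symb q ζm ζp γ δ r y (constC q ζm ζp γ δ) ((√q : ℝ) * u) b c =
      symb q ζm ζp γ δ r y (constC q ζm ζp γ δ) ((√q : ℝ) * u) a c *
      symb q ζm ζp γ δ r y (constC q ζm ζp γ δ) ((√q : ℝ) * u) b b := by
    intro b
    unfold symb
    ring
  simp only [R, ← Finset.mul_sum, T, mul_one]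

end Param

end

section

variable {q : ℝ}

/-! ### Idempotent block Toeplitz matrices -/

/-- A block Toeplitz matrix with absolutely summable coefficients whose symbol is idempotent on
the unit circle. -/
def IdemSymbol (B : Bool → Bool → ℤ → ℂ) : Prop :=
  ∃ S : ℂ → Bool → Bool → ℂ, (∀ u : ℂ, ‖u‖ = 1 → ∀ a b, HasSum (fun k => B a b k * u ^ k) (S u a b)) ∧
    ∀ u : ℂ, ‖u‖ = 1 → ∀ a c, ∑ b, S u a b * S u b c = S u a c

theorem hasSum_bool_prod {M : Type*} [AddCommMonoid M] [TopologicalSpace M] [ContinuousAdd M]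
    {f : Bool × ℤ → M} {s : Bool → M} (h : ∀ b, HasSum (fun m => f (b, m)) (s b)) :
    HasSum f (∑ b, s b) := by
  rw [← (Equiv.boolProdEquivSum ℤ).symm.hasSum_iff, Fintype.sum_bool, add_comm]
  exact HasSum.sum (h false) (h true)

namespace IdemSymbol

variable {B : Bool → Bool → ℤ → ℂ}

theorem summable (h : IdemSymbol B) (a b : Bool) : Summable fun k => B a b k := by
  obtain ⟨S, h1, -⟩ := h
  simpa using (h1 1 (by simp) a b).summable

/-- Both sides are Fourier coefficients: the symbol equation `S·S = S` holds at every point of the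
unit circle, and an absolutely summable series vanishing there has zero coefficients. -/
theorem convolution (h : IdemSymbol B) (a c : Bool) (N : ℤ) :
    (∀ b, Summable fun m => B a b m * B b c (N - m)) ∧
      ∑ b, ∑' m, B a b m * B b c (N - m) = B a c N := by
  refine ⟨fun b => (hasSum_convolution (h.summable a b).hasSum (h.summable b c).hasSum).1 N, ?_⟩
  obtain ⟨S, h1, h2⟩ := h
  have := laurent_coeff_eq_zero
    (c := fun N => ∑ b, ∑' m, B a b m * B b c (N - m) - B a c N) ?_ N
  · exact sub_eq_zero.1 this
  · intro u hu
    have hu0 : u ≠ 0 := norm_pos_iff.1 (by rw [hu]; norm_num)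
    have e := (hasSum_sum (s := Finset.univ) fun b _ =>
      (hasSum_laurent_mul hu0 (h1 u hu a b) (h1 u hu b c)).2).sub (h1 u hu a c)
    rw [h2 u hu, sub_self] at e
    convert! e using 2 with k
    rw [sub_mul, Finset.sum_mul]

theorem hasSum (h : IdemSymbol B) (a c : Bool) (n l : ℤ) :
    HasSum (fun p : Bool × ℤ => B a p.1 (n - p.2) * B p.1 c (p.2 - l)) (B a c (n - l)) := by
  obtain ⟨h1, h2⟩ := h.convolution a c (n - l)
  have h3 : ∀ b, HasSum (fun m => B a b (n - m) * B b c (m - l))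
      (∑' m, B a b m * B b c (n - l - m)) := by
    intro b
    have := (Equiv.subLeft n).hasSum_iff.2 (h1 b).hasSum
    convert! this using 2 with m
    simp only [Function.comp, Equiv.subLeft_apply]
    congr 2; ring
  rw [← h2]
  exact hasSum_bool_prod h3

/-- Idempotent symbols are closed under dominated pointwise limits. -/
theorem of_tendsto {ι : Type*} {F : Filter ι} [F.NeBot] {T : ι → Bool → Bool → ℤ → ℂ}
    (hT : ∀ᶠ i in F, IdemSymbol (T i))
    (hlim : ∀ a b k, Tendsto (fun i => T i a b k) F (𝓝 (B a b k)))
    {bound : ℤ → ℝ} (hb : Summable bound) (hbound : ∀ᶠ i in F, ∀ a b k, ‖T i a b k‖ ≤ bound k) :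
    IdemSymbol B := by
  have hB : ∀ a b k, ‖B a b k‖ ≤ bound k := fun a b k =>
    le_of_tendsto (hlim a b k).norm (hbound.mono fun i hi => hi a b k)
  refine ⟨fun u a b => ∑' k, B a b k * u ^ k, fun u hu a b => ?_, fun u hu a c => ?_⟩
  · refine (Summable.of_norm_bounded hb fun k => ?_).hasSum
    rw [norm_mul, norm_zpow, hu, one_zpow, mul_one]
    exact hB a b k
  · have hS : ∀ a b, Tendsto (fun i => ∑' k, T i a b k * u ^ k) F (𝓝 (∑' k, B a b k * u ^ k)) := by
      intro a b
      refine tendsto_tsum_of_dominated_convergence hb (fun k => (hlim a b k).mul_const _) ?_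
      filter_upwards [hbound] with i hi k
      rw [norm_mul, norm_zpow, hu, one_zpow, mul_one]
      exact hi a b k
    have h1 := tendsto_finsetSum (Finset.univ : Finset Bool) fun b _ => (hS a b).mul (hS b c)
    refine tendsto_nhds_unique h1 ((hS a c).congr' ?_)
    filter_upwards [hT] with i hi
    obtain ⟨S, s1, s2⟩ := hi
    simp only [(s1 u hu _ _).tsum_eq]
    exact (s2 u hu a c).symm

end IdemSymbol

theorem Param.idemSymbol {ζm ζp : ℝ} {γ δ r y : ℂ} (h : Param q ζm ζp γ δ r y) (hne : γ ≠ δ)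
    (hprod : theta q (γ * δ * ζm * ζp) ≠ 0) :
    IdemSymbol (toep q ζm ζp γ δ y (constC q ζm ζp γ δ)) :=
  ⟨fun u => symb q ζm ζp γ δ r y (constC q ζm ζp γ δ) ((√q : ℝ) * u),
    fun _ hu => h.hasSum_toep hu _, fun _ hu => h.symb_mul hne hprod hu⟩

end

section

variable {q : ℝ}

/-! ### The limit of coinciding parameters -/

/-- Numerator and denominator both have slopes at `1` equal to twice those of `G` and of the
identity. The symmetric quotient suits the pair `(g/τ, gτ)`, whose product stays `g²`. -/
theorem tendsto_symm_slope {G : ℂ → ℂ} {G' : ℂ} (hG : HasDerivAt G G' 1) :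
    Tendsto (fun τ : ℝ => (G τ - G (τ : ℂ)⁻¹) / (τ - (τ : ℂ)⁻¹)) (𝓝[>] 1) (𝓝 G') := by
  have hinv : HasDerivAt (fun z : ℂ => z⁻¹) (-1) 1 := by
    simpa using hasDerivAt_inv (one_ne_zero : (1 : ℂ) ≠ 0)
  have hG1 : HasDerivAt G G' ((1 : ℂ)⁻¹) := by simpa using hG
  have h1 : HasDerivAt (fun z => G z - G z⁻¹) (G' - G' * (-1)) 1 := hG.sub (hG1.comp 1 hinv)
  have h2 : HasDerivAt (fun z : ℂ => z - z⁻¹) (1 - (-1)) 1 := (hasDerivAt_id 1).sub hinv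
  have hof : Tendsto (fun t : ℝ => (t : ℂ)) (𝓝[>] 1) (𝓝[≠] 1) := by
    refine tendsto_nhdsWithin_iff.2 ⟨?_, ?_⟩
    · have : Tendsto (fun t : ℝ => (t : ℂ)) (𝓝 1) (𝓝 ((1 : ℝ) : ℂ)) :=
        Complex.continuous_ofReal.tendsto 1
      rw [Complex.ofReal_one] at this
      exact this.mono_left nhdsWithin_le_nhds
    · filter_upwards [self_mem_nhdsWithin] with t ht
      have : t ≠ 1 := ne_of_gt ht
      simpa using this
  have h3 := ((hasDerivAt_iff_tendsto_slope.1 h1).comp hof).div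
    ((hasDerivAt_iff_tendsto_slope.1 h2).comp hof) (by norm_num)
  have e : (G' - G' * (-1)) / (1 - (-1)) = G' := by ring
  rw [e] at h3
  refine h3.congr' ?_
  filter_upwards [self_mem_nhdsWithin] with t ht
  have h1t : (t : ℂ) - 1 ≠ 0 := by
    have : t - 1 ≠ 0 := sub_ne_zero.2 (ne_of_gt ht)
    exact_mod_cast this
  simp only [Pi.div_apply, Function.comp, slope_def_field, inv_one, sub_self, sub_zero]
  rw [div_div_div_cancel_right₀ h1t]

theorem differentiableAt_thetaL (hq0 : 0 < q) (hq1 : q < 1) {z : ℂ} (hz : z ≠ 0)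
    (h : theta q z ≠ 0) : DifferentiableAt ℂ (thetaL q) z := by
  have hd : DifferentiableOn ℂ (theta q) {0}ᶜ := fun w hw =>
    (differentiableAt_theta hq0 hq1 hw).differentiableWithinAt
  have h1 : DifferentiableAt ℂ (deriv (theta q)) z :=
    (hd.deriv isOpen_compl_singleton).differentiableAt (isOpen_compl_singleton.mem_nhds hz)
  exact differentiableAt_id.mul (h1.div (differentiableAt_theta hq0 hq1 hz) h)

theorem pow_sub_inv_pow_le {τ : ℝ} (hτ : 1 ≤ τ) (n : ℕ) :
    0 ≤ τ ^ n - τ⁻¹ ^ n ∧ τ ^ n - τ⁻¹ ^ n ≤ n * τ ^ n * (τ - τ⁻¹) := by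
  have hi : τ⁻¹ ≤ 1 := inv_le_one_of_one_le₀ hτ
  have h0 : 0 < τ⁻¹ := by positivity
  refine ⟨sub_nonneg.2 (pow_le_pow_left₀ h0.le (hi.trans hτ) n), ?_⟩
  induction n with
  | zero => simp
  | succ n ih =>
    have h1 : τ⁻¹ ^ n ≤ τ ^ (n + 1) := (pow_le_one₀ h0.le hi).trans (one_le_pow₀ hτ)
    have h2 : 0 ≤ τ - τ⁻¹ := by linarith
    calc τ ^ (n + 1) - τ⁻¹ ^ (n + 1) = τ * (τ ^ n - τ⁻¹ ^ n) + τ⁻¹ ^ n * (τ - τ⁻¹) := by ring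
      _ ≤ τ * (n * τ ^ n * (τ - τ⁻¹)) + τ ^ (n + 1) * (τ - τ⁻¹) := by gcongr
      _ = _ := by push_cast; ring

/-- The bound is uniform as `τ ↓ 1` up to a slightly enlarged geometric factor, as dominated
convergence requires. -/
theorem norm_zpow_sub_zpow_le {τ : ℝ} (hτ : 1 < τ) (k : ℤ) :
    ‖((τ : ℂ) ^ (-k) - (τ : ℂ)⁻¹ ^ (-k)) / (τ - (τ : ℂ)⁻¹)‖ ≤ k.natAbs * τ ^ k.natAbs := by
  have hi : τ⁻¹ < 1 := inv_lt_one_of_one_lt₀ hτ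
  have hpos : 0 < τ - τ⁻¹ := by linarith
  have key : ∀ n : ℕ, ‖((τ : ℂ) ^ n - (τ : ℂ)⁻¹ ^ n) / (τ - (τ : ℂ)⁻¹)‖ ≤ n * τ ^ n := by
    intro n
    obtain ⟨h1, h2⟩ := pow_sub_inv_pow_le hτ.le n
    have e : ((τ : ℂ) ^ n - (τ : ℂ)⁻¹ ^ n) / (τ - (τ : ℂ)⁻¹) =
        ((τ ^ n - τ⁻¹ ^ n) / (τ - τ⁻¹) : ℝ) := by push_cast; rfl
    rw [e, Complex.norm_real, Real.norm_of_nonneg (by positivity), div_le_iff₀ hpos]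
    exact h2
  rcases le_total 0 k with hk | hk
  · obtain ⟨n, rfl⟩ := Int.eq_ofNat_of_zero_le hk
    have e1 : (τ : ℂ) ^ (-(n : ℤ)) = (τ : ℂ)⁻¹ ^ n := by simp
    have e2 : (τ : ℂ)⁻¹ ^ (-(n : ℤ)) = (τ : ℂ) ^ n := by simp
    rw [Int.natAbs_natCast, e1, e2, ← norm_neg, ← neg_div, neg_sub]
    exact key n
  · obtain ⟨n, hn⟩ := Int.eq_ofNat_of_zero_le (a := -k) (by omega)
    obtain rfl : k = -(n : ℤ) := by omega
    simpa using key n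

/-- The limit of `toep` as the two parameters coalesce. -/
def toepEq (q ζm ζp : ℝ) (g : ℂ) (a b : Bool) (k : ℤ) : ℂ :=
  -(constEq q ζm ζp g / g) *
  ((if a = b ∧ k = 0 then
    branchSign a * (base ζm ζp a * g * deriv (thetaL q) (base ζm ζp a * g)) else 0) +
  -branchSign b / (theta q (base ζm ζp b * g) * theta q (base ζm ζp b * g)) *
    (kronCoeff q (base ζm ζp a / base ζm ζp b) k * ((√q : ℝ) : ℂ) ^ k *
      (theta q (base ζm ζp a * g) * theta q (base ζm ζp b * g) *
        (thetaL q (base ζm ζp a * g) - thetaL q (base ζm ζp b * g) - k))))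

/-- The decay is geometric in both directions: for `k = -n` the coefficient is `O(q^n)`, while
`√q^k` grows only like `√q^(-n)`. -/
theorem kronCoeff_mul_le (hq0 : 0 < q) (hq1 : q < 1) {a : ℂ} (ha : a ≠ 0) :
    ∃ M : ℝ, 0 ≤ M ∧ ∀ k : ℤ, ‖kronCoeff q a k‖ * √q ^ k ≤ M * √q ^ k.natAbs := by
  obtain ⟨M, h1, h2⟩ := kronCoeff_bound hq0 hq1 ha
  have hs : 0 < √q := Real.sqrt_pos.2 hq0
  refine ⟨M, (norm_nonneg _).trans (h1 0), fun k => ?_⟩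
  rcases le_total 0 k with hk | hk
  · obtain ⟨n, rfl⟩ := Int.eq_ofNat_of_zero_le hk
    rw [Int.natAbs_natCast, zpow_natCast]
    gcongr
    exact h1 n
  · obtain ⟨n, hn⟩ := Int.eq_ofNat_of_zero_le (a := -k) (by omega)
    obtain rfl : k = -(n : ℤ) := by omega
    rw [Int.natAbs_neg, Int.natAbs_natCast, zpow_neg, zpow_natCast]
    calc ‖kronCoeff q a (-(n : ℤ))‖ * (√q ^ n)⁻¹ ≤ M * q ^ n * (√q ^ n)⁻¹ := by
          gcongr; exact h2 n
      _ = M * √q ^ n := by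
        nth_rewrite 1 [← Real.mul_self_sqrt hq0.le]
        rw [mul_pow]; field_simp

theorem exists_eventually_norm_le {ι α : Type*} [Finite ι] {F : Filter α} {f : ι → α → ℂ}
    (h : ∀ i, ∃ l, Tendsto (f i) F (𝓝 l)) :
    ∃ M : ℝ, 0 ≤ M ∧ ∀ᶠ τ in F, ∀ i, ‖f i τ‖ ≤ M := by
  have := Fintype.ofFinite ι
  choose l hl using h
  have h0 : ∀ i, 0 ≤ ‖l i‖ + 1 := fun i => by positivity
  refine ⟨∑ i, (‖l i‖ + 1), Finset.sum_nonneg fun i _ => h0 i, ?_⟩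
  refine eventually_all.2 fun i => ?_
  filter_upwards [(hl i).norm.eventually_le_const (lt_add_one _)] with τ hτ
  exact hτ.trans (Finset.single_le_sum (fun i _ => h0 i) (Finset.mem_univ i))

theorem summable_one_add_natAbs_mul_pow {x : ℝ} (hx : 0 ≤ x) (hx1 : x < 1) :
    Summable fun k : ℤ => (1 + (k.natAbs : ℝ)) * x ^ k.natAbs := by
  have h1 := summable_geometric_of_lt_one hx hx1
  have h2 := summable_pow_mul_geometric_of_norm_lt_one (r := x) 1
    (by rwa [Real.norm_of_nonneg hx])
  have h3 := h1.add h2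
  refine Summable.of_nat_of_neg ?_ ?_ <;>
  · refine h3.congr fun n => ?_
    simp; ring

theorem tendsto_ofReal_one_right : Tendsto (fun τ : ℝ => (τ : ℂ)) (𝓝[>] 1) (𝓝 1) := by
  have : Tendsto (fun t : ℝ => (t : ℂ)) (𝓝 1) (𝓝 ((1 : ℝ) : ℂ)) :=
    Complex.continuous_ofReal.tendsto 1
  rw [Complex.ofReal_one] at this
  exact this.mono_left nhdsWithin_le_nhds

theorem tendsto_inv_ofReal_one_right : Tendsto (fun τ : ℝ => (τ : ℂ)⁻¹) (𝓝[>] 1) (𝓝 1) := by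
  simpa using tendsto_ofReal_one_right.inv₀ one_ne_zero

theorem ofReal_sub_inv_ne_zero {τ : ℝ} (hτ : 1 < τ) : (τ : ℂ) - (τ : ℂ)⁻¹ ≠ 0 := by
  have hi : τ⁻¹ < 1 := inv_lt_one_of_one_lt₀ hτ
  have : τ - τ⁻¹ ≠ 0 := by linarith
  exact_mod_cast this

section Limit

variable {ζm ζp : ℝ} {g : ℂ}

theorem tendsto_theta_mul (hq0 : 0 < q) (hq1 : q < 1) {z : ℂ} (hz : z ≠ 0) {F : Filter ℝ}
    {f : ℝ → ℂ} (hf : Tendsto f F (𝓝 1)) :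
    Tendsto (fun τ => theta q (z * f τ)) F (𝓝 (theta q z)) := by
  have h1 : Tendsto (fun τ => z * f τ) F (𝓝 z) := by simpa using hf.const_mul z
  exact (continuousAt_theta hq0 hq1 hz).tendsto.comp h1

/-- As `τ ↓ 1` the Pochhammer pair in the denominator of `C` vanishes to second order, through `(1 -
τ²)(1 - τ⁻²) = -(τ - τ⁻¹)²`, while `δ - γ = g(τ - τ⁻¹)` vanishes to first order. The resulting
simple pole is compensated by the extra factor, and the minus sign comes from the same identity. -/
theorem tendsto_constC (hq0 : 0 < q) (hq1 : q < 1) (hζm : ζm < 0) (hζp : 0 < ζp) (hg : g ≠ 0)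
    (hprod : theta q (g ^ 2 * ζm * ζp) ≠ 0) :
    Tendsto (fun τ : ℝ => constC q ζm ζp (g * (τ : ℂ)⁻¹) (g * τ) * (τ - (τ : ℂ)⁻¹)) (𝓝[>] 1)
      (𝓝 (-(constEq q ζm ζp g / g))) := by
  have hm : (ζm : ℂ) ≠ 0 := by exact_mod_cast hζm.ne
  have hp : (ζp : ℂ) ≠ 0 := by exact_mod_cast hζp.ne'
  have t1 := tendsto_ofReal_one_right
  have t2 := tendsto_inv_ofReal_one_right
  have hP : ∀ f : ℝ → ℂ, Tendsto f (𝓝[>] 1) (𝓝 1) →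
      Tendsto (fun τ => qPoch q (q * f τ)) (𝓝[>] 1) (𝓝 (qPoch q q)) := by
    intro f hf
    have h1 : Tendsto (fun τ => (q : ℂ) * f τ) (𝓝[>] 1) (𝓝 q) := by simpa using hf.const_mul (q : ℂ)
    exact (differentiable_qPoch hq0 hq1 _).continuousAt.tendsto.comp h1
  have hqq := qPoch_self_ne_zero hq0 hq1
  have hmp : theta q (ζm / ζp) ≠ 0 := by
    have := theta_of_neg_ne_zero hq0 hq1 (div_neg_of_neg_of_pos hζm hζp)
    rwa [Complex.ofReal_div] at this
  have p1 := hP (fun τ => (τ : ℂ) ^ 2) (by simpa using t1.pow 2)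
  have p2 := hP (fun τ => (τ : ℂ)⁻¹ ^ 2) (by simpa using t2.pow 2)
  have n1 := tendsto_theta_mul hq0 hq1 (mul_ne_zero hg hm) t1
  have n2 := tendsto_theta_mul hq0 hq1 (mul_ne_zero hg hp) t1
  have n3 := tendsto_theta_mul hq0 hq1 (mul_ne_zero hg hm) t2
  have n4 := tendsto_theta_mul hq0 hq1 (mul_ne_zero hg hp) t2
  have L := (((((n3.mul n4).mul n1).mul n2).div_const
    (ζp * (theta q (ζm / ζp) * theta q (g ^ 2 * ζm * ζp)))).mul
    ((((p1.mul p2).const_mul g).mul_const (qPoch q q * qPoch q q)).inv₀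
      (by simp [hg, hqq]))).neg
  have e : -(constEq q ζm ζp g / g) = -(theta q (g * ζm) * theta q (g * ζp) * theta q (g * ζm) *
      theta q (g * ζp) / (ζp * (theta q (ζm / ζp) * theta q (g ^ 2 * ζm * ζp))) *
      (g * (qPoch q q * qPoch q q) * (qPoch q q * qPoch q q))⁻¹) := by
    unfold constEq
    generalize theta q (g * ζm) = a₁, theta q (g * ζp) = a₂, theta q (ζm / ζp) = a₃,
      theta q (g ^ 2 * ζm * ζp) = a₄ at *
    field_simp
  rw [e]
  refine L.congr' ?_
  have e1 : ∀ᶠ τ : ℝ in 𝓝[>] 1, qPoch q (q * (τ : ℂ) ^ 2) ≠ 0 := p1.eventually_ne hqq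
  have e2 : ∀ᶠ τ : ℝ in 𝓝[>] 1, qPoch q (q * (τ : ℂ)⁻¹ ^ 2) ≠ 0 := p2.eventually_ne hqq
  filter_upwards [self_mem_nhdsWithin, e1, e2] with τ hτ h1 h2
  have hτ0 : (τ : ℂ) ≠ 0 := ofReal_ne_zero_of_pos (one_pos.trans hτ)
  have hd := ofReal_sub_inv_ne_zero hτ
  have a1 : g * (τ : ℂ) / (g * (τ : ℂ)⁻¹) = (τ : ℂ) ^ 2 := by field_simp
  have a2 : g * (τ : ℂ)⁻¹ / (g * τ) = (τ : ℂ)⁻¹ ^ 2 := by field_simp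
  have a3 : g * (τ : ℂ)⁻¹ * (g * τ) = g ^ 2 := by field_simp
  have b1 : (1 - (τ : ℂ) ^ 2) * (1 - (τ : ℂ)⁻¹ ^ 2) = -(τ - (τ : ℂ)⁻¹) ^ 2 := by
    field_simp; ring
  have b2 : g * (τ : ℂ) - g * (τ : ℂ)⁻¹ = g * (τ - (τ : ℂ)⁻¹) := by ring
  have b3 : qPoch q ((τ : ℂ) ^ 2) * qPoch q ((τ : ℂ)⁻¹ ^ 2) =
      -(τ - (τ : ℂ)⁻¹) ^ 2 * (qPoch q (q * (τ : ℂ) ^ 2) * qPoch q (q * (τ : ℂ)⁻¹ ^ 2)) := by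
    rw [qPoch_eq_mul hq0 hq1 ((τ : ℂ) ^ 2), qPoch_eq_mul hq0 hq1 ((τ : ℂ)⁻¹ ^ 2), ← b1]; ring
  have c1 : ∀ z w : ℂ, g * z * w = g * w * z := fun z w => by ring
  rw [constC, a1, a2, a3, b2, b3, c1 _ (ζm : ℂ), c1 _ (ζp : ℂ), c1 _ (ζm : ℂ), c1 _ (ζp : ℂ)]
  generalize (τ : ℂ) - (τ : ℂ)⁻¹ = d at *
  generalize theta q (g * ζm * τ) = a₁, theta q (g * ζp * τ) = a₂,
    theta q (g * ζm * (τ : ℂ)⁻¹) = a₃,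
    theta q (g * ζp * (τ : ℂ)⁻¹) = a₄, theta q (ζm / ζp) = a₅, theta q (g ^ 2 * ζm * ζp) = a₆,
    qPoch q (q * (τ : ℂ) ^ 2) = a₇, qPoch q (q * (τ : ℂ)⁻¹ ^ 2) = a₈ at *
  field_simp

/-- The factor `τ - τ⁻¹` removes the pole of `C`, and everything else becomes symmetric difference
quotients. The difference of products is split into one in the theta functions and one in the powers
of `τ`. The double inverse is the second function value in the shape of `tendsto_symm_slope`. -/
theorem toep_coalescing {τ : ℝ} (hτ : 1 < τ) (C : ℂ) (a b : Bool) (k : ℤ) :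
    toep q ζm ζp (g * (τ : ℂ)⁻¹) (g * τ) τ C a b k =
    C * (τ - (τ : ℂ)⁻¹) *
      ((if a = b ∧ k = 0 then branchSign a * ((thetaL q (base ζm ζp a * g * τ) -
        thetaL q (base ζm ζp a * g * (τ : ℂ)⁻¹)) / (τ - (τ : ℂ)⁻¹)) else 0) +
      -branchSign b / (theta q (base ζm ζp b * g * (τ : ℂ)⁻¹) * theta q (base ζm ζp b * g * τ)) *
        (kronCoeff q (base ζm ζp a / base ζm ζp b) k * ((√q : ℝ) : ℂ) ^ k *
          ((theta q (base ζm ζp a * g * τ) * theta q (base ζm ζp b * g * (τ : ℂ)⁻¹) -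
            theta q (base ζm ζp a * g * (τ : ℂ)⁻¹) *
              theta q (base ζm ζp b * g * (τ : ℂ)⁻¹⁻¹)) / (τ - (τ : ℂ)⁻¹) * (τ : ℂ) ^ (-k) +
          theta q (base ζm ζp a * g * (τ : ℂ)⁻¹) * theta q (base ζm ζp b * g * τ) *
            (((τ : ℂ) ^ (-k) - (τ : ℂ)⁻¹ ^ (-k)) / (τ - (τ : ℂ)⁻¹))))) := by
  have hd := ofReal_sub_inv_ne_zero hτ
  have e1 : ((√q : ℝ) / τ : ℂ) ^ k = ((√q : ℝ) : ℂ) ^ k * (τ : ℂ) ^ (-k) := by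
    rw [zpow_neg, ← inv_zpow, ← mul_zpow, div_eq_mul_inv]
  have e2 : ((√q : ℝ) * τ : ℂ) ^ k = ((√q : ℝ) : ℂ) ^ k * (τ : ℂ)⁻¹ ^ (-k) := by
    rw [zpow_neg, inv_zpow, inv_inv, ← mul_zpow]
  rw [toep, e1, e2]
  simp only [← mul_assoc, inv_inv]
  generalize (τ : ℂ) - (τ : ℂ)⁻¹ = d at *
  generalize ((√q : ℝ) : ℂ) ^ k = s, (τ : ℂ) ^ (-k) = t₁, (τ : ℂ)⁻¹ ^ (-k) = t₂
  split_ifs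
  · field_simp
    ring
  · field_simp
    ring

/-- The Toeplitz matrix of the kernel with coinciding parameters has an idempotent symbol. -/
theorem idemSymbol_toepEq (hq0 : 0 < q) (hq1 : q < 1) (hζm : ζm < 0) (hζp : 0 < ζp) (hg : g ≠ 0)
    (hθ : ∀ a, theta q (base ζm ζp a * g) ≠ 0)
    (hprod : theta q (g ^ 2 * ζm * ζp) ≠ 0) : IdemSymbol (toepEq q ζm ζp g) := by
  have hb := base_ne_zero hζm hζp
  have hbg : ∀ a, (base ζm ζp a : ℂ) * g ≠ 0 := fun a => mul_ne_zero (hb a) hg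
  have hs : 0 < √q := Real.sqrt_pos.2 hq0
  have hs1 : √q < 1 := by rw [Real.sqrt_lt' one_pos]; simpa using hq1
  have t1 := tendsto_ofReal_one_right
  have t2 := tendsto_inv_ofReal_one_right
  have n1 := fun a => tendsto_theta_mul hq0 hq1 (hbg a) t1
  have n2 := fun a => tendsto_theta_mul hq0 hq1 (hbg a) t2
  -- Room for the limit: the powers of `τ` grow at most like `τ₁^|k|`, which the decay `√q^|k|`
  -- still beats.
  obtain ⟨τ₁, hτ₁, hτ₁'⟩ : ∃ τ₁ : ℝ, 1 < τ₁ ∧ √q * τ₁ < 1 := by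
    obtain ⟨x, hx1, hx2⟩ := exists_between ((one_lt_inv₀ hs).2 hs1)
    exact ⟨x, hx1, (lt_inv_mul_iff₀ hs).1 (by simpa using hx2)⟩
  have hT : ∀ᶠ τ : ℝ in 𝓝[>] 1, IdemSymbol (toep q ζm ζp (g * (τ : ℂ)⁻¹) (g * τ) τ
      (constC q ζm ζp (g * (τ : ℂ)⁻¹) (g * τ))) := by
    filter_upwards [Ioo_mem_nhdsGT hτ₁, eventually_all.2 fun a => (n1 a).eventually_ne (hθ a),
      eventually_all.2 fun a => (n2 a).eventually_ne (hθ a)] with τ hτ h1 h2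
    have hτ0 : (τ : ℂ) ≠ 0 := ofReal_ne_zero_of_pos (one_pos.trans hτ.1)
    have hn : ‖(τ : ℂ)‖ = τ := norm_ofReal_of_pos (one_pos.trans hτ.1)
    refine Param.idemSymbol (r := g) ⟨hq0, hq1, hζm, hζp, hg, ?_, ?_, ?_, ?_,
      fun a => ?_, fun a => ?_⟩ ?_ ?_
    · rw [div_eq_mul_inv]
    · rfl
    · rw [hn]; linarith [hτ.1]
    · rw [hn]; exact (mul_lt_mul_of_pos_left hτ.2 hs).trans hτ₁'
    · rw [← mul_assoc]; exact h2 a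
    · rw [← mul_assoc]; exact h1 a
    · intro e
      have := mul_left_cancel₀ hg e
      exact ofReal_sub_inv_ne_zero hτ.1 (by rw [this, sub_self])
    · have : g * (τ : ℂ)⁻¹ * (g * τ) = g ^ 2 := by field_simp
      rwa [this]
  have dL := fun a => tendsto_symm_slope (G := fun z => thetaL q (base ζm ζp a * g * z))
    (G' := deriv (thetaL q) (base ζm ζp a * g) * (base ζm ζp a * g)) (by
      have h1 : HasDerivAt (fun z : ℂ => base ζm ζp a * g * z) (base ζm ζp a * g) 1 := by
        simpa using (hasDerivAt_id (1 : ℂ)).const_mul (base ζm ζp a * g : ℂ)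
      exact HasDerivAt.comp 1 (h₂ := thetaL q)
        (by rw [mul_one]; exact (differentiableAt_thetaL hq0 hq1 (hbg a) (hθ a)).hasDerivAt) h1)
  have dX := fun a b => tendsto_symm_slope
    (G := fun z => theta q (base ζm ζp a * g * z) * theta q (base ζm ζp b * g * z⁻¹))
    (G' := theta q (base ζm ζp a * g) * theta q (base ζm ζp b * g) *
        (thetaL q (base ζm ζp a * g) - thetaL q (base ζm ζp b * g))) (by
      have hd := fun a => (differentiableAt_theta hq0 hq1 (hbg a)).hasDerivAt
      have h1 : HasDerivAt (fun z : ℂ => base ζm ζp a * g * z) (base ζm ζp a * g) 1 := by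
        simpa using (hasDerivAt_id (1 : ℂ)).const_mul (base ζm ζp a * g : ℂ)
      have h2 : HasDerivAt (fun z : ℂ => base ζm ζp b * g * z⁻¹) (base ζm ζp b * g * (-1)) 1 := by
        have := (hasDerivAt_inv (one_ne_zero : (1 : ℂ) ≠ 0)).const_mul (base ζm ζp b * g : ℂ)
        simpa using this
      have h3 := HasDerivAt.comp 1 (h₂ := theta q) (by rw [mul_one]; exact hd a) h1
      have h4 := HasDerivAt.comp 1 (h₂ := theta q) (by rw [inv_one, mul_one]; exact hd b) h2
      have h5 := h3.mul h4
      convert! h5 using 1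
      simp only [Function.comp, inv_one, mul_one, thetaL]
      have ha := hθ a
      have hb := hθ b
      generalize theta q (base ζm ζp a * g) = x₁ at *
      generalize theta q (base ζm ζp b * g) = x₂ at *
      field_simp
      ring)
  have dk := fun k : ℤ => tendsto_symm_slope (G := fun z => z ^ (-k)) (G' := -(k : ℂ)) (by
    simpa using hasDerivAt_zpow (-k) (1 : ℂ) (Or.inl one_ne_zero))
  have dC := tendsto_constC hq0 hq1 hζm hζp hg hprod
  have dk1 : ∀ k : ℤ, Tendsto (fun τ : ℝ => (τ : ℂ) ^ (-k)) (𝓝[>] 1) (𝓝 1) := fun k => by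
    simpa using t1.zpow₀ (-k) (Or.inl one_ne_zero)
  have dD : ∀ b, Tendsto (fun τ : ℝ => -branchSign b / (theta q (base ζm ζp b * g * (τ : ℂ)⁻¹) *
      theta q (base ζm ζp b * g * τ))) (𝓝[>] 1)
      (𝓝 (-branchSign b / (theta q (base ζm ζp b * g) * theta q (base ζm ζp b * g)))) := fun b =>
    tendsto_const_nhds.div ((n2 b).mul (n1 b)) (mul_ne_zero (hθ b) (hθ b))
  have dY := fun a b => (n2 a).mul (n1 b)
  obtain ⟨M₁, hM₁, m₁⟩ := exists_eventually_norm_le (ι := Unit) fun _ => ⟨_, dC⟩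
  obtain ⟨M₂, hM₂, m₂⟩ := exists_eventually_norm_le fun a => ⟨_, dL a⟩
  obtain ⟨M₃, hM₃, m₃⟩ := exists_eventually_norm_le fun b => ⟨_, dD b⟩
  obtain ⟨M₄, hM₄, m₄⟩ := exists_eventually_norm_le (ι := Bool × Bool) fun p => ⟨_, dX p.1 p.2⟩
  obtain ⟨M₅, hM₅, m₅⟩ := exists_eventually_norm_le (ι := Bool × Bool) fun p => ⟨_, dY p.1 p.2⟩
  have hK := fun p : Bool × Bool => kronCoeff_mul_le hq0 hq1 (div_ne_zero (hb p.1) (hb p.2))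
  choose K hK0 hK using hK
  let K' := ∑ p, K p
  have hK' : ∀ a b k, ‖kronCoeff q (base ζm ζp a / base ζm ζp b) k‖ * √q ^ k ≤
      K' * √q ^ k.natAbs := fun a b k => (hK (a, b) k).trans (by
    gcongr
    exact Finset.single_le_sum (fun p _ => hK0 p) (Finset.mem_univ (a, b)))
  have hK'0 : 0 ≤ K' := Finset.sum_nonneg fun p _ => hK0 p
  refine IdemSymbol.of_tendsto hT (fun a b k => ?_)
    (bound := fun k => M₁ * (M₂ + M₃ * (K' * (M₄ + M₅))) *
      ((1 + (k.natAbs : ℝ)) * (√q * τ₁) ^ k.natAbs))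
    ((summable_one_add_natAbs_mul_pow (by positivity) hτ₁').mul_left _) ?_
  · have L : Tendsto (fun τ : ℝ => constC q ζm ζp (g * (τ : ℂ)⁻¹) (g * τ) * (τ - (τ : ℂ)⁻¹) *
      ((if a = b ∧ k = 0 then branchSign a * ((thetaL q (base ζm ζp a * g * τ) -
        thetaL q (base ζm ζp a * g * (τ : ℂ)⁻¹)) / (τ - (τ : ℂ)⁻¹)) else 0) +
      -branchSign b / (theta q (base ζm ζp b * g * (τ : ℂ)⁻¹) * theta q (base ζm ζp b * g * τ)) *
        (kronCoeff q (base ζm ζp a / base ζm ζp b) k * ((√q : ℝ) : ℂ) ^ k *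
          ((theta q (base ζm ζp a * g * τ) * theta q (base ζm ζp b * g * (τ : ℂ)⁻¹) -
            theta q (base ζm ζp a * g * (τ : ℂ)⁻¹) *
              theta q (base ζm ζp b * g * (τ : ℂ)⁻¹⁻¹)) / (τ - (τ : ℂ)⁻¹) * (τ : ℂ) ^ (-k) +
          theta q (base ζm ζp a * g * (τ : ℂ)⁻¹) * theta q (base ζm ζp b * g * τ) *
            (((τ : ℂ) ^ (-k) - (τ : ℂ)⁻¹ ^ (-k)) / (τ - (τ : ℂ)⁻¹)))))) (𝓝[>] 1)
        (𝓝 (toepEq q ζm ζp g a b k)) := by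
      have h1 : Tendsto (fun τ : ℝ => if a = b ∧ k = 0 then
          branchSign a * ((thetaL q (base ζm ζp a * g * τ) -
          thetaL q (base ζm ζp a * g * (τ : ℂ)⁻¹)) / (τ - (τ : ℂ)⁻¹)) else 0) (𝓝[>] 1)
          (𝓝 (if a = b ∧ k = 0 then branchSign a *
            (deriv (thetaL q) (base ζm ζp a * g) * (base ζm ζp a * g)) else 0)) := by
        split_ifs
        · exact (dL a).const_mul _
        · exact tendsto_const_nhds
      have h2 := dC.mul (h1.add ((dD b).mul ((((dX a b).mul (dk1 k)).add
        ((dY a b).mul (dk k))).const_mul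
        (kronCoeff q (base ζm ζp a / base ζm ζp b) k * ((√q : ℝ) : ℂ) ^ k))))
      convert! h2 using 2
      rw [toepEq, mul_comm (deriv (thetaL q) _)]
      congr 3
      ring
    refine L.congr' ?_
    filter_upwards [self_mem_nhdsWithin] with τ hτ
    exact (toep_coalescing hτ _ a b k).symm
  · filter_upwards [Ioo_mem_nhdsGT hτ₁, m₁, m₂, m₃, m₄, m₅] with τ hτ b₁ b₂ b₃ b₄ b₅ a b k
    have hτ0 : 0 < τ := one_pos.trans hτ.1
    rw [toep_coalescing hτ.1]
    have c1 : ‖(if a = b ∧ k = 0 then branchSign a * ((thetaL q (base ζm ζp a * g * τ) -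
        thetaL q (base ζm ζp a * g * (τ : ℂ)⁻¹)) / (τ - (τ : ℂ)⁻¹)) else 0)‖ ≤
        M₂ * ((1 + (k.natAbs : ℝ)) * (√q * τ₁) ^ k.natAbs) := by
      split_ifs with h
      · obtain ⟨-, rfl⟩ := h
        have : ‖branchSign a‖ = 1 := by cases a <;> simp [branchSign]
        rw [norm_mul, this]
        simpa using b₂ a
      · rw [norm_zero]; positivity
    have p1 : ‖(τ : ℂ) ^ (-k)‖ ≤ (1 + (k.natAbs : ℝ)) * τ₁ ^ k.natAbs := by
      rw [norm_zpow, norm_ofReal_of_pos hτ0]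
      calc τ ^ (-k) ≤ τ ^ (k.natAbs : ℤ) := zpow_le_zpow_right₀ hτ.1.le (by omega)
        _ ≤ τ₁ ^ k.natAbs := by
          rw [zpow_natCast]; exact pow_le_pow_left₀ hτ0.le hτ.2.le _
        _ ≤ _ := le_mul_of_one_le_left (by positivity) (by simp)
    have p2 : ‖((τ : ℂ) ^ (-k) - (τ : ℂ)⁻¹ ^ (-k)) / (τ - (τ : ℂ)⁻¹)‖ ≤
        (1 + (k.natAbs : ℝ)) * τ₁ ^ k.natAbs := by
      refine (norm_zpow_sub_zpow_le hτ.1 k).trans ?_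
      gcongr
      · linarith
      · exact hτ.2.le
    have p3 : ‖kronCoeff q (base ζm ζp a / base ζm ζp b) k * ((√q : ℝ) : ℂ) ^ k‖ ≤
        K' * √q ^ k.natAbs := by
      rw [norm_mul, norm_zpow, norm_ofReal_of_pos hs]
      exact hK' a b k
    rw [norm_mul]
    have c2 := b₃ b
    have c3 := b₄ (a, b)
    have c4 := b₅ (a, b)
    calc _ ≤ M₁ * (M₂ * ((1 + (k.natAbs : ℝ)) * (√q * τ₁) ^ k.natAbs) + M₃ *
          ((K' * √q ^ k.natAbs) * (M₄ * ((1 + (k.natAbs : ℝ)) * τ₁ ^ k.natAbs) +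
            M₅ * ((1 + (k.natAbs : ℝ)) * τ₁ ^ k.natAbs)))) := by
          gcongr
          · exact b₁ ()
          · refine (norm_add_le _ _).trans (add_le_add c1 ?_)
            rw [norm_mul, norm_mul _ (_ + _)]
            gcongr
            refine (norm_add_le _ _).trans (add_le_add ?_ ?_)
            · rw [norm_mul]; gcongr
            · rw [norm_mul]; gcongr
      _ = _ := by rw [mul_pow]; ring

end Limit

end

section

/-! ### Matrices defining orthogonal projections of `ℓ²` -/

/-- Weighted Cauchy–Schwarz, from `∑ aᵢ (bᵢ - t)² ≥ 0` with `t = (∑ aᵢ bᵢ)/M`. -/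
theorem sq_tsum_mul_le {ι : Type*} {a b : ι → ℝ} {M : ℝ} (hM : 0 < M) (ha : ∀ i, 0 ≤ a i)
    (hsa : Summable a) (haM : ∑' i, a i ≤ M) (h1 : Summable fun i => a i * b i)
    (h2 : Summable fun i => a i * b i ^ 2) :
    (∑' i, a i * b i) ^ 2 ≤ M * ∑' i, a i * b i ^ 2 := by
  let t := (∑' i, a i * b i) / M
  have hs := ((h2.hasSum.sub (h1.hasSum.mul_left (2 * t))).add (hsa.hasSum.mul_left (t ^ 2)))
  have h0 : 0 ≤ ∑' i, a i * b i ^ 2 - 2 * t * ∑' i, a i * b i + t ^ 2 * ∑' i, a i := by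
    rw [← hs.tsum_eq]
    refine tsum_nonneg fun i => ?_
    have : a i * b i ^ 2 - 2 * t * (a i * b i) + t ^ 2 * a i = a i * (b i - t) ^ 2 := by ring
    rw [this]
    exact mul_nonneg (ha i) (sq_nonneg _)
  have h3 : t ^ 2 * ∑' i, a i ≤ t ^ 2 * M := by gcongr
  have h4 : t * M = ∑' i, a i * b i := div_mul_cancel₀ _ hM.ne'
  have h5 : 0 ≤ M * (∑' i, a i * b i ^ 2 - 2 * t * ∑' i, a i * b i + t ^ 2 * M) :=
    mul_nonneg hM.le (by linarith)
  have h6 : M * (2 * t * ∑' i, a i * b i) = 2 * (∑' i, a i * b i) ^ 2 := by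
    rw [← h4]; ring
  have h7 : M * (t ^ 2 * M) = (∑' i, a i * b i) ^ 2 := by rw [← h4]; ring
  linarith

section Schur

variable {ι : Type*} {k : ι → ι → ℂ} {M : ℝ}

theorem summable_kernel_mul (hs : ∀ x, Summable fun y => ‖k x y‖) (f : lp (fun _ : ι => ℂ) 2)
    (x : ι) : Summable fun y => ‖k x y‖ * ‖f y‖ :=
  Summable.of_nonneg_of_le (fun y => by positivity)
    (fun y => mul_le_mul_of_nonneg_left (lp.norm_apply_le_norm two_ne_zero f y) (norm_nonneg _))
    ((hs x).mul_right ‖f‖)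

/-- Schur's test. -/
theorem schur_bound (hM : 0 < M) (hs : ∀ x, Summable fun y => ‖k x y‖)
    (hsM : ∀ x, ∑' y, ‖k x y‖ ≤ M) (hsym : ∀ x y, ‖k y x‖ = ‖k x y‖)
    (f : lp (fun _ : ι => ℂ) 2) (s : Finset ι) :
    ∑ x ∈ s, ‖∑' y, k x y * f y‖ ^ (2 : ℝ) ≤ (M * ‖f‖) ^ (2 : ℝ) := by
  have hf2 : HasSum (fun y => ‖f y‖ ^ 2) (‖f‖ ^ 2) := by
    have := lp.hasSum_norm (p := 2) (by simp) f
    simpa using this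
  have h2 : ∀ x, Summable fun y => ‖k x y‖ * ‖f y‖ ^ 2 := fun x => by
    refine Summable.of_nonneg_of_le (fun y => by positivity) (fun y => ?_)
      ((summable_kernel_mul hs f x).mul_right ‖f‖)
    rw [sq, ← mul_assoc]
    exact mul_le_mul_of_nonneg_left (lp.norm_apply_le_norm two_ne_zero f y) (by positivity)
  have h1 : ∀ x, ‖∑' y, k x y * f y‖ ^ (2 : ℝ) ≤ M * ∑' y, ‖k x y‖ * ‖f y‖ ^ 2 := fun x => by
    rw [Real.rpow_two]
    refine le_trans ?_ (sq_tsum_mul_le hM (fun y => norm_nonneg (k x y)) (hs x) (hsM x)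
      (summable_kernel_mul hs f x) (h2 x))
    gcongr
    refine (norm_tsum_le_tsum_norm ?_).trans_eq ?_
    · simpa using summable_kernel_mul hs f x
    · simp
  calc ∑ x ∈ s, ‖∑' y, k x y * f y‖ ^ (2 : ℝ) ≤ ∑ x ∈ s, M * ∑' y, ‖k x y‖ * ‖f y‖ ^ 2 :=
        Finset.sum_le_sum fun x _ => h1 x
    _ = M * ∑' y, ∑ x ∈ s, ‖k x y‖ * ‖f y‖ ^ 2 := by
        rw [← Finset.mul_sum, Summable.tsum_finsetSum fun x _ => h2 x]
    _ ≤ M * ∑' y, M * ‖f y‖ ^ 2 := by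
        gcongr with y
        · exact summable_sum fun x _ => h2 x
        · exact hf2.summable.mul_left M
        · rw [← Finset.sum_mul]
          gcongr
          -- Symmetry of the moduli turns column sums into row sums, so one bound serves for both.
          calc ∑ x ∈ s, ‖k x y‖ = ∑ x ∈ s, ‖k y x‖ := Finset.sum_congr rfl fun x _ => hsym y x
            _ ≤ ∑' x, ‖k y x‖ := (hs y).sum_le_tsum s fun x _ => norm_nonneg _
            _ ≤ M := hsM y
    _ = (M * ‖f‖) ^ (2 : ℝ) := by
        rw [tsum_mul_left, hf2.tsum_eq, Real.rpow_two]; ring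

theorem exists_clm_of_schur (hs : ∀ x, Summable fun y => ‖k x y‖)
    (hsM : ∀ x, ∑' y, ‖k x y‖ ≤ M) (hsym : ∀ x y, ‖k y x‖ = ‖k x y‖) :
    ∃ K : lp (fun _ : ι => ℂ) 2 →L[ℂ] lp (fun _ : ι => ℂ) 2,
      ∀ f x, HasSum (fun y => k x y * f y) (K f x) := by
  -- `M` may vanish, for instance for an empty index set; the weighted Cauchy–Schwarz step divides
  -- by a positive bound.
  have hM' : 0 < |M| + 1 := by positivity
  have hsM' : ∀ x, ∑' y, ‖k x y‖ ≤ |M| + 1 := fun x =>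
    (hsM x).trans ((le_abs_self M).trans (by linarith))
  have hsum : ∀ (f : lp (fun _ : ι => ℂ) 2) x, Summable fun y => k x y * f y := fun f x =>
    Summable.of_norm (by simpa using summable_kernel_mul hs f x)
  have hmem : ∀ f : lp (fun _ : ι => ℂ) 2, Memℓp (fun x => ∑' y, k x y * f y) 2 := fun f =>
    memℓp_gen' (C := ((|M| + 1) * ‖f‖) ^ (2 : ℝ)) fun s => by
      simpa using schur_bound hM' hs hsM' hsym f s
  let T : lp (fun _ : ι => ℂ) 2 →ₗ[ℂ] lp (fun _ : ι => ℂ) 2 :=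
    { toFun := fun f => ⟨fun x => ∑' y, k x y * f y, hmem f⟩
      map_add' := fun f g => by
        ext x
        simp only [lp.coeFn_add, Pi.add_apply, mul_add]
        exact (hsum f x).tsum_add (hsum g x)
      map_smul' := fun c f => by
        ext x
        simp only [lp.coeFn_smul, Pi.smul_apply, smul_eq_mul, RingHom.id_apply, ← tsum_mul_left]
        exact tsum_congr fun y => by ring }
  refine ⟨T.mkContinuous (|M| + 1) fun f => ?_, fun f x => (hsum f x).hasSum⟩
  refine lp.norm_le_of_forall_sum_le (by simp) (by positivity) fun s => ?_
  rw [ENNReal.toReal_ofNat]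
  exact schur_bound hM' hs hsM' hsym f s

/-- A Hermitian idempotent matrix that satisfies Schur's test defines an orthogonal projection. -/
theorem exists_projection_of_schur (hs : ∀ x, Summable fun y => ‖k x y‖)
    (hsM : ∀ x, ∑' y, ‖k x y‖ ≤ M) (hsym : ∀ x y, k y x = conj (k x y))
    (hmul : ∀ x z, HasSum (fun y => k x y * k y z) (k x z)) :
    ∃ K : lp (fun _ : ι => ℂ) 2 →L[ℂ] lp (fun _ : ι => ℂ) 2,
      (∀ f x, HasSum (fun y => k x y * f y) (K f x)) ∧
        K = ContinuousLinearMap.adjoint K ∧ K = K ∘L K := by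
  classical
  obtain ⟨K, hK⟩ := exists_clm_of_schur hs hsM fun x y => by rw [hsym x y, RCLike.norm_conj]
  have hsingle : ∀ z (c : ℂ) x, K (lp.single 2 z c) x = k x z * c := fun z c x => by
    refine (hK _ x).unique ?_
    convert! hasSum_ite_eq z (k x z * c) using 2 with y
    by_cases hy : y = z
    · subst hy; simp
    · rw [lp.single_apply_ne _ _ _ hy, mul_zero, if_neg hy]
  refine ⟨K, hK, ?_, ?_⟩
  -- Continuous operators on `ℓ²` are determined on vectors supported at one point, where both
  -- identities reduce to matrix entries.
  · refine lp.ext_continuousLinearMap (by simp) fun z => ContinuousLinearMap.ext fun c => lp.ext ?_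
    funext x
    change K (lp.single 2 z c) x = ContinuousLinearMap.adjoint K (lp.single 2 z c) x
    have h1 : inner ℂ (lp.single 2 x (1 : ℂ)) (ContinuousLinearMap.adjoint K (lp.single 2 z c)) =
        inner ℂ (K (lp.single 2 x (1 : ℂ))) (lp.single 2 z c) :=
      ContinuousLinearMap.adjoint_inner_right K _ _
    rw [lp.inner_single_left, lp.inner_single_right, hsingle] at h1
    simp only [RCLike.inner_apply, map_one, mul_one] at h1
    rw [h1, hsingle, hsym z x, mul_comm]
  · refine lp.ext_continuousLinearMap (by simp) fun z => ContinuousLinearMap.ext fun c => lp.ext ?_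
    funext x
    change K (lp.single 2 z c) x = K (K (lp.single 2 z c)) x
    refine (hsingle z c x).trans (((hmul x z).mul_right c).unique ?_)
    have := hK (K (lp.single 2 z c)) x
    simpa only [hsingle, ← mul_assoc] using this

end Schur

/-- A Hermitian matrix that is diagonally conjugate to a block Toeplitz matrix with idempotent
symbol defines an orthogonal projection. -/
theorem exists_projection_of_idemSymbol {ι : Type*} {k : ι → ι → ℂ} {B : Bool → Bool → ℤ → ℂ}
    (hB : IdemSymbol B) (e : Bool × ℤ ≃ ι) {H : Bool × ℤ → ℂ} {h : Bool → ℝ} (hh : ∀ a, h a ≠ 0)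
    (hH : ∀ p, ‖H p‖ = h p.1)
    (hk : ∀ p p', k (e p) (e p') = H p * B p.1 p'.1 (p.2 - p'.2) / H p')
    (hsym : ∀ x y, k y x = conj (k x y)) :
    ∃ K : lp (fun _ : ι => ℂ) 2 →L[ℂ] lp (fun _ : ι => ℂ) 2,
      (∀ f x, HasSum (fun y => k x y * f y) (K f x)) ∧
        K = ContinuousLinearMap.adjoint K ∧ K = K ∘L K := by
  have hH0 : ∀ p, H p ≠ 0 := fun p => norm_ne_zero_iff.1 (by rw [hH]; exact hh _)
  have hrow : ∀ a n, HasSum (fun p => ‖k (e (a, n)) (e p)‖)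
      -- Since `‖H‖` depends only on the branch, the absolute row sums do not depend on `n`; this
      -- gives the uniform bound for Schur's test.
      (∑ b, h a / h b * ∑' m, ‖B a b m‖) := by
    intro a n
    refine hasSum_bool_prod fun b => ?_
    have := ((Equiv.subLeft n).hasSum_iff.2 (hB.summable a b).norm.hasSum).mul_left (h a / h b)
    convert! this using 2 with m
    rw [hk, norm_div, norm_mul, hH, hH]
    simp only [Function.comp, Equiv.subLeft_apply]
    ring
  have hh0 : ∀ a, 0 < h a := fun a =>
    lt_of_le_of_ne ((norm_nonneg _).trans_eq (hH (a, 0))) (hh a).symm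
  have hrow' : ∀ x, Summable (fun y => ‖k x y‖) ∧
      ∑' y, ‖k x y‖ ≤ ∑ a, ∑ b, h a / h b * ∑' m, ‖B a b m‖ := by
    intro x
    obtain ⟨⟨a, n⟩, rfl⟩ := e.surjective x
    have h1 : HasSum (fun y => ‖k (e (a, n)) y‖) _ := e.hasSum_iff.1 (hrow a n)
    refine ⟨h1.summable, h1.tsum_eq.trans_le ?_⟩
    exact Finset.single_le_sum (f := fun a => ∑ b, h a / h b * ∑' m, ‖B a b m‖)
      (fun a _ => Finset.sum_nonneg fun b _ =>
        mul_nonneg (div_pos (hh0 a) (hh0 b)).le (tsum_nonneg fun m => norm_nonneg _))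
      (Finset.mem_univ a)
  refine exists_projection_of_schur (fun x => (hrow' x).1) (fun x => (hrow' x).2) hsym ?_
  intro x z
  obtain ⟨⟨a, n⟩, rfl⟩ := e.surjective x
  obtain ⟨⟨c, l⟩, rfl⟩ := e.surjective z
  rw [← e.hasSum_iff, hk]
  have := (hB.hasSum a c n l).mul_left (H (a, n) / H (c, l))
  convert! this using 1
  · ext p
    have := hH0 p
    simp only [Function.comp, hk]
    field_simp
  · ring

end

section

variable {q ζm ζp : ℝ} {γ δ : ℂ}

/-! ### The lattice -/

theorem mem_lattice_iff {x : ℝ} :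
    x ∈ lattice q ζm ζp ↔ ∃ p : Bool × ℤ, base ζm ζp p.1 * q ^ p.2 = x := by
  constructor
  · rintro ⟨n, h | h⟩
    · exact ⟨(false, n), h.symm⟩
    · exact ⟨(true, n), h.symm⟩
  · rintro ⟨⟨a, n⟩, rfl⟩
    cases a
    · exact ⟨n, Or.inl rfl⟩
    · exact ⟨n, Or.inr rfl⟩

theorem base_mul_mem (a : Bool) (n : ℤ) : base ζm ζp a * q ^ n ∈ lattice q ζm ζp :=
  mem_lattice_iff.2 ⟨(a, n), rfl⟩

theorem base_mem (a : Bool) : base ζm ζp a ∈ lattice q ζm ζp := by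
  simpa using base_mul_mem (q := q) (ζm := ζm) (ζp := ζp) a 0

/-- The parametrization of the lattice by branch and exponent. -/
def latticeEquiv (hq0 : 0 < q) (hq1 : q < 1) (hζm : ζm < 0) (hζp : 0 < ζp) :
    Bool × ℤ ≃ lattice q ζm ζp :=
  Equiv.ofBijective (fun p => ⟨base ζm ζp p.1 * q ^ p.2, base_mul_mem p.1 p.2⟩) (by
    constructor
    · rintro ⟨a, n⟩ ⟨b, m⟩ h
      have h' : base ζm ζp a * q ^ n = base ζm ζp b * q ^ m := congrArg Subtype.val h
      have hn := zpow_pos hq0 n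
      have hm := zpow_pos hq0 m
      have hab : a = b := by
        by_contra hab
        cases a <;> cases b <;> simp [base] at hab h'
        · nlinarith [mul_pos hζp hm, mul_neg_of_neg_of_pos hζm hn]
        · nlinarith [mul_pos hζp hn, mul_neg_of_neg_of_pos hζm hm]
      subst hab
      have hb : base ζm ζp a ≠ 0 := by exact_mod_cast base_ne_zero hζm hζp a
      rw [zpow_right_injective₀ hq0 hq1.ne (mul_left_cancel₀ hb h')]
    · rintro ⟨x, hx⟩
      obtain ⟨p, hp⟩ := mem_lattice_iff.1 hx
      exact ⟨p, Subtype.ext hp⟩)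

theorem branchSign_mul_base (hζm : ζm < 0) (hζp : 0 < ζp) (a : Bool) :
    branchSign a * base ζm ζp a = (|base ζm ζp a| : ℝ) := by
  cases a
  · simp [branchSign, base, abs_of_neg hζm]
  · simp [branchSign, base, abs_of_pos hζp]

theorem branchSign_sq (a : Bool) : branchSign a * branchSign a = 1 := by
  cases a <;> simp [branchSign]

theorem ne_zero_of_mem_lattice (hq0 : 0 < q) (hζm : ζm < 0) (hζp : 0 < ζp) {x : ℝ}
    (hx : x ∈ lattice q ζm ζp) : x ≠ 0 := by
  obtain ⟨⟨a, n⟩, rfl⟩ := mem_lattice_iff.1 hx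
  exact mul_ne_zero (by exact_mod_cast base_ne_zero hζm hζp a) (zpow_pos hq0 n).ne'

/-! ### Consequences of admissibility -/

/-- The properties of an admissible pair that enter the proof. -/
structure Good (q ζm ζp : ℝ) (γ δ : ℂ) (R : ℝ) : Prop where
  hq0 : 0 < q
  hq1 : q < 1
  hζm : ζm < 0
  hζp : 0 < ζp
  pos : ∀ x ∈ lattice q ζm ζp, ∃ p : ℝ, 0 < p ∧ theta q (x * γ) * theta q (x * δ) = p
  hR : 0 < R
  prod : γ * δ = R
  lower : √q < ‖δ / (√R : ℝ)‖
  upper : √q * ‖δ / (√R : ℝ)‖ < 1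
  symm : (conj γ = δ ∧ conj δ = γ) ∨ (conj γ = γ ∧ conj δ = δ)

theorem theta_ofReal (q x : ℝ) : theta q x = ((theta q x).re : ℂ) := by
  exact (Complex.conj_eq_iff_re.1 (by rw [← theta_conj, Complex.conj_ofReal])).symm

theorem zpow_ne_of_between (hq0 : 0 < q) (hq1 : q < 1) {s : ℝ} {n : ℤ} (h1 : q ^ (n + 1) < s)
    (h2 : s < q ^ n) (j : ℤ) : s ≠ q ^ j := by
  rintro rfl
  have := (zpow_lt_zpow_iff_right_of_lt_one₀ hq0 hq1).1 h1
  have := (zpow_lt_zpow_iff_right_of_lt_one₀ hq0 hq1).1 h2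
  omega

theorem theta_mul_ne_zero_of_between (hq0 : 0 < q) (hq1 : q < 1) (hζm : ζm < 0) (hζp : 0 < ζp)
    {t : ℝ} {a : Bool} {n : ℤ} (h1 : q ^ (n + 1) < base ζm ζp a * t)
    (h2 : base ζm ζp a * t < q ^ n) {x : ℝ} (hx : x ∈ lattice q ζm ζp) : theta q (x * t) ≠ 0 := by
  obtain ⟨⟨b, k⟩, rfl⟩ := mem_lattice_iff.1 hx
  have hk := zpow_pos hq0 k
  have ht : 0 < base ζm ζp a * t := (zpow_pos hq0 _).trans h1
  by_cases hab : a = b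
  · subst hab
    have e : ((base ζm ζp a * q ^ k : ℝ) * t : ℂ) = ((q ^ k * (base ζm ζp a * t) : ℝ) : ℂ) := by
      push_cast; ring
    rw [e]
    refine theta_ne_zero hq0 hq1 (ofReal_ne_zero_of_pos (by positivity)) fun j hj => ?_
    have hj' : q ^ k * (base ζm ζp a * t) = q ^ j := by exact_mod_cast hj
    refine zpow_ne_of_between hq0 hq1 h1 h2 (j - k) ?_
    rw [zpow_sub₀ hq0.ne', ← hj']
    field_simp
  · have e : ((base ζm ζp b * q ^ k : ℝ) * t : ℂ) =
        ((base ζm ζp b / base ζm ζp a * (q ^ k * (base ζm ζp a * t)) : ℝ) : ℂ) := by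
      have := base_ne_zero hζm hζp a
      push_cast; field_simp
    rw [e]
    refine theta_of_neg_ne_zero hq0 hq1 (mul_neg_of_neg_of_pos ?_ (by positivity))
    exact base_div_neg hζm hζp (Ne.symm hab)

/-- For real `x` and `v` the function `v ↦ θ(xv)` is real and continuous. For lattice `x` it has no
zero between `s` and `t`, so it keeps its sign there by the intermediate value theorem. -/
theorem theta_mul_theta_pos (hq0 : 0 < q) (hq1 : q < 1) (hζm : ζm < 0) (hζp : 0 < ζp)
    {s t : ℝ} {a : Bool} {n : ℤ} (hs : q ^ (n + 1) < base ζm ζp a * s)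
    (hs' : base ζm ζp a * s < q ^ n) (ht : q ^ (n + 1) < base ζm ζp a * t)
    (ht' : base ζm ζp a * t < q ^ n) {x : ℝ} (hx : x ∈ lattice q ζm ζp) :
    ∃ p : ℝ, 0 < p ∧ theta q (x * s) * theta q (x * t) = p := by
  let φ : ℝ → ℝ := fun v => (theta q (x * v)).re
  have hφ : ∀ v : ℝ, theta q (x * v) = (φ v : ℂ) := fun v => by
    have := theta_ofReal q (x * v)
    rwa [Complex.ofReal_mul] at this
  have hx0 := ne_zero_of_mem_lattice hq0 hζm hζp hx
  have hbt : ∀ v ∈ Set.uIcc s t, q ^ (n + 1) < base ζm ζp a * v ∧ base ζm ζp a * v < q ^ n := by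
    intro v hv
    rcases Set.mem_uIcc.1 hv with ⟨h1, h2⟩ | ⟨h1, h2⟩ <;>
    rcases le_total 0 (base ζm ζp a) with h | h <;>
    constructor <;>
    nlinarith [mul_le_mul_of_nonneg_left h1 (abs_nonneg (base ζm ζp a)),
      mul_le_mul_of_nonneg_left h2 (abs_nonneg (base ζm ζp a))]
  have hne : ∀ v ∈ Set.uIcc s t, φ v ≠ 0 := fun v hv h0 => by
    have := theta_mul_ne_zero_of_between hq0 hq1 hζm hζp (hbt v hv).1 (hbt v hv).2 hx
    rw [hφ, h0] at this
    exact this rfl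
  have hcont : ContinuousOn φ (Set.uIcc s t) := by
    intro v hv
    have hv0 : v ≠ 0 := by
      rintro rfl
      have := (hbt 0 hv).1
      rw [mul_zero] at this
      exact this.not_gt (zpow_pos hq0 _)
    have h1 : ContinuousAt (fun v : ℝ => theta q (x * v)) v :=
      ContinuousAt.comp (f := fun v : ℝ => (x * v : ℂ))
        (continuousAt_theta hq0 hq1 (by exact_mod_cast mul_ne_zero hx0 hv0)) (by fun_prop)
    exact (Complex.continuous_re.continuousAt.comp h1).continuousWithinAt
  refine ⟨φ s * φ t, ?_, by rw [hφ, hφ]; push_cast; rfl⟩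
  by_contra! hle
  have h0 : (0 : ℝ) ∈ Set.uIcc (φ s) (φ t) := by
    rw [Set.mem_uIcc]
    rcases le_total 0 (φ s) with h | h <;> rcases le_total 0 (φ t) with h' | h'
    · rcases h.eq_or_lt with h2 | h2
      · left; exact ⟨h2.symm.le, h'⟩
      · right; exact ⟨by nlinarith, h⟩
    · right; exact ⟨h', h⟩
    · left; exact ⟨h, h'⟩
    · rcases h.eq_or_lt with h2 | h2
      · right; exact ⟨h', h2.symm.le⟩
      · left; exact ⟨h, by nlinarith⟩
  obtain ⟨v, hv, hv0⟩ := intermediate_value_uIcc hcont h0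
  exact hne v hv hv0

/-- Two points of one open interval whose endpoints have ratio `q` have ratio in `(q, q⁻¹)`, and
`|t|/√(st)` is the square root of `t/s`. -/
theorem good_of_between (hq0 : 0 < q) (hq1 : q < 1) (hζm : ζm < 0) (hζp : 0 < ζp)
    {s t : ℝ} {a : Bool} {n : ℤ} (hs : q ^ (n + 1) < base ζm ζp a * s)
    (hs' : base ζm ζp a * s < q ^ n) (ht : q ^ (n + 1) < base ζm ζp a * t)
    (ht' : base ζm ζp a * t < q ^ n) : ∃ R, Good q ζm ζp s t R := by
  have hq := zpow_add_one₀ hq0.ne' n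
  have hn := zpow_pos hq0 (n + 1)
  have hs0 : 0 < base ζm ζp a * s := hn.trans hs
  have ht0 : 0 < base ζm ζp a * t := hn.trans ht
  have hb : base ζm ζp a ≠ 0 := by exact_mod_cast base_ne_zero hζm hζp a
  have hb2 : 0 < base ζm ζp a ^ 2 := by positivity
  have hst : 0 < s * t := by nlinarith [mul_pos hs0 ht0]
  have h1 : q * (s * t) < t ^ 2 := by
    have e1 : q * (base ζm ζp a * s) < base ζm ζp a * t := by nlinarith
    have := mul_lt_mul_of_pos_right e1 ht0
    by_contra! h
    nlinarith [mul_le_mul_of_nonneg_left h hb2.le]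
  have h2 : q * t ^ 2 < s * t := by
    have e1 : q * (base ζm ζp a * t) < base ζm ζp a * s := by nlinarith
    have := mul_lt_mul_of_pos_right e1 ht0
    by_contra! h
    nlinarith [mul_le_mul_of_nonneg_left h hb2.le]
  have hnorm : ‖(t : ℂ) / (√(s * t) : ℝ)‖ = |t| / √(s * t) := by
    rw [norm_div, Complex.norm_real, norm_ofReal_of_pos (Real.sqrt_pos.2 hst), Real.norm_eq_abs]
  refine ⟨s * t, hq0, hq1, hζm, hζp, fun x hx =>
    theta_mul_theta_pos hq0 hq1 hζm hζp hs hs' ht ht' hx, hst, by push_cast; rfl, ?_, ?_,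
    Or.inr ⟨Complex.conj_ofReal s, Complex.conj_ofReal t⟩⟩
  · rw [hnorm, lt_div_iff₀ (Real.sqrt_pos.2 hst), ← Real.sqrt_mul hq0.le, ← Real.sqrt_sq_eq_abs]
    exact Real.sqrt_lt_sqrt (by positivity) h1
  · rw [hnorm, ← mul_div_assoc, div_lt_one (Real.sqrt_pos.2 hst), ← Real.sqrt_sq_eq_abs,
      ← Real.sqrt_mul hq0.le]
    exact Real.sqrt_lt_sqrt (by positivity) h2

/-- In the principal series `γδ = |γ|²`, the quotient `δ/√(γδ)` is unimodular, and the radicand is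
`|θ(xγ)|²`. In the complementary series both parameters lie in one interval free of zeros. -/
theorem Admissible.good (hq0 : 0 < q) (hq1 : q < 1) (hζm : ζm < 0) (hζp : 0 < ζp)
    (h : Admissible q ζm ζp γ δ) : ∃ R, Good q ζm ζp γ δ R := by
  rcases h with ⟨him, rfl⟩ | ⟨s, t, rfl, rfl, ⟨m, ⟨h1, h2⟩, h3, h4⟩ | ⟨n, ⟨h1, h2⟩, h3, h4⟩⟩
  · have hγ0 : γ ≠ 0 := by rintro rfl; simp at him
    have hn : 0 < ‖γ‖ := norm_pos_iff.2 hγ0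
    have hs1 : √q < 1 := by rw [Real.sqrt_lt' one_pos]; simpa using hq1
    have hnorm : ‖conj γ / ((√(‖γ‖ ^ 2) : ℝ) : ℂ)‖ = 1 := by
      rw [Real.sqrt_sq hn.le, norm_div, RCLike.norm_conj, norm_ofReal_of_pos hn, div_self hn.ne']
    refine ⟨‖γ‖ ^ 2, hq0, hq1, hζm, hζp, fun x hx => ?_, by positivity, ?_, ?_, ?_,
      Or.inl ⟨rfl, Complex.conj_conj γ⟩⟩
    · have hx0 := ne_zero_of_mem_lattice hq0 hζm hζp hx
      have hθ : theta q (x * γ) ≠ 0 := by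
        refine theta_ne_zero hq0 hq1 (mul_ne_zero (by exact_mod_cast hx0) hγ0) fun n hn => ?_
        have h1 : (x * γ : ℂ).im = 0 := by
          rw [hn]; exact_mod_cast Complex.ofReal_im (q ^ n)
        rw [Complex.im_ofReal_mul] at h1
        exact (mul_ne_zero hx0 him) h1
      refine ⟨‖theta q (x * γ)‖ ^ 2, by positivity, ?_⟩
      have e : (x * conj γ : ℂ) = conj (x * γ) := by rw [map_mul, Complex.conj_ofReal]
      rw [e, theta_conj, Complex.mul_conj, Complex.normSq_eq_norm_sq]
    · rw [Complex.mul_conj, Complex.normSq_eq_norm_sq]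
    · rw [hnorm]; exact hs1
    · rw [hnorm, mul_one]; exact hs1
  -- Multiplication by the negative base point reverses the interval, so both branches land in
  -- `(q^(n+1), q^n)`.
  · refine good_of_between hq0 hq1 hζm hζp (a := false) (n := m) ?_ ?_ ?_ ?_ <;>
      simp only [base, cond_false]
    · have := mul_lt_mul_of_neg_left h2 hζm
      rwa [mul_inv_cancel_left₀ hζm.ne] at this
    · have := mul_lt_mul_of_neg_left h1 hζm
      rwa [mul_inv_cancel_left₀ hζm.ne] at this
    · have := mul_lt_mul_of_neg_left h4 hζm
      rwa [mul_inv_cancel_left₀ hζm.ne] at this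
    · have := mul_lt_mul_of_neg_left h3 hζm
      rwa [mul_inv_cancel_left₀ hζm.ne] at this
  · refine good_of_between hq0 hq1 hζm hζp (a := true) (n := n) ?_ ?_ ?_ ?_ <;>
      simp only [base, cond_true]
    · have := mul_lt_mul_of_pos_left h1 hζp
      rwa [mul_inv_cancel_left₀ hζp.ne'] at this
    · have := mul_lt_mul_of_pos_left h2 hζp
      rwa [mul_inv_cancel_left₀ hζp.ne'] at this
    · have := mul_lt_mul_of_pos_left h3 hζp
      rwa [mul_inv_cancel_left₀ hζp.ne'] at this
    · have := mul_lt_mul_of_pos_left h4 hζp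
      rwa [mul_inv_cancel_left₀ hζp.ne'] at this

end

/-! ### The kernel as a conjugated block Toeplitz matrix -/

section

variable {q ζm ζp R : ℝ} {γ δ : ℂ}

theorem sqrt_ofReal_of_nonneg {p : ℝ} (hp : 0 ≤ p) : Complex.sqrt (p : ℂ) = (√p : ℝ) := by
  rw [Complex.sqrt_of_nonneg (by exact_mod_cast hp), Complex.ofReal_re]

theorem complex_sqrt_sq (z : ℂ) : Complex.sqrt z ^ 2 = z := by
  have := Complex.cpow_nat_inv_pow z two_ne_zero
  rwa [Nat.cast_ofNat] at this

theorem thetaL_conj (hq0 : 0 < q) (hq1 : q < 1) (z : ℂ) :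
    thetaL q (conj z) = conj (thetaL q z) := by
  by_cases hz : z = 0
  · simp [hz, thetaL]
  have h1 := (differentiableAt_theta hq0 hq1 hz).hasDerivAt.conj_conj
  have e : conj ∘ theta q ∘ conj = theta q := by
    funext w
    simp only [Function.comp, theta_conj, Complex.conj_conj]
  have h2 : deriv (theta q) (conj z) = conj (deriv (theta q) z) := by
    have := h1.deriv
    rwa [e] at this
  simp only [thetaL, h2, theta_conj, map_mul, map_div₀]

theorem thetaL_base_mul (hq0 : 0 < q) (hq1 : q < 1) (hζm : ζm < 0) (hζp : 0 < ζp) {c : ℂ}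
    (hc : c ≠ 0) (ht : ∀ x ∈ lattice q ζm ζp, theta q (x * c) ≠ 0) (a : Bool) (n : ℤ) :
    thetaL q ((base ζm ζp a * q ^ n : ℝ) * c) = thetaL q (base ζm ζp a * c) - n := by
  rw [← thetaL_zpow_mul hq0 hq1 (mul_ne_zero (base_ne_zero hζm hζp a) hc) (fun k => ?_) n]
  · push_cast; congr 1; ring
  · have := ht _ (base_mul_mem a k)
    push_cast at this
    convert! this using 2; ring

/-- The Cauchy factor `1/(x - x')` of two lattice points is a Kronecker coefficient in the
difference of exponents, up to a factor in the second point. On the diagonal both sides are zero by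
the convention for division by zero. -/
theorem kronCoeff_base (hq0 : 0 < q) (hζm : ζm < 0) (hζp : 0 < ζp) (a b : Bool) (n m : ℤ) :
    kronCoeff q (base ζm ζp a / base ζm ζp b) (n - m) = -(base ζm ζp b * (q : ℂ) ^ m) /
      ((base ζm ζp a * q ^ n : ℝ) - (base ζm ζp b * q ^ m : ℝ)) := by
  have hqn : (q : ℂ) ≠ 0 := ofReal_ne_zero_of_pos hq0
  have hb := base_ne_zero hζm hζp b
  have hqm : (q : ℂ) ^ m ≠ 0 := zpow_ne_zero m hqn
  have e : (1 - base ζm ζp a / base ζm ζp b * (q : ℂ) ^ (n - m)) =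
      -((base ζm ζp a * q ^ n : ℝ) - (base ζm ζp b * q ^ m : ℝ)) /
        (base ζm ζp b * (q : ℂ) ^ m) := by
    rw [zpow_sub₀ hqn]; push_cast; field_simp; ring
  rw [kronCoeff, e, inv_div, div_neg, neg_div]

theorem kronCoeff_base_self (hζm : ζm < 0) (hζp : 0 < ζp) (a : Bool) :
    kronCoeff q (base ζm ζp a / base ζm ζp a) 0 = 0 := by
  simp [kronCoeff, div_self (base_ne_zero hζm hζp a)]

theorem branchSign_mul_base_mul (hq0 : 0 < q) (hζm : ζm < 0) (hζp : 0 < ζp) (a : Bool) (n : ℤ) :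
    branchSign a * ((base ζm ζp a * q ^ n : ℝ) : ℂ) = (|base ζm ζp a * q ^ n| : ℝ) := by
  rw [abs_mul, abs_of_pos (zpow_pos hq0 n), Complex.ofReal_mul, Complex.ofReal_mul,
    ← branchSign_mul_base hζm hζp a]
  ring

theorem branchSign_mul_base_sqrt (hζm : ζm < 0) (hζp : 0 < ζp) (a : Bool) :
    branchSign a * base ζm ζp a = ((√|base ζm ζp a| : ℝ) : ℂ) ^ 2 := by
  rw [branchSign_mul_base hζm hζp, ← Complex.ofReal_pow, Real.sq_sqrt (abs_nonneg _)]

theorem sqrt_abs_base_ne_zero (hζm : ζm < 0) (hζp : 0 < ζp) (a : Bool) :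
    ((√|base ζm ζp a| : ℝ) : ℂ) ≠ 0 :=
  ofReal_ne_zero_of_pos (Real.sqrt_pos.2 (abs_pos.2 (by
    exact_mod_cast base_ne_zero hζm hζp a)))

theorem zpow_eq_sqrt (hq0 : 0 < q) (m : ℤ) :
    (q : ℂ) ^ m = ((√q : ℝ) : ℂ) ^ m * ((√q : ℝ) : ℂ) ^ m := by
  rw [← mul_zpow, ← Complex.ofReal_mul, Real.mul_self_sqrt hq0.le]

theorem base_mul_ne (hq0 : 0 < q) (hq1 : q < 1) (hζm : ζm < 0) (hζp : 0 < ζp) {a b : Bool}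
    {n m : ℤ} (h : (a, n) ≠ (b, m)) : base ζm ζp a * q ^ n ≠ base ζm ζp b * q ^ m :=
  fun e => h ((latticeEquiv hq0 hq1 hζm hζp).injective (Subtype.ext e))

/-- The diagonal conjugation that turns the kernel into a block Toeplitz matrix. -/
def gauge (q ζm ζp : ℝ) (γ δ : ℂ) (p : Bool × ℤ) : ℂ :=
  (-branchSign p.1) ^ p.2 * ((√|base ζm ζp p.1| : ℝ) /
    Complex.sqrt (theta q (base ζm ζp p.1 * γ) * theta q (base ζm ζp p.1 * δ)))

namespace Good

theorem ne (h : Good q ζm ζp γ δ R) : γ ≠ 0 ∧ δ ≠ 0 := by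
  have : γ * δ ≠ 0 := by rw [h.prod]; exact ofReal_ne_zero_of_pos h.hR
  exact ⟨left_ne_zero_of_mul this, right_ne_zero_of_mul this⟩

theorem theta_ne (h : Good q ζm ζp γ δ R) {x : ℝ} (hx : x ∈ lattice q ζm ζp) :
    theta q (x * γ) ≠ 0 ∧ theta q (x * δ) ≠ 0 := by
  obtain ⟨p, hp, e⟩ := h.pos x hx
  have : theta q (x * γ) * theta q (x * δ) ≠ 0 := by rw [e]; exact ofReal_ne_zero_of_pos hp
  exact ⟨left_ne_zero_of_mul this, right_ne_zero_of_mul this⟩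

theorem sqrt_R_ne (h : Good q ζm ζp γ δ R) : ((√R : ℝ) : ℂ) ≠ 0 :=
  ofReal_ne_zero_of_pos (Real.sqrt_pos.2 h.hR)

theorem sqrt_R_mul (h : Good q ζm ζp γ δ R) : ((√R : ℝ) : ℂ) * (√R : ℝ) = γ * δ := by
  rw [h.prod, ← Complex.ofReal_mul, Real.mul_self_sqrt h.hR.le]

theorem param (h : Good q ζm ζp γ δ R) : Param q ζm ζp γ δ (√R : ℝ) (δ / (√R : ℝ)) := by
  have h0 := h.sqrt_R_ne
  have hδ := h.ne.2
  refine ⟨h.hq0, h.hq1, h.hζm, h.hζp, h0, ?_, ?_, h.lower, h.upper,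
    fun a => (h.theta_ne (base_mem a)).1, fun a => (h.theta_ne (base_mem a)).2⟩
  · rw [div_div_eq_mul_div, h.sqrt_R_mul]; field_simp
  · field_simp

theorem theta_prod_ne (h : Good q ζm ζp γ δ R) : theta q (γ * δ * ζm * ζp) ≠ 0 := by
  rw [h.prod, ← Complex.ofReal_mul, ← Complex.ofReal_mul]
  exact theta_of_neg_ne_zero h.hq0 h.hq1
    (mul_neg_of_neg_of_pos (mul_neg_of_pos_of_neg h.hR h.hζm) h.hζp)

/-- Two applications of the functional equation divide the radicand by `x² γδ = x² R`. The principal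
root is multiplicative here because all quantities are positive. -/
theorem sqrt_rad_q_mul (h : Good q ζm ζp γ δ R) {x : ℝ} (hx : x ∈ lattice q ζm ζp) :
    Complex.sqrt (theta q ((q * x : ℝ) * γ) * theta q ((q * x : ℝ) * δ)) =
      Complex.sqrt (theta q (x * γ) * theta q (x * δ)) / (|x| * √R : ℝ) := by
  have hx0 := ne_zero_of_mem_lattice h.hq0 h.hζm h.hζp hx
  have hxc : (x : ℂ) ≠ 0 := by exact_mod_cast hx0
  obtain ⟨hγ, hδ⟩ := h.ne
  obtain ⟨p, hp, e⟩ := h.pos x hx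
  have hR := h.hR
  have h1 : theta q ((q * x : ℝ) * γ) * theta q ((q * x : ℝ) * δ) = (p / (x ^ 2 * R) : ℝ) := by
    rw [Complex.ofReal_mul, mul_assoc, mul_assoc, theta_q_mul h.hq0 h.hq1 (mul_ne_zero hxc hγ),
      theta_q_mul h.hq0 h.hq1 (mul_ne_zero hxc hδ)]
    push_cast
    rw [← e, ← h.prod]
    field_simp
  rw [h1, e, sqrt_ofReal_of_nonneg hp.le, sqrt_ofReal_of_nonneg (by positivity),
    Real.sqrt_div hp.le, Real.sqrt_mul (by positivity), Real.sqrt_sq_eq_abs]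
  push_cast
  rfl

theorem sqrt_rad_ne (h : Good q ζm ζp γ δ R) {x : ℝ} (hx : x ∈ lattice q ζm ζp) :
    Complex.sqrt (theta q (x * γ) * theta q (x * δ)) ≠ 0 := by
  obtain ⟨p, hp, e⟩ := h.pos x hx
  rw [e, sqrt_ofReal_of_nonneg hp.le]
  exact ofReal_ne_zero_of_pos (Real.sqrt_pos.2 hp)

theorem P_Q_q_mul (h : Good q ζm ζp γ δ R) {x : ℝ} (hx : x ∈ lattice q ζm ζp) {s : ℂ}
    (hs : s * x = (|x| : ℝ)) :
    P q γ δ (q * x) = -s * (√q : ℝ) / (δ / (√R : ℝ)) * P q γ δ x ∧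
      Q q γ δ (q * x) = -s * (√q : ℝ) * (δ / (√R : ℝ)) * Q q γ δ x := by
  have hx0 := ne_zero_of_mem_lattice h.hq0 h.hζm h.hζp hx
  have hxc : (x : ℂ) ≠ 0 := by exact_mod_cast hx0
  obtain ⟨hγ, hδ⟩ := h.ne
  have h0 := h.sqrt_R_ne
  have h1 := h.sqrt_rad_ne hx
  have hRR := h.sqrt_R_mul
  have e1 : (Real.sqrt |q * x| : ℂ) = (√q : ℝ) * (√|x| : ℝ) := by
    rw [abs_mul, abs_of_pos h.hq0, Real.sqrt_mul h.hq0.le]; push_cast; rfl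
  have hsx : ((|x| : ℝ) : ℂ) ≠ 0 := by exact_mod_cast abs_ne_zero.2 hx0
  unfold P Q
  rw [h.sqrt_rad_q_mul hx, e1, Complex.ofReal_mul q x, mul_assoc (q : ℂ), mul_assoc (q : ℂ),
    theta_q_mul h.hq0 h.hq1 (mul_ne_zero hxc hγ), theta_q_mul h.hq0 h.hq1 (mul_ne_zero hxc hδ),
    Complex.ofReal_mul |x|, ← hs]
  generalize ((√R : ℝ) : ℂ) = r at *
  generalize Complex.sqrt (theta q (x * γ) * theta q (x * δ)) = D at *
  generalize theta q (x * γ) = A at *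
  generalize theta q (x * δ) = B at *
  generalize ((√|x| : ℝ) : ℂ) = X at *
  generalize ((√q : ℝ) : ℂ) = ρ at *
  constructor
  · field_simp
  · field_simp
    linear_combination -(ρ * X * s * A) * hRR

/-- Along a branch `|x|/x` is the constant `branchSign a`, so the multipliers for a shift by `q` do
not change and simply accumulate. -/
theorem P_Q_zpow (h : Good q ζm ζp γ δ R) (a : Bool) (n : ℤ) :
    P q γ δ (base ζm ζp a * q ^ n) =
        (-branchSign a * (√q : ℝ) / (δ / (√R : ℝ))) ^ n * P q γ δ (base ζm ζp a) ∧
      Q q γ δ (base ζm ζp a * q ^ n) =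
        (-branchSign a * (√q : ℝ) * (δ / (√R : ℝ))) ^ n * Q q γ δ (base ζm ζp a) := by
  have hy : δ / (√R : ℝ) ≠ 0 := div_ne_zero h.ne.2 h.sqrt_R_ne
  have hs : branchSign a ≠ 0 := by cases a <;> simp [branchSign]
  have hq : ((√q : ℝ) : ℂ) ≠ 0 := ofReal_ne_zero_of_pos (Real.sqrt_pos.2 h.hq0)
  have c1 : -branchSign a * (√q : ℝ) / (δ / (√R : ℝ)) ≠ 0 :=
    div_ne_zero (mul_ne_zero (neg_ne_zero.2 hs) hq) hy
  have c2 : -branchSign a * (√q : ℝ) * (δ / (√R : ℝ)) ≠ 0 :=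
    mul_ne_zero (mul_ne_zero (neg_ne_zero.2 hs) hq) hy
  have step : ∀ n : ℤ, P q γ δ (base ζm ζp a * q ^ (n + 1)) =
      -branchSign a * (√q : ℝ) / (δ / (√R : ℝ)) * P q γ δ (base ζm ζp a * q ^ n) ∧
      Q q γ δ (base ζm ζp a * q ^ (n + 1)) =
      -branchSign a * (√q : ℝ) * (δ / (√R : ℝ)) * Q q γ δ (base ζm ζp a * q ^ n) := by
    intro n
    have e : base ζm ζp a * q ^ (n + 1) = q * (base ζm ζp a * q ^ n) := by
      rw [zpow_add_one₀ h.hq0.ne']; ring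
    rw [e]
    exact h.P_Q_q_mul (base_mul_mem a n) (branchSign_mul_base_mul h.hq0 h.hζm h.hζp a n)
  generalize -branchSign a * (√q : ℝ) / (δ / (√R : ℝ)) = u at *
  generalize -branchSign a * (√q : ℝ) * (δ / (√R : ℝ)) = v at *
  induction n with
  | zero => simp
  | succ n ih =>
    rw [(step n).1, (step n).2, ih.1, ih.2, zpow_add_one₀ c1, zpow_add_one₀ c2]
    constructor <;> ring
  | pred n ih =>
    have h1 := step (-n - 1)
    rw [sub_add_cancel, ih.1, ih.2] at h1
    constructor
    · apply mul_left_cancel₀ c1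
      rw [← h1.1, zpow_sub_one₀ c1]; field_simp
    · apply mul_left_cancel₀ c2
      rw [← h1.2, zpow_sub_one₀ c2]; field_simp

/-- `P` and `Q` are a common function `N` times `θ(xδ)` and `θ(xγ)`. In the Wronskian `N'` cancels,
and `N² θ(xγ)θ(xδ) = |x|` leaves a difference of logarithmic derivatives. -/
theorem kernel_diag (h : Good q ζm ζp γ δ R) {x : ℝ} (hx : x ∈ lattice q ζm ζp) {s : ℂ}
    (hs : s * x = (|x| : ℝ)) (C : ℂ) :
    C * (deriv (P q γ δ) x * Q q γ δ x - deriv (Q q γ δ) x * P q γ δ x) =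
      C * (s * (thetaL q (x * δ) - thetaL q (x * γ))) := by
  have hx0 := ne_zero_of_mem_lattice h.hq0 h.hζm h.hζp hx
  have hxc : (x : ℂ) ≠ 0 := by exact_mod_cast hx0
  obtain ⟨hγ, hδ⟩ := h.ne
  obtain ⟨tγ, tδ⟩ := h.theta_ne hx
  obtain ⟨p, hp, e⟩ := h.pos x hx
  have hS := h.sqrt_rad_ne hx
  have hdθ : ∀ c : ℂ, c ≠ 0 → HasDerivAt (fun z => theta q (z * c))
      (deriv (theta q) (x * c) * c) (x : ℂ) := fun c hc => by
    have h1 : HasDerivAt (fun z : ℂ => z * c) c x := by simpa using (hasDerivAt_id (x : ℂ)).mul_const c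
    exact HasDerivAt.comp (x : ℂ) (h₂ := theta q)
      (differentiableAt_theta h.hq0 h.hq1 (mul_ne_zero hxc hc)).hasDerivAt h1
  have hrad : DifferentiableAt ℂ
      (fun z => Complex.sqrt (theta q (z * γ) * theta q (z * δ))) (x : ℂ) := by
    refine DifferentiableAt.cpow_const (c := 2⁻¹)
      ((hdθ γ hγ).mul (hdθ δ hδ)).differentiableAt ?_
    rw [e]
    exact Complex.ofReal_mem_slitPlane.2 hp
  obtain ⟨N', hN⟩ : ∃ N', HasDerivAt (fun t : ℝ => (Real.sqrt |t| : ℂ) /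
      Complex.sqrt (theta q (t * γ) * theta q (t * δ))) N' x := by
    have h1 : DifferentiableAt ℝ (fun t : ℝ => √|t|) x :=
      (differentiableAt_id.abs hx0).sqrt (abs_ne_zero.2 hx0)
    exact ⟨_, h1.hasDerivAt.ofReal_comp.div hrad.hasDerivAt.comp_ofReal hS⟩
  have hP := hN.mul (hdθ δ hδ).comp_ofReal
  have hQ := hN.mul (hdθ γ hγ).comp_ofReal
  have eP : P q γ δ = (fun t : ℝ => (Real.sqrt |t| : ℂ) /
      Complex.sqrt (theta q (t * γ) * theta q (t * δ))) * fun t : ℝ => theta q (t * δ) := by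
    funext t; simp only [P, Pi.mul_apply]; ring
  have eQ : Q q γ δ = (fun t : ℝ => (Real.sqrt |t| : ℂ) /
      Complex.sqrt (theta q (t * γ) * theta q (t * δ))) * fun t : ℝ => theta q (t * γ) := by
    funext t; simp only [Q, Pi.mul_apply]; ring
  rw [eP, eQ, hP.deriv, hQ.deriv]
  simp only [Pi.mul_apply]
  have hsq := complex_sqrt_sq (theta q (x * γ) * theta q (x * δ))
  have hX : ((√|x| : ℝ) : ℂ) ^ 2 = s * x := by
    rw [hs, ← Complex.ofReal_pow, Real.sq_sqrt (abs_nonneg x)]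
  unfold thetaL
  generalize Complex.sqrt (theta q (x * γ) * theta q (x * δ)) = D at *
  generalize theta q (x * γ) = A at *
  generalize theta q (x * δ) = B at *
  generalize ((√|x| : ℝ) : ℂ) = X at *
  have hN2 : (X / D) ^ 2 * (A * B) = s * x := by
    rw [div_pow, hsq, hX]; field_simp
  generalize X / D = N at *
  field_simp
  linear_combination C * (deriv (theta q) (x * δ) * δ * A - deriv (theta q) (x * γ) * γ * B) * hN2

/-- The kernel for distinct parameters is conjugate to a block Toeplitz matrix. -/
theorem kernelNe_eq (h : Good q ζm ζp γ δ R) (p p' : Bool × ℤ) :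
    kernelNe q ζm ζp γ δ (base ζm ζp p.1 * q ^ p.2) (base ζm ζp p'.1 * q ^ p'.2) =
      gauge q ζm ζp γ δ p *
        toep q ζm ζp γ δ (δ / (√R : ℝ)) (constC q ζm ζp γ δ) p.1 p'.1 (p.2 - p'.2) /
        gauge q ζm ζp γ δ p' := by
  obtain ⟨a, n⟩ := p
  obtain ⟨b, m⟩ := p'
  have hy : δ / (√R : ℝ) ≠ 0 := div_ne_zero h.ne.2 h.sqrt_R_ne
  have hs : ∀ a, -branchSign a ≠ 0 := fun a => by cases a <;> simp [branchSign]
  have hq : ((√q : ℝ) : ℂ) ≠ 0 := ofReal_ne_zero_of_pos (Real.sqrt_pos.2 h.hq0)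
  have hD := fun a => h.sqrt_rad_ne (base_mem (q := q) a)
  have hB := sqrt_abs_base_ne_zero h.hζm h.hζp
  have hgauge : gauge q ζm ζp γ δ (b, m) ≠ 0 :=
    mul_ne_zero (zpow_ne_zero _ (hs b)) (div_ne_zero (hB b) (hD b))
  unfold kernelNe
  by_cases hxy : (a, n) = (b, m)
  · obtain ⟨rfl, rfl⟩ := Prod.mk.inj hxy
    rw [if_pos rfl, h.kernel_diag (base_mul_mem a n)
      (branchSign_mul_base_mul h.hq0 h.hζm h.hζp a n), sub_self, mul_div_right_comm,
      div_self hgauge, one_mul, 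
      thetaL_base_mul h.hq0 h.hq1 h.hζm h.hζp h.ne.1 fun x hx => (h.theta_ne hx).1,
      thetaL_base_mul h.hq0 h.hq1 h.hζm h.hζp h.ne.2 fun x hx => (h.theta_ne hx).2]
    simp only [toep, kronCoeff_base_self h.hζm h.hζp]
    simp
    ring
  · have hne := base_mul_ne h.hq0 h.hq1 h.hζm h.hζp hxy
    rw [if_neg hne, (h.P_Q_zpow a n).1, (h.P_Q_zpow a n).2, (h.P_Q_zpow b m).1,
      (h.P_Q_zpow b m).2, toep, if_neg (fun hc => hxy (by
        obtain ⟨h1, h2⟩ := hc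
        simp only at h1 h2
        rw [h1, sub_eq_zero.1 h2]))]
    have hden : ((base ζm ζp a * q ^ n : ℝ) : ℂ) - (base ζm ζp b * q ^ m : ℝ) ≠ 0 :=
      sub_ne_zero.2 (by exact_mod_cast hne)
    have hbb := branchSign_mul_base_sqrt h.hζm h.hζp b
    have hDb := complex_sqrt_sq (theta q (base ζm ζp b * γ) * theta q (base ζm ζp b * δ))
    have hsb : (-branchSign b) ^ m * (-branchSign b) ^ m = 1 := by
      rw [← mul_zpow, neg_mul_neg, branchSign_sq, one_zpow]
    have hB1 := (h.theta_ne (base_mem b)).1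
    have hB2 := (h.theta_ne (base_mem b)).2
    have hsa := zpow_ne_zero n (hs a)
    have hsb' := zpow_ne_zero m (hs b)
    have hDa' := hD a
    have hDb' := hD b
    have hBa := hB a
    have hBb := hB b
    rw [kronCoeff_base h.hq0 h.hζm h.hζp, zpow_eq_sqrt h.hq0]
    simp only [gauge, P, Q]
    clear hgauge hxy hne hs hD hB
    generalize ((base ζm ζp a * q ^ n : ℝ) : ℂ) - (base ζm ζp b * q ^ m : ℝ) = d at *
    generalize δ / (√R : ℝ) = y at *
    generalize ((√q : ℝ) : ℂ) = ρ at *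
    have hyn := zpow_ne_zero n hy
    have hym := zpow_ne_zero m hy
    have hρn := zpow_ne_zero n hq
    have hρm := zpow_ne_zero m hq
    have e1 : ∀ (c : Bool) (k : ℤ), (-branchSign c * ρ / y) ^ k = (-branchSign c) ^ k * ρ ^ k / y ^ k :=
      fun c k => by rw [div_zpow, mul_zpow]
    have e2 : ∀ (c : Bool) (k : ℤ), (-branchSign c * ρ * y) ^ k = (-branchSign c) ^ k * ρ ^ k * y ^ k :=
      fun c k => by rw [mul_zpow, mul_zpow]
    have e3 : (ρ / y) ^ (n - m) = ρ ^ n / ρ ^ m / (y ^ n / y ^ m) := by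
      rw [div_zpow, zpow_sub₀ hq, zpow_sub₀ hy]
    have e4 : (ρ * y) ^ (n - m) = ρ ^ n / ρ ^ m * (y ^ n / y ^ m) := by
      rw [mul_zpow, zpow_sub₀ hq, zpow_sub₀ hy]
    rw [e1, e1, e2, e2, e3, e4]
    clear e1 e2 e3 e4
    generalize Complex.sqrt (theta q (base ζm ζp a * γ) * theta q (base ζm ζp a * δ)) = Da at *
    generalize Complex.sqrt (theta q (base ζm ζp b * γ) * theta q (base ζm ζp b * δ)) = Db at *
    generalize theta q (base ζm ζp a * γ) = A₁, theta q (base ζm ζp a * δ) = A₂,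
      theta q (base ζm ζp b * γ) = B₁, theta q (base ζm ζp b * δ) = B₂ at *
    generalize y ^ n = yn, y ^ m = ym, ρ ^ n = ρn, ρ ^ m = ρm at *
    generalize (-branchSign a) ^ n = sa, (-branchSign b) ^ m = sb at *
    generalize ((√|base ζm ζp a| : ℝ) : ℂ) = Xa, ((√|base ζm ζp b| : ℝ) : ℂ) = Xb at *
    generalize constC q ζm ζp γ δ = C
    -- The one-sided prefactor of `toep` is a square: `s_b ζ_b = |ζ_b|`, and the theta product is
    -- `Db²`. One root belongs to `P` and `Q` at the second point, the other to the gauge.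
    have e5 : -C * branchSign b / (B₁ * B₂) * (-(base ζm ζp b * (ρm * ρm)) / d * (A₂ * B₁ *
        (ρn / ρm / (yn / ym)) - A₁ * B₂ * (ρn / ρm * (yn / ym)))) =
        C / Db ^ 2 * (Xb ^ 2 * ρm / d * (A₂ * B₁ * (ρn / (yn / ym)) -
          A₁ * B₂ * (ρn * (yn / ym)))) := by
      rw [hDb, ← hbb]
      field_simp
    have e6 : sb⁻¹ = sb := inv_eq_of_mul_eq_one_left hsb
    rw [zero_add, e5, div_eq_mul_inv _ (sb * _), mul_inv, e6]
    field_simp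

end Good

end

section

variable {q ζm ζp R : ℝ} {γ δ g : ℂ}

/-! ### Equal parameters -/

theorem thetaLog_eq (hg : g ≠ 0) (x : ℝ) : thetaLog q g x = thetaL q (x * g) / g := by
  unfold thetaLog thetaL
  field_simp

theorem theta_zpow_mul_ne_zero (hq0 : 0 < q) (hq1 : q < 1) {z : ℂ} (hz : z ≠ 0)
    (h : theta q z ≠ 0) (n : ℤ) : theta q ((q : ℂ) ^ n * z) ≠ 0 := by
  have hq := ofReal_ne_zero_of_pos hq0
  induction n with
  | zero => simpa using h
  | succ n ih =>
    rw [zpow_add_one₀ hq, mul_comm _ (q : ℂ), mul_assoc,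
      theta_q_mul hq0 hq1 (mul_ne_zero (zpow_ne_zero _ hq) hz)]
    exact mul_ne_zero (neg_ne_zero.2 (inv_ne_zero (mul_ne_zero (zpow_ne_zero _ hq) hz))) ih
  | pred n ih =>
    intro h0
    have hz' := mul_ne_zero (zpow_ne_zero (-(n : ℤ) - 1) hq) hz
    have h1 := theta_q_mul hq0 hq1 hz'
    rw [h0, ← mul_assoc, ← zpow_one_add₀ hq, add_sub_cancel] at h1
    exact ih (by simpa using h1)

/-- The shift rule for `thetaL` is differentiated; it must hold in a neighbourhood, where `θ` still
has no zero. Consequently the diagonal of the kernel is constant along a branch. -/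
theorem deriv_thetaL_zpow_mul (hq0 : 0 < q) (hq1 : q < 1) {z : ℂ} (hz : z ≠ 0)
    (h : ∀ n : ℤ, theta q ((q : ℂ) ^ n * z) ≠ 0) (n : ℤ) :
    (q : ℂ) ^ n * deriv (thetaL q) ((q : ℂ) ^ n * z) = deriv (thetaL q) z := by
  have hqn : (q : ℂ) ^ n ≠ 0 := zpow_ne_zero n (ofReal_ne_zero_of_pos hq0)
  have key : ∀ᶠ w in 𝓝 z, thetaL q ((q : ℂ) ^ n * w) = thetaL q w - n := by
    have hz0 : theta q z ≠ 0 := by simpa using h 0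
    filter_upwards [(continuousAt_theta hq0 hq1 hz).eventually_ne hz0, eventually_ne_nhds hz]
      with w hw hw0
    exact thetaL_zpow_mul hq0 hq1 hw0 (theta_zpow_mul_ne_zero hq0 hq1 hw0 hw) n
  have h1 := Filter.EventuallyEq.deriv_eq key
  rw [deriv_sub_const] at h1
  rw [← h1, ← smul_eq_mul]
  exact (deriv_comp_mul_left ((q : ℂ) ^ n) (thetaL q) z).symm

theorem conj_constC (γ δ : ℂ) :
    conj (constC q ζm ζp γ δ) = constC q ζm ζp (conj γ) (conj δ) := by
  simp only [constC, map_mul, map_div₀, map_sub, ← theta_conj, ← qPoch_conj, Complex.conj_ofReal]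

theorem constC_swap (γ δ : ℂ) :
    constC q ζm ζp δ γ = -constC q ζm ζp γ δ := by
  unfold constC
  rw [mul_comm δ γ, mul_comm (qPoch q (γ / δ)), ← neg_sub δ γ, neg_div, mul_neg]
  ring

theorem P_swap (γ δ : ℂ) (x : ℝ) : P q δ γ x = Q q γ δ x := by
  rw [P, Q, mul_comm (theta q (x * δ))]

namespace Good

/-- The difference of the logarithmic terms vanishes at `t = y`, so the derivative of the square
root does not enter. -/
theorem kernelEq_diag (h : Good q ζm ζp g g R) {y : ℝ} (hy : y ∈ lattice q ζm ζp) :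
    kernelEq q ζm ζp g y y =
      -(constEq q ζm ζp g * ((|y| : ℝ) * deriv (thetaL q) (y * g))) := by
  have hy0 := ne_zero_of_mem_lattice h.hq0 h.hζm h.hζp hy
  have hyc : (y : ℂ) ≠ 0 := by exact_mod_cast hy0
  have hg := h.ne.1
  have h1 : DifferentiableAt ℝ (fun t : ℝ => √|t * y|) y :=
    ((differentiableAt_id.mul_const y).abs (mul_ne_zero hy0 hy0)).sqrt
      (abs_ne_zero.2 (mul_ne_zero hy0 hy0))
  have h2 : HasDerivAt (fun z : ℂ => z * g) g y := by
    simpa using (hasDerivAt_id (y : ℂ)).mul_const g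
  have h3 : HasDerivAt (fun z : ℂ => thetaL q (z * g)) (deriv (thetaL q) (y * g) * g) y :=
    HasDerivAt.comp (y : ℂ) (h₂ := thetaL q)
      (differentiableAt_thetaL h.hq0 h.hq1 (mul_ne_zero hyc hg) (h.theta_ne hy).1).hasDerivAt h2
  have h4 := (h3.comp_ofReal.div_const g).const_sub (thetaLog q g y)
  have h5 := h1.hasDerivAt.ofReal_comp.mul h4
  have e : (fun t : ℝ => (Real.sqrt |t * y| : ℂ) * (thetaLog q g y - thetaLog q g t)) =
      (fun t : ℝ => ((√|t * y| : ℝ) : ℂ)) * fun t : ℝ => thetaLog q g y - thetaL q (t * g) / g := by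
    funext t
    simp only [Pi.mul_apply, thetaLog_eq hg]
  rw [kernelEq, if_pos rfl, e, h5.deriv, ← thetaLog_eq hg, sub_self, abs_mul,
    Real.sqrt_mul_self (abs_nonneg y)]
  field_simp
  ring

/-- The kernel for equal parameters is conjugate to a block Toeplitz matrix. -/
theorem kernelEq_eq (h : Good q ζm ζp g g R) (p p' : Bool × ℤ) :
    kernelEq q ζm ζp g (base ζm ζp p.1 * q ^ p.2) (base ζm ζp p'.1 * q ^ p'.2) =
      (√|base ζm ζp p.1| : ℝ) / theta q (base ζm ζp p.1 * g) *
        toepEq q ζm ζp g p.1 p'.1 (p.2 - p'.2) /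
        ((√|base ζm ζp p'.1| : ℝ) / theta q (base ζm ζp p'.1 * g)) := by
  obtain ⟨a, n⟩ := p
  obtain ⟨b, m⟩ := p'
  have hg := h.ne.1
  have hB := sqrt_abs_base_ne_zero h.hζm h.hζp
  have hθ : ∀ a, theta q (base ζm ζp a * g) ≠ 0 := fun a => (h.theta_ne (base_mem a)).1
  have hq : ((√q : ℝ) : ℂ) ≠ 0 := ofReal_ne_zero_of_pos (Real.sqrt_pos.2 h.hq0)
  by_cases hxy : (a, n) = (b, m)
  · obtain ⟨rfl, rfl⟩ := Prod.mk.inj hxy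
    have hL := deriv_thetaL_zpow_mul h.hq0 h.hq1
      (mul_ne_zero (base_ne_zero h.hζm h.hζp a) hg) (fun k => by
        have := (h.theta_ne (base_mul_mem a k)).1
        push_cast at this
        convert! this using 2; ring) n
    have hs := branchSign_mul_base h.hζm h.hζp a
    rw [h.kernelEq_diag (base_mul_mem a n), sub_self, mul_div_right_comm,
      div_self (div_ne_zero (hB a) (hθ a)), one_mul, abs_mul, abs_of_pos (zpow_pos h.hq0 n)]
    simp only [toepEq, kronCoeff_base_self h.hζm h.hζp]
    rw [if_pos ⟨trivial, trivial⟩, ← hL, Complex.ofReal_mul |_|, ← hs]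
    have e : ((base ζm ζp a * q ^ n : ℝ) : ℂ) * g = (q : ℂ) ^ n * (base ζm ζp a * g) := by
      push_cast; ring
    rw [e]
    push_cast
    field_simp
    ring
  · have hne := base_mul_ne h.hq0 h.hq1 h.hζm h.hζp hxy
    have hden : ((base ζm ζp a * q ^ n : ℝ) : ℂ) - (base ζm ζp b * q ^ m : ℝ) ≠ 0 :=
      sub_ne_zero.2 (by exact_mod_cast hne)
    have hT : ∀ (c : Bool) (k : ℤ), thetaLog q g (base ζm ζp c * q ^ k) =
        (thetaL q (base ζm ζp c * g) - k) / g := fun c k => by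
      rw [thetaLog_eq hg, thetaL_base_mul h.hq0 h.hq1 h.hζm h.hζp hg
        (fun x hx => (h.theta_ne hx).1)]
    have hX : ((√|base ζm ζp a * q ^ n * (base ζm ζp b * q ^ m)| : ℝ) : ℂ) =
        (√|base ζm ζp a| : ℝ) * (√|base ζm ζp b| : ℝ) *
          (((√q : ℝ) : ℂ) ^ n * ((√q : ℝ) : ℂ) ^ m) := by
      have e : |base ζm ζp a * q ^ n * (base ζm ζp b * q ^ m)| =
          |base ζm ζp a| * |base ζm ζp b| * (√q ^ n * √q ^ m) ^ 2 := by
        rw [mul_pow, pow_two, pow_two, ← mul_zpow, ← mul_zpow, Real.mul_self_sqrt h.hq0.le,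
          abs_mul, abs_mul, abs_mul, abs_of_pos (zpow_pos h.hq0 n), abs_of_pos (zpow_pos h.hq0 m)]
        ring
      rw [e, Real.sqrt_mul (by positivity), Real.sqrt_mul (abs_nonneg _),
        Real.sqrt_sq (by positivity)]
      push_cast
      rfl
    have hbb := branchSign_mul_base_sqrt h.hζm h.hζp b
    rw [kernelEq, if_neg hne, hT, hT, hX, toepEq, if_neg (fun hc => hxy (by
        obtain ⟨h1, h2⟩ := hc
        simp only at h1 h2
        rw [h1, sub_eq_zero.1 h2])), kronCoeff_base h.hq0 h.hζm h.hζp, zpow_eq_sqrt h.hq0,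
        zpow_sub₀ hq, zero_add]
    have hBa := hB a
    have hBb := hB b
    have hA1 := hθ a
    have hA2 := hθ b
    have hρn := zpow_ne_zero n hq
    have hρm := zpow_ne_zero m hq
    push_cast at *
    generalize ((√|base ζm ζp a| : ℝ) : ℂ) = Xa, ((√|base ζm ζp b| : ℝ) : ℂ) = Xb at *
    generalize ((√q : ℝ) : ℂ) ^ n = ρn, ((√q : ℝ) : ℂ) ^ m = ρm at *
    generalize theta q (base ζm ζp a * g) = A, theta q (base ζm ζp b * g) = B at *
    generalize (base ζm ζp a : ℂ) * (q : ℂ) ^ n - base ζm ζp b * (q : ℂ) ^ m = d at *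
    generalize thetaL q (base ζm ζp a * g) = s, thetaL q (base ζm ζp b * g) = t at *
    field_simp
    linear_combination constEq q ζm ζp g * (s - n - (t - m)) * hbb

/-! ### Symmetry -/

theorem conj_rad (h : Good q ζm ζp γ δ R) {x : ℝ} (hx : x ∈ lattice q ζm ζp) :
    conj (Complex.sqrt (theta q (x * γ) * theta q (x * δ))) =
      Complex.sqrt (theta q (x * conj γ) * theta q (x * conj δ)) := by
  obtain ⟨p, hp, e⟩ := h.pos x hx
  have e' : theta q (x * conj γ) * theta q (x * conj δ) = p := by
    rw [← Complex.conj_ofReal x, ← map_mul, ← map_mul, theta_conj, theta_conj, ← map_mul, e,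
      Complex.conj_ofReal]
  rw [e, e', sqrt_ofReal_of_nonneg hp.le, Complex.conj_ofReal]

theorem conj_P_Q (h : Good q ζm ζp γ δ R) {x : ℝ} (hx : x ∈ lattice q ζm ζp) :
    conj (P q γ δ x) = P q (conj γ) (conj δ) x ∧ conj (Q q γ δ x) = Q q (conj γ) (conj δ) x := by
  simp only [P, Q, map_mul, map_div₀, h.conj_rad hx, ← theta_conj, Complex.conj_ofReal, and_self]

/-- For conjugate parameters, conjugation swaps `γ` and `δ`: the constant and the antisymmetric
numerator both change sign. For real parameters every ingredient is real. Exchanging the two points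
flips the numerator and the denominator together. -/
theorem kernelNe_symm (h : Good q ζm ζp γ δ R) {x y : ℝ} (hx : x ∈ lattice q ζm ζp)
    (hy : y ∈ lattice q ζm ζp) :
    kernelNe q ζm ζp γ δ y x = conj (kernelNe q ζm ζp γ δ x y) := by
  have hC := conj_constC (q := q) (ζm := ζm) (ζp := ζp) γ δ
  unfold kernelNe
  by_cases hxy : x = y
  · subst hxy
    have hxc : (x : ℂ) ≠ 0 := by exact_mod_cast ne_zero_of_mem_lattice h.hq0 h.hζm h.hζp hx
    rw [if_pos rfl, h.kernel_diag hx (s := (|x| : ℝ) / x) (div_mul_cancel₀ _ hxc)]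
    simp only [map_mul, map_sub, map_div₀, Complex.conj_ofReal, ← thetaL_conj h.hq0 h.hq1, hC]
    rcases h.symm with ⟨h1, h2⟩ | ⟨h1, h2⟩
    · rw [h1, h2, constC_swap γ δ]; ring
    · rw [h1, h2]
  · rw [if_neg hxy, if_neg (Ne.symm hxy)]
    simp only [map_mul, map_sub, map_div₀, Complex.conj_ofReal, hC, (h.conj_P_Q hx).1,
      (h.conj_P_Q hx).2, (h.conj_P_Q hy).1, (h.conj_P_Q hy).2]
    rw [← neg_sub (x : ℂ) y, div_neg]
    rcases h.symm with ⟨h1, h2⟩ | ⟨h1, h2⟩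
    · rw [h1, h2, constC_swap γ δ, P_swap γ δ x, P_swap γ δ y, ← P_swap δ γ x,
        ← P_swap δ γ y]
      ring
    · rw [h1, h2]; ring

theorem kernelEq_symm (h : Good q ζm ζp g g R) {x y : ℝ} (hx : x ∈ lattice q ζm ζp) :
    kernelEq q ζm ζp g y x = conj (kernelEq q ζm ζp g x y) := by
  have hg : conj g = g := by rcases h.symm with h1 | h1 <;> exact h1.1
  have hC : conj (constEq q ζm ζp g) = constEq q ζm ζp g := by
    simp only [constEq, map_mul, map_div₀, map_pow, ← theta_conj, ← qPoch_conj,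
      Complex.conj_ofReal, hg]
  by_cases hxy : x = y
  · subst hxy
    have hxc : (x : ℂ) ≠ 0 := by exact_mod_cast ne_zero_of_mem_lattice h.hq0 h.hζm h.hζp hx
    have h1 := (differentiableAt_thetaL h.hq0 h.hq1 (mul_ne_zero hxc h.ne.1)
      (h.theta_ne hx).1).hasDerivAt.conj_conj
    have e : conj ∘ thetaL q ∘ conj = thetaL q := by
      funext w
      simp only [Function.comp, thetaL_conj h.hq0 h.hq1, Complex.conj_conj]
    have h2 := h1.deriv
    rw [e, map_mul, Complex.conj_ofReal, hg] at h2
    rw [h.kernelEq_diag hx]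
    simp only [map_neg, map_mul, Complex.conj_ofReal, hC, ← h2]
  · have hT : ∀ t, conj (thetaLog q g t) = thetaLog q g t := fun t => by
      rw [thetaLog_eq h.ne.1, map_div₀, ← thetaL_conj h.hq0 h.hq1, map_mul, Complex.conj_ofReal, hg]
    rw [kernelEq, kernelEq, if_neg hxy, if_neg (Ne.symm hxy)]
    simp only [map_mul, map_sub, map_div₀, Complex.conj_ofReal, hC, hT]
    rw [← neg_sub (x : ℂ) y, div_neg, mul_comm y x]
    ring

end Good

end

/-- The elliptic tail kernel of a good pair defines an orthogonal projection. -/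
theorem Good.exists_projection {q ζm ζp R : ℝ} {γ δ : ℂ} (h : Good q ζm ζp γ δ R) :
    ∃ K : lp (fun _ : lattice q ζm ζp => ℂ) 2 →L[ℂ] lp (fun _ : lattice q ζm ζp => ℂ) 2,
      (∀ (f : lp (fun _ : lattice q ζm ζp => ℂ) 2) (x : lattice q ζm ζp),
        HasSum (fun y : lattice q ζm ζp => kernel q ζm ζp γ δ (x : ℝ) (y : ℝ) * f y) (K f x)) ∧
      K = ContinuousLinearMap.adjoint K ∧ K = K ∘L K := by
  have hB : ∀ a, √|base ζm ζp a| ≠ 0 := fun a => by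
    exact_mod_cast sqrt_abs_base_ne_zero h.hζm h.hζp a
  by_cases hne : γ = δ
  · subst hne
    have hθ : ∀ a, theta q (base ζm ζp a * γ) ≠ 0 := fun a => (h.theta_ne (base_mem a)).1
    have hprod := h.theta_prod_ne
    rw [← pow_two] at hprod
    simp only [kernel, if_true]
    refine exists_projection_of_idemSymbol
      (idemSymbol_toepEq h.hq0 h.hq1 h.hζm h.hζp h.ne.1 hθ hprod)
      (latticeEquiv h.hq0 h.hq1 h.hζm h.hζp)
      (h := fun a => √|base ζm ζp a| / ‖theta q (base ζm ζp a * γ)‖)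
      (fun a => div_ne_zero (hB a) (norm_ne_zero_iff.2 (hθ a))) (fun p => ?_)
      h.kernelEq_eq fun x y => h.kernelEq_symm x.2
    rw [norm_div, Complex.norm_real, Real.norm_of_nonneg (Real.sqrt_nonneg _)]
  · simp only [kernel, if_neg hne]
    refine exists_projection_of_idemSymbol (h.param.idemSymbol hne h.theta_prod_ne)
      (latticeEquiv h.hq0 h.hq1 h.hζm h.hζp)
      (h := fun a => √|base ζm ζp a| /
        ‖Complex.sqrt (theta q (base ζm ζp a * γ) * theta q (base ζm ζp a * δ))‖)
      (fun a => div_ne_zero (hB a) (norm_ne_zero_iff.2 (h.sqrt_rad_ne (base_mem a))))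
      (fun p => ?_) h.kernelNe_eq fun x y => h.kernelNe_symm x.2 y.2
    have hs : ‖-branchSign p.1‖ = 1 := by cases p.1 <;> simp [branchSign]
    rw [gauge, norm_mul, norm_zpow, hs, one_zpow, one_mul, norm_div, Complex.norm_real,
      Real.norm_of_nonneg (Real.sqrt_nonneg _)]

end EllipticTail

end

/-- The elliptic tail kernel defines a bounded operator on `ℓ²` of the two-sided `q`-lattice, and
this operator is an orthogonal projection. -/
theorem theorem6p1 (q ζm ζp : ℝ) (hq0 : 0 < q) (hq1 : q < 1) (hζm : ζm < 0) (hζp : 0 < ζp)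
    (γ δ : ℂ) (hγδ : EllipticTail.Admissible q ζm ζp γ δ) :
    ∃ K : lp (fun _ : EllipticTail.lattice q ζm ζp => ℂ) 2 →L[ℂ]
        lp (fun _ : EllipticTail.lattice q ζm ζp => ℂ) 2,
      (∀ (f : lp (fun _ : EllipticTail.lattice q ζm ζp => ℂ) 2)
          (x : EllipticTail.lattice q ζm ζp),
        HasSum (fun y : EllipticTail.lattice q ζm ζp =>
          EllipticTail.kernel q ζm ζp γ δ (x : ℝ) (y : ℝ) * f y) (K f x)) ∧
      K = ContinuousLinearMap.adjoint K ∧ K = K ∘L K := by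
  obtain ⟨R, h⟩ := hγδ.good hq0 hq1 hζm hζp
  exact h.exists_projection
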